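/- Let $X$ be a (real or complex) Banach space, $1<p<\infty$, $\frac1p+\frac1{p'}=1$, let $\eta:[-1,0]\to\mathcal L(X)$ be of bounded variation (in operator norm), and let $|\eta|([-1,0])$ be its total variation. Then for every $f\in C([-1,0],X)$ the Riemann–Stieltjes integral $\Phi f:=\int_{-1}^0 d\eta\,f$ exists, and it defines a bounded linear operator $\Phi:C([-1,0],X)\to X$. Since $W^{1,p}([-1,0],X)$ is continuously embedded in $C([-1,0],X)$, $\Phi$ is also a bounded operator from $W^{1,p}([-1,0],X)$ to $X$. For a linear operator $A:D(A)\subseteq X\to X$ consider on $\mathcal E:=X\times L^p([-1,0],X)$, normed by $\|x\|+\|f\|_p$, the operator $$\mathcal A\binom{x}{f}:=\binom{Ax+\Phi f}{f'},\qquad D(\mathcal A):=\{(x,f)\in D(A)\times W^{1,p}([-1,0],X): f(0)=x\},$$ and the delay equation $$(DE)\qquad u'(t)=Au(t)+\Phi u_t\ (t\ge 0),\quad u(0)=x,\quad u_0=f,\qquad u_t(\sigma):=u(t+\sigma).$$ A (classical) solution of (DE) is a function $u\in C([-1,\infty),X)\cap C^1([0,\infty),X)$ with $u(t)\in D(A)$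 and $u_t\in W^{1,p}([-1,0],X)$ for all $t\ge0$ that satisfies (DE). The equation (DE) is well-posed if for every $(x,f)\in D(\mathcal A)$ it has a unique solution $u(x,f,\cdot)$, and if $D(\mathcal A)\ni(x_n,f_n)\to(x,f)\in D(\mathcal A)$ in $\mathcal E$ implies that $u(x_n,f_n,t)\to u(x,f,t)$ uniformly for $t$ in compact subintervals of $[0,\infty)$. Then the following hold. 1. Let $A$ be the generator of a strongly continuous semigroup $(S(t))_{t\ge0}$ on $X$, and let $M:=\sup_{r\in[0,1]}\|S(r)\|$. For $r\ge0$ and $\tau\in[-1,0]$ let $(S_rx)(\tau):=S(r+\tau)x$ if $\tau>-r$ and $0$ otherwise, and let $(T_0(r)f)(\tau):=f(r+\tau)$ if $r+\tau\le 0$ and $0$ otherwise. If $(x,f)\in D(\mathcal A)$, then $S_rx+T_0(r)f$ has a continuous representative, and for all $0<t<1$ $$\int_0^t\|\Phi(S_rx+T_0(r)f)\|\,dr\le t^{1/p'}M\,|\eta|([-1,0])\,(\|f\|_p+\|x\|).$$ In particular condition (M) holds: there are $t_0>0$ and $0\le q<1$ with $\int_0^{t_0}\|\Phi(S_rx+T_0(r)f)\|\,dr\le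 q\,(\|f\|_p+\|x\|)$ for all $(x,f)\in D(\mathcal A)$. Moreover, $\mathcal A$ generates a strongly continuous semigroup on $\mathcal E$, and (DE) is well-posed. 2. Let $A$ be closed and densely defined. Then (DE) is well-posed if and only if $A$ generates a strongly continuous semigroup on $X$; and $\mathcal A$ generates a strongly continuous semigroup on $\mathcal E$ if and only if $A$ generates one on $X$. -/

import Mathlib

open MeasureTheory Set Filter Topology
open scoped ENNReal

/-! ### Strongly continuous semigroups and their generators -/

section Semigroup

variable {𝕜 : Type*} [RCLike 𝕜] {E : Type*} [NormedAddCommGroup E] [NormedSpace 𝕜 E]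

/-- `T` is a strongly continuous semigroup on `E`; only the values `T t` with `0 ≤ t` matter. -/
structure IsC0Semigroup (T : ℝ → E →L[𝕜] E) : Prop where
  map_zero : T 0 = ContinuousLinearMap.id 𝕜 E
  map_add : ∀ s t : ℝ, 0 ≤ s → 0 ≤ t → T (s + t) = (T s).comp (T t)
  continuousOn_orbit : ∀ x : E, ContinuousOn (fun t => T t x) (Ici 0)

/-- The (partially defined) linear operator `G` is the generator of `T`: `x ∈ D(G)` and `G x = y`
if and only if `(T h x - x) / h → y` as `h → 0+`. -/
def IsGeneratorOf [NormedSpace ℝ E] (G : E →ₗ.[𝕜] E) (T : ℝ → E →L[𝕜] E) : Prop :=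
  ∀ x y : E, (x, y) ∈ G.graph ↔
    Tendsto (fun h : ℝ => h⁻¹ • (T h x - x)) (𝓝[>] 0) (𝓝 y)

/-- `G` generates a strongly continuous semigroup. -/
def GeneratesC0Semigroup [NormedSpace ℝ E] (G : E →ₗ.[𝕜] E) : Prop :=
  ∃ T : ℝ → E →L[𝕜] E, IsC0Semigroup T ∧ IsGeneratorOf G T

end Semigroup

/-! ### The Riemann-Stieltjes integral -/

section RiemannStieltjes

variable {𝕜 : Type*} [RCLike 𝕜] {X : Type*} [NormedAddCommGroup X] [NormedSpace 𝕜 X]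

/-- `I` is the Riemann-Stieltjes integral `∫_{-1}^0 dη F`: the limit of the sums
`∑ (η (s (i+1)) - η (s i)) (F (τ i))` over the tagged partitions
`-1 = s 0 ≤ s 1 ≤ … ≤ s n = 0`, `τ i ∈ [s i, s (i+1)]`, as the mesh tends to zero. -/
def HasRSIntegral (η : ℝ → X →L[𝕜] X) (F : C(Icc (-1 : ℝ) 0, X)) (I : X) : Prop :=
  ∀ ε : ℝ, 0 < ε → ∃ δ : ℝ, 0 < δ ∧
    ∀ (n : ℕ) (s : ℕ → ℝ) (τ : ℕ → Icc (-1 : ℝ) 0),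
      s 0 = -1 → s n = 0 →
      (∀ i < n, s i ≤ s (i + 1) ∧ s (i + 1) - s i < δ ∧
        (τ i : ℝ) ∈ Icc (s i) (s (i + 1))) →
      ‖(∑ i ∈ Finset.range n, (η (s (i + 1)) - η (s i)) (F (τ i))) - I‖ < ε

/-- The total variation `|η|([-1,0])`. It is finite if `η` is of bounded variation. -/
noncomputable def totalVar (η : ℝ → X →L[𝕜] X) : ℝ :=
  (eVariationOn η (Icc (-1 : ℝ) 0)).toReal

end RiemannStieltjes

/-! ### The spaces `L^p([-1,0],X)` and `W^{1,p}([-1,0],X)` -/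

/-- Lebesgue measure on `[-1,0]`. -/
noncomputable abbrev delayMeasure : Measure ℝ := volume.restrict (Icc (-1 : ℝ) 0)

/-- The space `L^p([-1,0],X)`. -/
abbrev DelayLp (X : Type*) [NormedAddCommGroup X] (p : ℝ≥0∞) : Type _ := Lp X p delayMeasure

section Sobolev

variable {X : Type*} [NormedAddCommGroup X]

/-- `g` is the weak derivative of `f` on `(-1,0)` (to be used for integrable `f` and `g`). -/
def IsWeakDeriv [NormedSpace ℝ X] (f g : ℝ → X) : Prop :=
  ∀ φ : ℝ → ℝ, ContDiff ℝ (⊤ : ℕ∞) φ → HasCompactSupport φ → tsupport φ ⊆ Ioo (-1 : ℝ) 0 →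
    ∫ s in Icc (-1 : ℝ) 0, deriv φ s • f s = - ∫ s in Icc (-1 : ℝ) 0, φ s • g s

/-- `f`, restricted to `[-1,0]`, belongs to `W^{1,p}([-1,0],X)`. -/
def MemW1p [NormedSpace ℝ X] (p : ℝ≥0∞) (f : ℝ → X) : Prop :=
  MemLp f p delayMeasure ∧ ∃ g : ℝ → X, MemLp g p delayMeasure ∧ IsWeakDeriv f g

/-- `F` is the continuous representative of `f` on `[-1,0]`. -/
def IsContRep (F : C(Icc (-1 : ℝ) 0, X)) (f : ℝ → X) : Prop :=
  ∀ᵐ s : ℝ, ∀ hs : s ∈ Icc (-1 : ℝ) 0, f s = F ⟨s, hs⟩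

theorem isContRep_unique {F G : C(Icc (-1 : ℝ) 0, X)} {f : ℝ → X}
    (hF : IsContRep F f) (hG : IsContRep G f) : F = G := by
  have h01 : (-1 : ℝ) ≤ 0 := by norm_num
  have h : IccExtend h01 F =ᵐ[volume.restrict (Icc (-1 : ℝ) 0)] IccExtend h01 G := by
    refine (ae_restrict_iff' measurableSet_Icc).2 ?_
    filter_upwards [hF, hG] with s h1 h2 hs
    rw [IccExtend_of_mem _ _ hs, IccExtend_of_mem _ _ hs, ← h1 hs, ← h2 hs]
  have h' := Measure.eqOn_Icc_of_ae_eq volume (by norm_num) h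
    (F.continuous.Icc_extend' (h := h01)).continuousOn
    (G.continuous.Icc_extend' (h := h01)).continuousOn
  ext ⟨s, hs⟩
  have := h' hs
  rwa [IccExtend_of_mem _ _ hs, IccExtend_of_mem _ _ hs] at this

theorem integrable_test_smul [NormedSpace ℝ X] {p : ℝ≥0∞} [Fact (1 ≤ p)] {ψ : ℝ → ℝ}
    (hψ : Continuous ψ) (f : DelayLp X p) :
    Integrable (fun s => ψ s • f s) delayMeasure := by
  have hf : Integrable f delayMeasure := (Lp.memLp f).integrable Fact.out
  exact IntegrableOn.continuousOn_smul hf hψ.continuousOn isCompact_Icc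

theorem isWeakDeriv_zero_unique [NormedSpace ℝ X] [CompleteSpace X] {p : ℝ≥0∞} [Fact (1 ≤ p)]
    (g : DelayLp X p) (h : IsWeakDeriv (0 : DelayLp X p) g) : g = 0 := by
  have hg : IntegrableOn g (Icc (-1 : ℝ) 0) := (Lp.memLp g).integrable Fact.out
  have h0 : ∀ᵐ s : ℝ, s ∈ Ioo (-1 : ℝ) 0 → g s = 0 := by
    refine isOpen_Ioo.ae_eq_zero_of_integral_contDiff_smul_eq_zero
      (hg.mono_set Ioo_subset_Icc_self).locallyIntegrableOn ?_
    intro φ h1 h2 h3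
    have h4 := h φ h1 h2 h3
    have h5 : ∫ s in Icc (-1 : ℝ) 0, deriv φ s • (0 : DelayLp X p) s = 0 := by
      rw [← integral_zero (α := ℝ) (G := X) (μ := delayMeasure)]
      refine integral_congr_ae ?_
      filter_upwards [Lp.coeFn_zero X p delayMeasure] with s hs
      rw [hs]
      simp
    rw [h5, eq_comm, neg_eq_zero] at h4
    rw [← h4, setIntegral_eq_integral_of_forall_compl_eq_zero]
    intro s hs
    have : φ s = 0 := by
      by_contra hne
      exact hs (Ioo_subset_Icc_self (h3 (subset_tsupport _ hne)))
    rw [this, zero_smul]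
  refine Lp.ext ?_
  refine EventuallyEq.trans ?_ (Lp.coeFn_zero X p delayMeasure).symm
  have h6 : ∀ᵐ s ∂(volume.restrict (Ioo (-1 : ℝ) 0)), g s = 0 :=
    (ae_restrict_iff' measurableSet_Ioo).2 h0
  rw [Measure.restrict_congr_set (Ioo_ae_eq_Icc (μ := volume) (a := (-1 : ℝ)) (b := 0))] at h6
  exact h6

end Sobolev

/-! ### The delay operator matrix and the delay equation -/

section Delay

variable {𝕜 : Type*} [RCLike 𝕜] {X : Type*} [NormedAddCommGroup X] [NormedSpace 𝕜 X]
  [NormedSpace ℝ X] [IsScalarTower ℝ 𝕜 X]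

/-- The set of all `(x, f) ∈ D(A) × W^{1,p}([-1,0],X)` with `f(0) = x`. -/
def delayDomain (p : ℝ≥0∞) (A : X →ₗ.[𝕜] X) : Set (X × DelayLp X p) :=
  {z | z.1 ∈ A.domain ∧ (∃ g : DelayLp X p, IsWeakDeriv z.2 g) ∧
    ∃ F : C(Icc (-1 : ℝ) 0, X), IsContRep F z.2 ∧ F ⟨0, by norm_num⟩ = z.1}

/-- The graph of the operator matrix `(A, Φ; 0, d/dσ)` on `X × L^p([-1,0],X)`: the pairs
`((x, f), (A x + Φ f, f'))` with `x ∈ D(A)`, `f ∈ W^{1,p}` and `f(0) = x`, where `Φ` is applied to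
the continuous representative `F` of `f`. -/
def delayGraph (p : ℝ≥0∞) [Fact (1 ≤ p)] (A : X →ₗ.[𝕜] X) (Φ : C(Icc (-1 : ℝ) 0, X) →L[𝕜] X) :
    Submodule 𝕜 ((X × DelayLp X p) × (X × DelayLp X p)) where
  carrier := {w | ∃ (hx : w.1.1 ∈ A.domain) (F : C(Icc (-1 : ℝ) 0, X)),
    IsContRep F w.1.2 ∧ F ⟨0, by norm_num⟩ = w.1.1 ∧
    w.2.1 = A ⟨w.1.1, hx⟩ + Φ F ∧ IsWeakDeriv w.1.2 w.2.2}
  zero_mem' := by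
    refine ⟨A.domain.zero_mem, 0, ?_, rfl, ?_, ?_⟩
    · have h := (ae_restrict_iff' measurableSet_Icc).1 (Lp.coeFn_zero X p delayMeasure)
      filter_upwards [h] with s hs hs'
      exact hs hs'
    · have : A ⟨0, A.domain.zero_mem⟩ = 0 := A.map_zero
      simp [this]
    · intro φ _ _ _
      have h1 : ∀ ψ : ℝ → ℝ, ∫ s in Icc (-1 : ℝ) 0, ψ s • (0 : DelayLp X p) s = 0 := by
        intro ψ
        rw [← integral_zero (α := ℝ) (G := X) (μ := delayMeasure)]
        refine integral_congr_ae ?_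
        filter_upwards [Lp.coeFn_zero X p delayMeasure] with s hs
        rw [hs]
        simp
      have h2 : ∫ s in Icc (-1 : ℝ) 0, φ s • (0 : DelayLp X p) s = 0 := h1 φ
      calc ∫ s in Icc (-1 : ℝ) 0, deriv φ s • (0 : DelayLp X p) s = 0 := h1 (deriv φ)
        _ = - ∫ s in Icc (-1 : ℝ) 0, φ s • (0 : DelayLp X p) s := by rw [h2, neg_zero]
  add_mem' := by
    rintro ⟨⟨x, f⟩, ⟨y, g⟩⟩ ⟨⟨x', f'⟩, ⟨y', g'⟩⟩ ⟨hx, F, hF, hF0, hy, hg⟩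
      ⟨hx', F', hF', hF0', hy', hg'⟩
    refine ⟨A.domain.add_mem hx hx', F + F', ?_, ?_, ?_, ?_⟩
    · have h := (ae_restrict_iff' measurableSet_Icc).1 (Lp.coeFn_add f f')
      filter_upwards [h, hF, hF'] with s hs h1 h2 hs'
      exact (hs hs').trans (by simp [h1 hs', h2 hs'])
    · simpa using congrArg₂ (· + ·) hF0 hF0'
    · have h := A.map_add ⟨x, hx⟩ ⟨x', hx'⟩
      simp only [Prod.mk_add_mk] at hy hy' ⊢
      rw [hy, hy', map_add]
      have h' : A ⟨x + x', A.domain.add_mem hx hx'⟩ = A ⟨x, hx⟩ + A ⟨x', hx'⟩ := h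
      rw [h']
      abel
    · intro φ h1 h2 h3
      have key : ∀ (ψ : ℝ → ℝ), Continuous ψ → ∀ a b : DelayLp X p,
          ∫ s in Icc (-1 : ℝ) 0, ψ s • (a + b : DelayLp X p) s =
          (∫ s in Icc (-1 : ℝ) 0, ψ s • a s) + ∫ s in Icc (-1 : ℝ) 0, ψ s • b s := by
        intro ψ hψ a b
        rw [← integral_add (integrable_test_smul hψ a) (integrable_test_smul hψ b)]
        refine integral_congr_ae ?_
        filter_upwards [Lp.coeFn_add a b] with s hs
        rw [hs, Pi.add_apply, smul_add]
      have hd : Continuous (deriv φ) := h1.continuous_deriv (by simp)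
      have e1 := hg φ h1 h2 h3
      have e2 := hg' φ h1 h2 h3
      simp only [Prod.mk_add_mk] at e1 e2 ⊢
      rw [key _ hd, key _ h1.continuous, e1, e2, neg_add]
  smul_mem' := by
    rintro c ⟨⟨x, f⟩, ⟨y, g⟩⟩ ⟨hx, F, hF, hF0, hy, hg⟩
    refine ⟨A.domain.smul_mem c hx, c • F, ?_, ?_, ?_, ?_⟩
    · have h := (ae_restrict_iff' measurableSet_Icc).1 (Lp.coeFn_smul c f)
      filter_upwards [h, hF] with s hs h1 hs'
      exact (hs hs').trans (by simp [h1 hs'])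
    · simpa using congrArg (c • ·) hF0
    · have h' : A ⟨c • x, A.domain.smul_mem c hx⟩ = c • A ⟨x, hx⟩ := A.map_smul c ⟨x, hx⟩
      simp only [Prod.smul_mk] at hy ⊢
      rw [hy, map_smul, h', smul_add]
    · intro φ h1 h2 h3
      have key : ∀ (ψ : ℝ → ℝ) (a : DelayLp X p),
          ∫ s in Icc (-1 : ℝ) 0, ψ s • (c • a : DelayLp X p) s =
          c • ∫ s in Icc (-1 : ℝ) 0, ψ s • a s := by
        intro ψ a
        rw [← integral_smul]
        refine integral_congr_ae ?_
        filter_upwards [Lp.coeFn_smul c a] with s hs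
        rw [hs, Pi.smul_apply, smul_comm]
      have e1 := hg φ h1 h2 h3
      simp only [Prod.smul_mk] at e1 ⊢
      rw [key, key, e1, smul_neg]

/-- The operator matrix `(A, Φ; 0, d/dσ)` with domain `delayDomain p A` on the Banach space
`X × L^p([-1,0],X)`. -/
noncomputable def delayOp (p : ℝ≥0∞) [Fact (1 ≤ p)] (A : X →ₗ.[𝕜] X)
    (Φ : C(Icc (-1 : ℝ) 0, X) →L[𝕜] X) : (X × DelayLp X p) →ₗ.[𝕜] (X × DelayLp X p) :=
  (delayGraph p A Φ).toLinearPMap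

theorem delayOp_graph [CompleteSpace X] (p : ℝ≥0∞) [Fact (1 ≤ p)] (A : X →ₗ.[𝕜] X)
    (Φ : C(Icc (-1 : ℝ) 0, X) →L[𝕜] X) : (delayOp p A Φ).graph = delayGraph p A Φ := by
  refine Submodule.toLinearPMap_graph_eq _ ?_
  rintro ⟨⟨x, f⟩, ⟨y, g⟩⟩ ⟨hx, F, hF, hF0, hy, hg⟩ h0
  obtain ⟨rfl, rfl⟩ := Prod.mk.inj h0
  have hF' : F = 0 := by
    refine isContRep_unique hF ?_
    have h := (ae_restrict_iff' measurableSet_Icc).1 (Lp.coeFn_zero X p delayMeasure)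
    filter_upwards [h] with s hs hs'
    exact hs hs'
  have h1 : A ⟨0, hx⟩ = 0 := A.map_zero
  have hg' : g = 0 := isWeakDeriv_zero_unique g hg
  have hy' : y = 0 := by
    have h2 : y = A ⟨0, hx⟩ + Φ F := hy
    rw [h2, h1, hF', map_zero, add_zero]
  change (y, g) = 0
  rw [hy', hg']
  rfl

theorem delayOp_domain (p : ℝ≥0∞) [Fact (1 ≤ p)] (A : X →ₗ.[𝕜] X)
    (Φ : C(Icc (-1 : ℝ) 0, X) →L[𝕜] X) :
    ((delayOp p A Φ).domain : Set (X × DelayLp X p)) = delayDomain p A := by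
  ext ⟨x, f⟩
  constructor
  · rintro ⟨⟨z, ⟨y, g⟩⟩, ⟨hx, F, hF, hF0, -, hg⟩, rfl⟩
    exact ⟨hx, ⟨g, hg⟩, F, hF, hF0⟩
  · rintro ⟨hx, ⟨g, hg⟩, F, hF, hF0⟩
    exact ⟨((x, f), (A ⟨x, hx⟩ + Φ F, g)), ⟨hx, F, hF, hF0, rfl, hg⟩, rfl⟩

/-- `u` (of which only the restriction to `[-1,∞)` matters) is a classical solution of
`u'(t) = A u(t) + Φ u_t` for `t ≥ 0`, `u(0) = x`, `u_0 = f`, where `u_t(σ) = u(t + σ)`. -/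
structure IsDelaySolution (p : ℝ≥0∞) (A : X →ₗ.[𝕜] X)
    (Φ : C(Icc (-1 : ℝ) 0, X) →L[𝕜] X) (x : X) (f : DelayLp X p) (u : ℝ → X) : Prop where
  continuousOn : ContinuousOn u (Ici (-1))
  mem_W1p : ∀ t : ℝ, 0 ≤ t → MemW1p p (fun σ => u (t + σ))
  equation : ∃ u' : ℝ → X, ContinuousOn u' (Ici 0) ∧
    ∀ t : ℝ, 0 ≤ t → HasDerivWithinAt u (u' t) (Ici 0) t ∧
      ∃ (ht : u t ∈ A.domain) (U : C(Icc (-1 : ℝ) 0, X)),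
        (∀ σ : Icc (-1 : ℝ) 0, U σ = u (t + σ)) ∧ u' t = A ⟨u t, ht⟩ + Φ U
  initial_value : u 0 = x
  initial_history : u =ᵐ[delayMeasure] f

/-- Well-posedness of the delay equation: existence and uniqueness of classical solutions for all
initial values in `delayDomain p A`, and continuous dependence on the initial values (convergence
in `X × L^p([-1,0],X)`), uniformly for `t` in compact subintervals of `[0,∞)`. -/
structure DelayWellPosed (p : ℝ≥0∞) [Fact (1 ≤ p)] (A : X →ₗ.[𝕜] X)
    (Φ : C(Icc (-1 : ℝ) 0, X) →L[𝕜] X) : Prop where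
  exists_solution : ∀ (x : X) (f : DelayLp X p), (x, f) ∈ delayDomain p A →
    ∃ u : ℝ → X, IsDelaySolution p A Φ x f u
  unique_solution : ∀ (x : X) (f : DelayLp X p), (x, f) ∈ delayDomain p A →
    ∀ u v : ℝ → X, IsDelaySolution p A Φ x f u → IsDelaySolution p A Φ x f v →
      EqOn u v (Ici (-1))
  continuous_dependence : ∀ (x : X) (f : DelayLp X p) (xs : ℕ → X) (fs : ℕ → DelayLp X p)
    (u : ℝ → X) (us : ℕ → ℝ → X), (x, f) ∈ delayDomain p A →
    (∀ n, (xs n, fs n) ∈ delayDomain p A) →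
    Tendsto (fun n => (xs n, fs n)) atTop (𝓝 (x, f)) →
    IsDelaySolution p A Φ x f u → (∀ n, IsDelaySolution p A Φ (xs n) (fs n) (us n)) →
    ∀ b : ℝ, 0 ≤ b → TendstoUniformlyOn us u atTop (Icc 0 b)

/-! ### The Miyadera condition -/

/-- `(S_t x)(τ) = S(t+τ) x` for `-t < τ ≤ 0` and `0` for `-1 ≤ τ ≤ -t`. -/
noncomputable def orbitSegment (S : ℝ → X →L[𝕜] X) (t : ℝ) (x : X) : ℝ → X :=
  fun τ => if -t < τ then S (t + τ) x else 0

/-- The nilpotent left shift semigroup: `(T₀(t) f)(τ) = f(t+τ)` if `t + τ ≤ 0` and `0`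
otherwise. -/
noncomputable def leftShift (t : ℝ) (f : ℝ → X) : ℝ → X :=
  fun τ => if t + τ ≤ 0 then f (t + τ) else 0

/-- The estimate `∫_0^t ‖Φ (S_r x + T₀(r) f)‖ dr ≤ q (‖f‖_p + ‖x‖)` for all `(x, f)` in
`delayDomain p A`. Here `H r` is the continuous representative of `S_r x + T₀(r) f`, so its
existence is part of the assertion. -/
def MiyaderaEstimate (p : ℝ≥0∞) (A : X →ₗ.[𝕜] X) (S : ℝ → X →L[𝕜] X)
    (Φ : C(Icc (-1 : ℝ) 0, X) →L[𝕜] X) (t q : ℝ) : Prop :=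
  ∀ (x : X) (f : DelayLp X p), (x, f) ∈ delayDomain p A →
    ∃ H : ℝ → C(Icc (-1 : ℝ) 0, X),
      (∀ r ∈ Icc 0 t, IsContRep (H r) (orbitSegment S r x + leftShift r f)) ∧
      IntervalIntegrable (fun r => ‖Φ (H r)‖) volume 0 t ∧
      ∫ r in (0 : ℝ)..t, ‖Φ (H r)‖ ≤ q * (‖f‖ + ‖x‖)

/-- Condition (M), where `X × L^p([-1,0],X)` carries the norm `‖x‖ + ‖f‖_p`. -/
def ConditionM (p : ℝ≥0∞) (A : X →ₗ.[𝕜] X) (S : ℝ → X →L[𝕜] X)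
    (Φ : C(Icc (-1 : ℝ) 0, X) →L[𝕜] X) : Prop :=
  ∃ t₀ q : ℝ, 0 < t₀ ∧ 0 ≤ q ∧ q < 1 ∧ MiyaderaEstimate p A S Φ t₀ q

end Delay

/-!
The operator `Φ` is the limit of Riemann-Stieltjes sums over uniform partitions
(`exists_rsOperator`). These sums yield the one estimate on which everything rests: if
`∫_σ^{t+σ} ‖w‖ ≤ B` for all `σ ∈ [-1,0]`, then `∫₀ᵗ ‖Φ w_s‖ ds ≤ |η|([-1,0]) B`
(`hasDelayBound_of_tendsto`), where `w_s` is the history segment `σ ↦ w (s + σ)`. Although `Φ` is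
not bounded on `L^p`, it is thus bounded after integration in time. Hölder's inequality turns this
estimate into the Miyadera estimate (`miyaderaEstimate_of_hasDelayBound`), and it implies a Gronwall
inequality in which the history enters only through its `L¹` norm (`HasDelayBound.gronwall`) and the
convergence of the Neumann series for delay Volterra equations `v = a + ∫₀ᵗ L(t - s) Φ v_s ds`
(`exists_volterra_solution`).

The assertions on generation and well-posedness follow from a cycle of three implications. It avoids
resolvents: a closed operator generates a strongly continuous semigroup as soon as its integrated
Cauchy problem `u(t) = x + G ∫₀ᵗ u` has unique solutions that are locally uniformly bounded by the
initial value, for a dense set of initial values (`generates_of_mild`).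

* If `A` generates a semigroup `S`, then the delay equation is well-posed
  (`delayWellPosed_of_generator`). Solutions satisfy the variation of constants formula
  `u(t) = S(t) x + ∫₀ᵗ S(t - s) Φ u_s ds`, so that uniqueness and continuous dependence follow from
  Gronwall's inequality. To get a classical solution, the Volterra equation is solved for the
  derivative `v = u'`, whose initial history is `f'`. As `f'` is only in `L^p`, it is approximated
  by continuous functions, and Gronwall's inequality gives convergence of the solutions.
* If the delay equation is well-posed, then the operator matrix is a generator
  (`DelayWellPosed.generates`): its mild solutions for initial values in the domain are
  `(u(t), u_t)`, and continuous dependence provides the bound by a scaling argument.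
* If the operator matrix generates a semigroup `T`, then so does `A`
  (`generates_of_delayOp_generates`). A mild solution `v` of `v' = A v` is the first component of
  the solution of the inhomogeneous equation for the operator matrix, with the inhomogeneity
  `(-Φ v_s, 0)` cancelling the delay term; this is a Volterra equation for `v`.

The last two steps need that the second component of a mild solution for the operator matrix is
the history segment of the first one. This is uniqueness for the transport equation
`∂ₜ Q = ∂_σ Q` on `[-1,0]` (`transport_unique`).
-/

/-! ### Integrals in closed subspaces and over triangles -/

section Preliminaries

variable {𝕜 : Type*} [RCLike 𝕜] {E : Type*} [NormedAddCommGroup E] [NormedSpace 𝕜 E]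
  [NormedSpace ℝ E] [IsScalarTower ℝ 𝕜 E]

theorem intervalIntegral_mem_of_isClosed [CompleteSpace E] {K : Submodule 𝕜 E}
    (hK : IsClosed (K : Set E)) {f : ℝ → E} (hf : Continuous f) {a b : ℝ} (hab : a ≤ b)
    (h : ∀ t ∈ Icc a b, f t ∈ K) :
    ∫ t in a..b, f t ∈ K := by
  rcases hab.eq_or_lt with rfl | hlt
  · simp
  have hconv : Convex ℝ (K : Set E) := (K.restrictScalars ℝ).convex
  have h0 : volume (Ioc a b) ≠ 0 := by simp [hlt]
  have h1 : volume (Ioc a b) ≠ ⊤ := by simp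
  have h2 := hconv.set_average_mem hK h0 h1 (f := f)
    ((ae_restrict_iff' measurableSet_Ioc).2 (Eventually.of_forall
      fun t ht => h t (Ioc_subset_Icc_self ht)))
    ((hf.integrableOn_Icc).mono_set Ioc_subset_Icc_self)
  rw [setAverage_eq] at h2
  have h3 : (volume.real (Ioc a b)) • ((volume.real (Ioc a b))⁻¹ • ∫ t in Ioc a b, f t) ∈ K :=
    (K.restrictScalars ℝ).smul_mem _ h2
  rw [smul_smul, mul_inv_cancel₀ ?_, one_smul] at h3
  · rwa [intervalIntegral.integral_of_le hab]
  · simp [Measure.real, hlt.le]; linarith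

theorem intervalIntegral_prodMk [CompleteSpace E] {F : Type*} [NormedAddCommGroup F]
    [NormedSpace ℝ F] [CompleteSpace F] {u : ℝ → E} {v : ℝ → F}
    (hu : Continuous u) (hv : Continuous v) (a b : ℝ) :
    ∫ t in a..b, (u t, v t) = (∫ t in a..b, u t, ∫ t in a..b, v t) := by
  have hi := (hu.prodMk hv).intervalIntegrable (μ := volume) a b
  refine Prod.ext ?_ ?_
  · exact ((ContinuousLinearMap.fst ℝ E F).intervalIntegral_comp_comm hi).symm
  · exact ((ContinuousLinearMap.snd ℝ E F).intervalIntegral_comp_comm hi).symm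

/-- A closed operator commutes with integration. -/
theorem graph_integral_mem [CompleteSpace E] {G : E →ₗ.[𝕜] E} (hG : G.IsClosed) {u v : ℝ → E}
    (hu : Continuous u) (hv : Continuous v) {a b : ℝ} (hab : a ≤ b)
    (h : ∀ t ∈ Icc a b, (u t, v t) ∈ G.graph) :
    (∫ t in a..b, u t, ∫ t in a..b, v t) ∈ G.graph := by
  rw [← intervalIntegral_prodMk hu hv]
  exact intervalIntegral_mem_of_isClosed hG (hu.prodMk hv) hab h

theorem integral_triangle_swap {F : ℝ → ℝ → E} {a b : ℝ} (hab : a ≤ b)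
    (hF : IntegrableOn (Function.uncurry F) (Ioc a b ×ˢ Ioc a b) (volume.prod volume)) :
    ∫ r in a..b, ∫ s in a..r, F r s = ∫ s in a..b, ∫ r in s..b, F r s := by
  set μ : Measure ℝ := volume.restrict (Ioc a b) with hμ
  have hT : MeasurableSet {q : ℝ × ℝ | q.2 ≤ q.1} := measurableSet_le measurable_snd measurable_fst
  have hint : Integrable (Function.uncurry fun r s =>
      {q : ℝ × ℝ | q.2 ≤ q.1}.indicator (Function.uncurry F) (r, s)) (μ.prod μ) := by
    change Integrable ({q : ℝ × ℝ | q.2 ≤ q.1}.indicator (Function.uncurry F)) (μ.prod μ)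
    refine Integrable.indicator ?_ hT
    rw [hμ, Measure.prod_restrict]
    exact hF
  have key := integral_integral_swap hint
  rw [intervalIntegral.integral_of_le hab, intervalIntegral.integral_of_le hab]
  refine Eq.trans ?_ (key.trans ?_)
  · refine setIntegral_congr_fun measurableSet_Ioc fun r hr => ?_
    have : ∀ s, {q : ℝ × ℝ | q.2 ≤ q.1}.indicator (Function.uncurry F) (r, s)
        = (Iic r).indicator (F r) s := fun s => by
      by_cases h : s ≤ r <;> simp [indicator, h]
    simp only [this]
    rw [integral_indicator measurableSet_Iic, hμ, Measure.restrict_restrict measurableSet_Iic,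
      intervalIntegral.integral_of_le hr.1.le]
    congr 2
    ext s; simp only [mem_Ioc, mem_inter_iff, mem_Iic]
    exact ⟨fun h => ⟨h.2, h.1, h.2.trans hr.2⟩, fun h => ⟨h.2.1, h.1⟩⟩
  · refine setIntegral_congr_fun measurableSet_Ioc fun s hs => ?_
    have : ∀ r, {q : ℝ × ℝ | q.2 ≤ q.1}.indicator (Function.uncurry F) (r, s)
        = (Ici s).indicator (fun r => F r s) r := fun r => by
      by_cases h : s ≤ r <;> simp [indicator, h]
    simp only [this]
    rw [integral_indicator measurableSet_Ici, hμ, Measure.restrict_restrict measurableSet_Ici,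
      intervalIntegral.integral_of_le hs.2, ← integral_Icc_eq_integral_Ioc]
    congr 2
    ext r; simp only [mem_Ioc, mem_inter_iff, mem_Icc, mem_Ici]
    exact ⟨fun h => ⟨h.1, h.2.2⟩, fun h => ⟨h.1, hs.1.trans_le h.1, h.2⟩⟩

theorem tendsto_average [CompleteSpace E] {f : ℝ → E} (hf : Continuous f) (a : ℝ) :
    Tendsto (fun h : ℝ => h⁻¹ • ∫ s in a..(a + h), f s) (𝓝[>] 0) (𝓝 (f a)) := by
  have h1 : HasDerivAt (fun t => ∫ s in a..t, f s) (f a) a :=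
    intervalIntegral.integral_hasDerivAt_right (hf.intervalIntegrable _ _)
      hf.stronglyMeasurable.stronglyMeasurableAtFilter hf.continuousAt
  have h2 := h1.tendsto_slope_zero_right
  simpa using h2

end Preliminaries

/-! ### Strongly continuous semigroups -/

section C0

variable {𝕜 : Type*} [RCLike 𝕜] {E : Type*} [NormedAddCommGroup E] [NormedSpace 𝕜 E]

namespace IsC0Semigroup

variable {T : ℝ → E →L[𝕜] E}

/-- Strongly continuous semigroups are locally bounded, by the uniform boundedness principle. -/
theorem exists_bound [CompleteSpace E] (hT : IsC0Semigroup T) (b : ℝ) :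
    ∃ M : ℝ, 0 ≤ M ∧ ∀ t ∈ Icc 0 b, ‖T t‖ ≤ M := by
  obtain ⟨C, hC⟩ := banach_steinhaus (g := fun t : Icc (0 : ℝ) b => T t) (fun x => by
    obtain ⟨C, hC⟩ := isCompact_Icc.exists_bound_of_continuousOn
      ((hT.continuousOn_orbit x).mono (Icc_subset_Ici_self : Icc 0 b ⊆ Ici 0))
    exact ⟨C, fun t => hC t t.2⟩)
  exact ⟨max C 0, le_max_right _ _, fun t ht => (hC ⟨t, ht⟩).trans (le_max_left _ _)⟩

/-- A strongly continuous semigroup, extended by the identity to negative times, is jointly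
continuous. -/
theorem continuous_uncurry [CompleteSpace E] (hT : IsC0Semigroup T) :
    Continuous fun q : ℝ × E => T (max q.1 0) q.2 := by
  rw [continuous_iff_continuousAt]
  rintro ⟨t, x⟩
  obtain ⟨M, hM0, hM⟩ := hT.exists_bound (|t| + 1)
  have h1 : Continuous fun s : ℝ => T (max s 0) x :=
    (hT.continuousOn_orbit x).comp_continuous (continuous_id.max continuous_const)
      fun s => mem_Ici.2 (le_max_right s 0)
  have h2 : Tendsto (fun q : ℝ × E => M * ‖q.2 - x‖ + ‖T (max q.1 0) x - T (max t 0) x‖)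
      (𝓝 (t, x)) (𝓝 0) := by
    have hc : Continuous fun q : ℝ × E => M * ‖q.2 - x‖ + ‖T (max q.1 0) x - T (max t 0) x‖ := by
      exact (continuous_const.mul (continuous_snd.sub continuous_const).norm).add
        ((h1.comp continuous_fst).sub continuous_const).norm
    simpa using hc.tendsto (t, x)
  rw [ContinuousAt, tendsto_iff_norm_sub_tendsto_zero]
  refine squeeze_zero' (Eventually.of_forall fun _ => norm_nonneg _) ?_ h2
  have h3 : ∀ᶠ q : ℝ × E in 𝓝 (t, x), q.1 < |t| + 1 :=
    (continuous_fst.tendsto (t, x)).eventually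
      (gt_mem_nhds (lt_of_le_of_lt (le_abs_self t) (lt_add_one _)))
  filter_upwards [h3] with q hq
  have h4 : T (max q.1 0) q.2 - T (max t 0) x
      = T (max q.1 0) (q.2 - x) + (T (max q.1 0) x - T (max t 0) x) := by
    rw [map_sub]; abel
  rw [h4]
  refine (norm_add_le _ _).trans (add_le_add ?_ le_rfl)
  exact (T (max q.1 0)).le_of_opNorm_le
    (hM _ ⟨le_max_right _ _, max_le hq.le (by positivity)⟩) _

theorem continuous_orbit [CompleteSpace E] (hT : IsC0Semigroup T) (x : E) :
    Continuous fun t => T (max t 0) x :=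
  hT.continuous_uncurry.comp (continuous_id.prodMk continuous_const)

theorem add_apply (hT : IsC0Semigroup T) {s t : ℝ} (hs : 0 ≤ s) (ht : 0 ≤ t) (x : E) :
    T (s + t) x = T s (T t x) := by
  rw [hT.map_add s t hs ht]; rfl

theorem zero_apply (hT : IsC0Semigroup T) (x : E) : T 0 x = x := by
  rw [hT.map_zero]; rfl

end IsC0Semigroup

end C0

section Generator

variable {𝕜 : Type*} [RCLike 𝕜] {E : Type*} [NormedAddCommGroup E] [NormedSpace 𝕜 E]
  [NormedSpace ℝ E]

namespace IsC0Semigroup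

variable {T : ℝ → E →L[𝕜] E} {G : E →ₗ.[𝕜] E}

theorem map_integral [CompleteSpace E] [IsScalarTower ℝ 𝕜 E] (hT : IsC0Semigroup T) (x : E)
    {h t : ℝ} (hh : 0 ≤ h) (ht : 0 ≤ t) :
    T h (∫ s in (0 : ℝ)..t, T (max s 0) x) = ∫ s in h..(t + h), T (max s 0) x := by
  rw [← (T h).intervalIntegral_comp_comm ((hT.continuous_orbit x).intervalIntegrable _ _)]
  have : ∀ s ∈ uIcc 0 t, T h (T (max s 0) x) = T (max (s + h) 0) x := fun s hs => by
    rw [uIcc_of_le ht] at hs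
    rw [max_eq_left hs.1, max_eq_left (add_nonneg hs.1 hh), add_comm, hT.add_apply hh hs.1]
  rw [intervalIntegral.integral_congr this,
    intervalIntegral.integral_comp_add_right (fun s => T (max s 0) x) h, zero_add]

/-- Integrals of orbits lie in the domain of the generator. -/
theorem integral_mem_graph [CompleteSpace E] [IsScalarTower ℝ 𝕜 E] (hT : IsC0Semigroup T)
    (hG : IsGeneratorOf G T) (x : E) {t : ℝ}
    (ht : 0 ≤ t) : (∫ s in (0 : ℝ)..t, T (max s 0) x, T t x - x) ∈ G.graph := by
  rw [hG]
  have hc := hT.continuous_orbit x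
  have h1 := (tendsto_average hc t).sub (tendsto_average hc 0)
  simp only [max_eq_left ht, max_self, hT.zero_apply] at h1
  refine h1.congr' ?_
  filter_upwards [self_mem_nhdsWithin] with h hh
  have hh : (0 : ℝ) ≤ h := le_of_lt hh
  have hi := fun a b => hc.intervalIntegrable (μ := volume) a b
  rw [hT.map_integral x hh ht, ← smul_sub]
  congr 1
  rw [zero_add, ← intervalIntegral.integral_interval_sub_left (hi 0 (t + h)) (hi 0 t),
    ← intervalIntegral.integral_interval_sub_left (hi 0 (t + h)) (hi 0 h)]
  abel

theorem hasDerivWithinAt_orbit [IsScalarTower ℝ 𝕜 E] (hT : IsC0Semigroup T)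
    (hG : IsGeneratorOf G T) {x y : E}
    (hxy : (x, y) ∈ G.graph) {t : ℝ} (ht : 0 ≤ t) :
    HasDerivWithinAt (fun s => T (max s 0) x) (T t y) (Ioi t) t := by
  rw [hasDerivWithinAt_iff_tendsto_slope' (by simp)]
  have h1 := ((T t).continuous.tendsto y).comp ((hG x y).1 hxy)
  have h2 : Tendsto (fun s : ℝ => s - t) (𝓝[>] t) (𝓝[>] 0) := by
    refine tendsto_nhdsWithin_of_tendsto_nhds_of_eventually_within _ ?_ ?_
    · refine Tendsto.mono_left ?_ nhdsWithin_le_nhds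
      simpa using (continuous_sub_right t).tendsto t
    · filter_upwards [self_mem_nhdsWithin] with s hs using mem_Ioi.2 (sub_pos.2 (mem_Ioi.1 hs))
  refine (h1.comp h2).congr' ?_
  filter_upwards [self_mem_nhdsWithin] with s hs
  have hs : t < s := hs
  have h3 : T s x = T t (T (s - t) x) := by
    rw [← hT.add_apply ht (sub_nonneg.2 hs.le)]; congr 2; ring
  simp only [Function.comp, slope, vsub_eq_sub]
  rw [max_eq_left ht, max_eq_left (ht.trans hs.le), h3, ← map_sub,
    (T t).map_smul_of_tower]

theorem integral_generator [CompleteSpace E] [IsScalarTower ℝ 𝕜 E] (hT : IsC0Semigroup T)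
    (hG : IsGeneratorOf G T) {x y : E}
    (hxy : (x, y) ∈ G.graph) {t : ℝ} (ht : 0 ≤ t) :
    ∫ s in (0 : ℝ)..t, T (max s 0) y = T t x - x := by
  have h := intervalIntegral.integral_eq_sub_of_hasDeriv_right_of_le
    (f := fun s => T (max s 0) x) (f' := fun s => T (max s 0) y) ht
    (hT.continuous_orbit x).continuousOn
    (fun s hs => by
      have := hT.hasDerivWithinAt_orbit hG hxy hs.1.le
      simpa only [max_eq_left hs.1.le] using this)
    ((hT.continuous_orbit y).intervalIntegrable _ _)
  simpa [max_eq_left ht, hT.zero_apply] using h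

/-- Generators are closed, because `∫₀ᵗ T(s) y ds = T(t) x - x` is preserved under limits and
characterizes `G x = y`. -/
theorem isClosed_generator [CompleteSpace E] [IsScalarTower ℝ 𝕜 E] (hT : IsC0Semigroup T)
    (hG : IsGeneratorOf G T) : G.IsClosed := by
  refine isClosed_of_closure_subset ?_
  rintro ⟨x, y⟩ hxy
  obtain ⟨z, hz, hzl⟩ := mem_closure_iff_seq_limit.1 hxy
  have hz1 : Tendsto (fun n => (z n).1) atTop (𝓝 x) := (continuous_fst.tendsto _).comp hzl
  have hz2 : Tendsto (fun n => (z n).2) atTop (𝓝 y) := (continuous_snd.tendsto _).comp hzl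
  have key : ∀ t, 0 ≤ t → ∫ s in (0 : ℝ)..t, T (max s 0) y = T t x - x := by
    intro t ht
    obtain ⟨M, hM0, hM⟩ := hT.exists_bound t
    have h1 : Tendsto (fun n => T t (z n).1 - (z n).1) atTop (𝓝 (T t x - x)) :=
      (((T t).continuous.tendsto _).comp hz1).sub hz1
    refine tendsto_nhds_unique ?_ h1
    have h2 : ∀ n, T t (z n).1 - (z n).1 = ∫ s in (0 : ℝ)..t, T (max s 0) (z n).2 := fun n =>
      (hT.integral_generator hG (hz n) ht).symm
    simp only [h2]
    rw [tendsto_iff_norm_sub_tendsto_zero]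
    have h3 : Tendsto (fun n => M * ‖(z n).2 - y‖ * |t - 0|) atTop (𝓝 0) := by
      simpa using ((tendsto_iff_norm_sub_tendsto_zero.1 hz2).const_mul M).mul_const |t - 0|
    refine squeeze_zero (fun _ => norm_nonneg _) (fun n => ?_) h3
    rw [← intervalIntegral.integral_sub ((hT.continuous_orbit _).intervalIntegrable _ _)
      ((hT.continuous_orbit _).intervalIntegrable _ _)]
    refine intervalIntegral.norm_integral_le_of_norm_le_const fun s hs => ?_
    rw [uIoc_of_le ht] at hs
    rw [← map_sub]
    exact (T _).le_of_opNorm_le (hM _ ⟨le_max_right _ _, by simpa [hs.2] using ht⟩) _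
  refine (hG x y).2 ?_
  have h4 := tendsto_average (hT.continuous_orbit y) 0
  simp only [max_self, hT.zero_apply] at h4
  refine h4.congr' ?_
  filter_upwards [self_mem_nhdsWithin] with h hh
  rw [zero_add, key h (le_of_lt hh)]

theorem dense_domain [CompleteSpace E] [IsScalarTower ℝ 𝕜 E] (hT : IsC0Semigroup T)
    (hG : IsGeneratorOf G T) :
    Dense (G.domain : Set E) := by
  intro x
  have h4 := tendsto_average (hT.continuous_orbit x) 0
  simp only [max_self, hT.zero_apply] at h4
  refine mem_closure_of_tendsto h4 ?_
  filter_upwards [self_mem_nhdsWithin] with h hh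
  rw [zero_add]
  exact (G.domain.restrictScalars ℝ).smul_mem _
    (LinearPMap.mem_domain_of_mem_graph (hT.integral_mem_graph hG x (le_of_lt hh)))

/-- The only continuous `v` with `v t = G ∫₀ᵗ v` for all `t` is zero: `s ↦ T (t - s) ∫₀ˢ v` has
vanishing right derivative. -/
theorem mild_unique [CompleteSpace E] [IsScalarTower ℝ 𝕜 E] (hT : IsC0Semigroup T)
    (hG : IsGeneratorOf G T) {v : ℝ → E}
    (hv : Continuous v) {b : ℝ}
    (h : ∀ t ∈ Icc 0 b, (∫ s in (0 : ℝ)..t, v s, v t) ∈ G.graph) :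
    ∀ t ∈ Icc 0 b, v t = 0 := by
  set D : ℝ → E := fun t => ∫ s in (0 : ℝ)..t, v s with hD
  have hDd : ∀ t, HasDerivAt D (v t) t := fun t =>
    intervalIntegral.integral_hasDerivAt_right (hv.intervalIntegrable _ _)
      hv.stronglyMeasurable.stronglyMeasurableAtFilter hv.continuousAt
  have hDc : Continuous D := continuous_iff_continuousAt.2 fun t => (hDd t).continuousAt
  have hDz : ∀ t ∈ Icc 0 b, D t = 0 := by
    intro t ht
    have hcont : Continuous fun s => T (max (t - s) 0) (D s) :=
      hT.continuous_uncurry.comp ((continuous_const.sub continuous_id).prodMk hDc)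
    have hder : ∀ s ∈ Ico 0 t,
        HasDerivWithinAt (fun s => T (max (t - s) 0) (D s)) 0 (Ici s) s := by
      intro s hs
      rw [← hasDerivWithinAt_Ioi_iff_Ici, hasDerivWithinAt_iff_tendsto_slope' (by simp)]
      have hsb : s ∈ Icc 0 b := ⟨hs.1, hs.2.le.trans ht.2⟩
      have e1 : Tendsto (fun r => (r - s)⁻¹ • (D r - D s)) (𝓝[>] s) (𝓝 (v s)) := by
        have := (hasDerivWithinAt_iff_tendsto_slope' (by simp)).1
          ((hDd s).hasDerivWithinAt (s := Ioi s))
        simpa [slope, slope_fun_def] using this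
      have h2 : Tendsto (fun r : ℝ => r - s) (𝓝[>] s) (𝓝[>] 0) := by
        refine tendsto_nhdsWithin_of_tendsto_nhds_of_eventually_within _ ?_ ?_
        · refine Tendsto.mono_left ?_ nhdsWithin_le_nhds
          simpa using (continuous_sub_right s).tendsto s
        · filter_upwards [self_mem_nhdsWithin] with r hr using mem_Ioi.2 (sub_pos.2 (mem_Ioi.1 hr))
      have e2 := ((hG _ _).1 (h s hsb)).comp h2
      have e3 := e1.sub e2
      rw [sub_self] at e3
      have e4 : Tendsto (fun r : ℝ => t - r) (𝓝[>] s) (𝓝 (t - s)) :=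
        ((continuous_const.sub continuous_id).tendsto s).mono_left nhdsWithin_le_nhds
      have e5 := (hT.continuous_uncurry.tendsto (t - s, 0)).comp (e4.prodMk_nhds e3)
      rw [_root_.map_zero] at e5
      refine e5.congr' ?_
      filter_upwards [Ioo_mem_nhdsGT hs.2] with r hr
      have h6 : T (t - s) (D s) = T (t - r) (T (r - s) (D s)) := by
        rw [← hT.add_apply (sub_nonneg.2 hr.2.le) (sub_nonneg.2 hr.1.le)]; congr 2; ring
      simp only [Function.comp, slope, vsub_eq_sub]
      rw [max_eq_left (sub_nonneg.2 hr.2.le), max_eq_left (sub_nonneg.2 hs.2.le), h6, ← map_sub,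
        ← smul_sub,
        ← (T (t - r)).map_smul_of_tower]
      congr 2
      abel
    have := constant_of_has_deriv_right_zero hcont.continuousOn hder t (right_mem_Icc.2 ht.1)
    simpa [hT.zero_apply, hD] using this
  intro t ht
  have h1 := h t ht
  have h2 : ∫ s in (0 : ℝ)..t, v s = 0 := hDz t ht
  rw [h2] at h1
  exact LinearPMap.graph_fst_eq_zero_snd _ h1 rfl

/-- The variation of constants integral is a mild solution of the inhomogeneous equation: after
interchanging the integrations, the claim is an integral of `integral_mem_graph`. -/
theorem conv_mem_graph [CompleteSpace E] [IsScalarTower ℝ 𝕜 E] (hT : IsC0Semigroup T)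
    (hG : IsGeneratorOf G T) {h : ℝ → E}
    (hh : Continuous h) {t : ℝ} (ht : 0 ≤ t) :
    (∫ r in (0 : ℝ)..t, ∫ s in (0 : ℝ)..r, T (max (r - s) 0) (h s),
      (∫ s in (0 : ℝ)..t, T (max (t - s) 0) (h s)) - ∫ s in (0 : ℝ)..t, h s) ∈ G.graph := by
  have hF : Continuous (Function.uncurry fun r s : ℝ => T (max (r - s) 0) (h s)) :=
    hT.continuous_uncurry.comp
      ((continuous_fst.sub continuous_snd).prodMk (hh.comp continuous_snd))
  have hFt : Continuous fun s => T (max (t - s) 0) (h s) :=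
    hF.comp (continuous_const.prodMk continuous_id)
  have hFi : IntegrableOn (Function.uncurry fun r s : ℝ => T (max (r - s) 0) (h s))
      (Ioc 0 t ×ˢ Ioc 0 t) (volume.prod volume) :=
    (hF.continuousOn.integrableOn_compact (isCompact_Icc.prod isCompact_Icc)).mono_set
      (prod_mono Ioc_subset_Icc_self Ioc_subset_Icc_self)
  rw [integral_triangle_swap ht hFi,
    ← intervalIntegral.integral_sub (hFt.intervalIntegrable _ _) (hh.intervalIntegrable _ _)]
  refine graph_integral_mem (hT.isClosed_generator hG) ?_ (hFt.sub hh) ht ?_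
  · have h1 : Continuous fun s => ∫ r in t..s, T (max (r - s) 0) (h s) :=
      intervalIntegral.continuous_parametric_intervalIntegral_of_continuous
        (f := fun s r : ℝ => T (max (r - s) 0) (h s)) (hF.comp continuous_swap) continuous_id
    exact h1.neg.congr fun s => (intervalIntegral.integral_symm t s).symm
  · intro s hs
    have h2 : ∫ r in s..t, T (max (r - s) 0) (h s)
        = ∫ r in (0 : ℝ)..(t - s), T (max r 0) (h s) := by
      rw [intervalIntegral.integral_comp_sub_right (fun r => T (max r 0) (h s)) s, sub_self]
    rw [h2]
    simp only [Pi.sub_apply, max_eq_left (sub_nonneg.2 hs.2)]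
    exact hT.integral_mem_graph hG (h s) (sub_nonneg.2 hs.2)

end IsC0Semigroup

end Generator

/-! ### Generation from mild solutions -/

section Mild

variable {𝕜 : Type*} [RCLike 𝕜] {E : Type*} [NormedAddCommGroup E] [NormedSpace 𝕜 E]
  [NormedSpace ℝ E]

/-- `u` is a mild solution of `u' = G u`, `u(0) = x`: the integrated equation
`u(t) = x + G ∫₀ᵗ u(s) ds` holds for `t ≥ 0`. -/
structure IsMildSolution (G : E →ₗ.[𝕜] E) (x : E) (u : ℝ → E) : Prop where
  continuous : Continuous u
  mem_graph : ∀ t, 0 ≤ t → (∫ s in (0 : ℝ)..t, u s, u t - x) ∈ G.graph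

namespace IsMildSolution

variable {G : E →ₗ.[𝕜] E} {x y : E} {u v : ℝ → E}

theorem map_zero (hu : IsMildSolution G x u) : u 0 = x := by
  have h := hu.mem_graph 0 le_rfl
  rw [intervalIntegral.integral_same] at h
  exact sub_eq_zero.1 (LinearPMap.graph_fst_eq_zero_snd _ h rfl)

theorem add (hu : IsMildSolution G x u) (hv : IsMildSolution G y v) :
    IsMildSolution G (x + y) (fun t => u t + v t) where
  continuous := hu.continuous.add hv.continuous
  mem_graph t ht := by
    rw [intervalIntegral.integral_add (hu.continuous.intervalIntegrable _ _)
      (hv.continuous.intervalIntegrable _ _), add_sub_add_comm]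
    exact G.graph.add_mem (hu.mem_graph t ht) (hv.mem_graph t ht)

theorem smul [CompleteSpace E] [IsScalarTower ℝ 𝕜 E] (c : 𝕜) (hu : IsMildSolution G x u) :
    IsMildSolution G (c • x) (fun t => c • u t) where
  continuous := hu.continuous.const_smul c
  mem_graph t ht := by
    have h : ∫ s in (0 : ℝ)..t, c • u s = c • ∫ s in (0 : ℝ)..t, u s :=
      (c • ContinuousLinearMap.id 𝕜 E).intervalIntegral_comp_comm
        (hu.continuous.intervalIntegrable _ _)
    rw [h, ← smul_sub]
    exact G.graph.smul_mem c (hu.mem_graph t ht)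

theorem sub (hu : IsMildSolution G x u) (hv : IsMildSolution G y v) :
    IsMildSolution G (x - y) (fun t => u t - v t) where
  continuous := hu.continuous.sub hv.continuous
  mem_graph t ht := by
    rw [intervalIntegral.integral_sub (hu.continuous.intervalIntegrable _ _)
      (hv.continuous.intervalIntegrable _ _), sub_sub_sub_comm]
    exact G.graph.sub_mem (hu.mem_graph t ht) (hv.mem_graph t ht)

/-- The translate of a mild solution is a mild solution. -/
theorem shift (hu : IsMildSolution G x u) {r : ℝ} (hr : 0 ≤ r) :
    IsMildSolution G (u r) (fun t => u (t + r)) where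
  continuous := hu.continuous.comp (continuous_add_const r)
  mem_graph t ht := by
    have hi := fun a b => hu.continuous.intervalIntegrable (μ := volume) a b
    have h := G.graph.sub_mem (hu.mem_graph (t + r) (add_nonneg ht hr)) (hu.mem_graph r hr)
    rw [Prod.mk_sub_mk, intervalIntegral.integral_interval_sub_left (hi _ _) (hi _ _),
      sub_sub_sub_cancel_right] at h
    rwa [intervalIntegral.integral_comp_add_right, zero_add]

end IsMildSolution

theorem integral_max_zero (u : ℝ → E) {t : ℝ} (ht : 0 ≤ t) :
    ∫ s in (0 : ℝ)..t, u (max s 0) = ∫ s in (0 : ℝ)..t, u s := by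
  refine intervalIntegral.integral_congr fun s hs => ?_
  rw [uIcc_of_le ht] at hs
  simp only [max_eq_left hs.1]

theorem exists_limit_of_uniformCauchySeqOn {E : Type*} [NormedAddCommGroup E] [CompleteSpace E]
    {w : ℕ → ℝ → E} (hw : ∀ n, Continuous (w n))
    (hcauchy : ∀ b, 0 ≤ b → UniformCauchySeqOn w atTop (Icc 0 b)) :
    ∃ u : ℝ → E, Continuous u ∧ ∀ b, 0 ≤ b → TendstoUniformlyOn w u atTop (Icc 0 b) := by
  have hlim : ∀ t, ∃ l, Tendsto (fun n => w n (max t 0)) atTop (𝓝 l) := fun t =>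
    cauchySeq_tendsto_of_complete
      ((hcauchy _ (le_max_right t 0)).cauchySeq ⟨le_max_right t 0, le_rfl⟩)
  choose u hu using hlim
  have hunif : ∀ b, 0 ≤ b → TendstoUniformlyOn w u atTop (Icc 0 b) := fun b hb =>
    (hcauchy b hb).tendstoUniformlyOn_of_tendsto fun t ht => by
      simpa [max_eq_left ht.1] using hu t
  refine ⟨u, ?_, hunif⟩
  rw [continuous_iff_continuousAt]
  intro t
  have h1 : ContinuousOn u (Icc 0 (|t| + 1)) := (hunif _ (by positivity)).continuousOn
    (Frequently.of_forall fun n => (hw n).continuousOn)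
  have h2 : ∀ s, u s = u (max s 0) := fun s =>
    tendsto_nhds_unique (hu s) (by simpa using hu (max s 0))
  have h3 : ContinuousOn (fun s => u (max s 0)) (Iio (|t| + 1)) :=
    h1.comp (continuous_id.max continuous_const).continuousOn
      fun s hs => ⟨le_max_right _ _, max_le (le_of_lt hs) (by positivity)⟩
  exact ((h3.congr fun s _ => h2 s) t
    (lt_of_le_of_lt (le_abs_self t) (lt_add_one _))).continuousAt
      (Iio_mem_nhds (lt_of_le_of_lt (le_abs_self t) (lt_add_one _)))

/-- A closed operator `G` generates a strongly continuous semigroup if mild solutions are unique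
and exist, with a locally uniform linear bound, for a dense set of initial values. -/
theorem generates_of_mild [CompleteSpace E] [IsScalarTower ℝ 𝕜 E] {G : E →ₗ.[𝕜] E}
    (hG : G.IsClosed) {D : Submodule 𝕜 E} (hD : Dense (D : Set E)) {C : ℝ → ℝ}
    (hex : ∀ x ∈ D, ∃ u, IsMildSolution G x u ∧ ∀ b, 0 ≤ b → ∀ t ∈ Icc 0 b, ‖u t‖ ≤ C b * ‖x‖)
    (huniq : ∀ u, IsMildSolution G 0 u → ∀ t, 0 ≤ t → u t = 0) :
    GeneratesC0Semigroup G := by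
  have uniq : ∀ {x : E} {u v : ℝ → E}, IsMildSolution G x u → IsMildSolution G x v →
      ∀ t, 0 ≤ t → u t = v t := fun {x u v} hu hv t ht => by
    have h := hu.sub hv
    rw [sub_self] at h
    exact sub_eq_zero.1 (huniq _ h t ht)
  have hC : ∀ b, 0 ≤ b → ∀ x ∈ D, ∀ u, IsMildSolution G x u → ∀ t ∈ Icc 0 b,
      ‖u t‖ ≤ C b * ‖x‖ := fun b hb x hx u hu t ht => by
    obtain ⟨v, hv, hvb⟩ := hex x hx
    rw [uniq hu hv t ht.1]
    exact hvb b hb t ht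
  -- mild solutions for arbitrary initial values are locally uniform limits
  have hall : ∀ x, ∃ u, IsMildSolution G x u ∧
      ∀ b, 0 ≤ b → ∀ t ∈ Icc 0 b, ‖u t‖ ≤ C b * ‖x‖ := by
    intro x
    obtain ⟨z, hz, hzx⟩ := mem_closure_iff_seq_limit.1 (hD x)
    choose w hw hwb using fun n => hex (z n) (hz n)
    have hcauchy : ∀ b, 0 ≤ b → UniformCauchySeqOn w atTop (Icc 0 b) := by
      intro b hb
      rw [Metric.uniformCauchySeqOn_iff]
      intro ε hε
      obtain ⟨N, hN⟩ := Metric.cauchySeq_iff.1 hzx.cauchySeq (ε / (|C b| + 1)) (by positivity)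
      refine ⟨N, fun m hm n hn t ht => ?_⟩
      have h1 := hC b hb _ (D.sub_mem (hz m) (hz n)) _ ((hw m).sub (hw n)) t ht
      rw [dist_eq_norm]
      refine h1.trans_lt ?_
      have h2 := hN m hm n hn
      rw [dist_eq_norm, lt_div_iff₀ (by positivity)] at h2
      calc C b * ‖z m - z n‖ ≤ (|C b| + 1) * ‖z m - z n‖ := by
            gcongr; exact (le_abs_self _).trans (by linarith)
        _ < ε := by rwa [mul_comm]
    obtain ⟨u, hcont, hunif⟩ :=
      exists_limit_of_uniformCauchySeqOn (fun n => (hw n).continuous) hcauchy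
    have hu : ∀ t, 0 ≤ t → Tendsto (fun n => w n t) atTop (𝓝 (u t)) := fun t ht =>
      (hunif t ht).tendsto_at ⟨ht, le_rfl⟩
    refine ⟨u, ⟨hcont, fun t ht => ?_⟩, fun b hb t ht => ?_⟩
    · have hint : Tendsto (fun n => ∫ s in (0 : ℝ)..t, w n s) atTop
          (𝓝 (∫ s in (0 : ℝ)..t, u s)) := by
        refine intervalIntegral.tendsto_integral_filter_of_dominated_convergence
          (fun _ => |C t| * (‖x‖ + 1)) ?_ ?_ intervalIntegrable_const ?_
        · exact Eventually.of_forall fun n => (hw n).continuous.aestronglyMeasurable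
        · have : ∀ᶠ n in atTop, ‖z n‖ < ‖x‖ + 1 :=
            hzx.norm.eventually (gt_mem_nhds (lt_add_one _))
          filter_upwards [this] with n hn
          refine Eventually.of_forall fun s hs => ?_
          rw [uIoc_of_le ht] at hs
          refine (hwb n t ht s ⟨hs.1.le, hs.2⟩).trans ?_
          calc C t * ‖z n‖ ≤ |C t| * ‖z n‖ := by gcongr; exact le_abs_self _
            _ ≤ _ := by gcongr
        · refine Eventually.of_forall fun s hs => ?_
          rw [uIoc_of_le ht] at hs
          exact hu s hs.1.le
      have h2 : Tendsto (fun n => w n t - z n) atTop (𝓝 (u t - x)) := (hu t ht).sub hzx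
      exact hG.mem_of_tendsto (hint.prodMk_nhds h2)
        (Eventually.of_forall fun n => (hw n).mem_graph t ht)
    · exact le_of_tendsto_of_tendsto (hu t ht.1).norm (hzx.norm.const_mul (C b))
        (Eventually.of_forall fun n => hwb n b hb t ht)
  choose u hu hub using hall
  let T : ℝ → E →L[𝕜] E := fun t => LinearMap.mkContinuous
    { toFun := fun x => u x (max t 0)
      map_add' := fun x y =>
        uniq (hu (x + y)) ((hu x).add (hu y)) _ (le_max_right _ _)
      map_smul' := fun c x => uniq (hu (c • x)) ((hu x).smul c) _ (le_max_right _ _) }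
    (C (max t 0)) (fun x => hub x _ (le_max_right _ _) _ ⟨le_max_right _ _, le_rfl⟩)
  have hT : ∀ t x, T t x = u x (max t 0) := fun _ _ => rfl
  have hsg : IsC0Semigroup T := by
    refine ⟨?_, fun s t hs ht => ?_, fun x => ?_⟩
    · ext x
      rw [hT, max_self, (hu x).map_zero]; rfl
    · ext x
      rw [ContinuousLinearMap.comp_apply, hT, hT, hT, max_eq_left hs, max_eq_left ht,
        max_eq_left (add_nonneg hs ht)]
      exact uniq ((hu x).shift ht) (hu _) s hs
    · exact ((hu x).continuous.comp (continuous_id.max continuous_const)).continuousOn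
  refine ⟨T, hsg, fun x y => ⟨fun hxy => ?_, fun hxy => ?_⟩⟩
  · -- `x + ∫₀ᵗ T(s) y` is a mild solution, hence equals `T(t) x`
    have hcy : Continuous fun s => T (max s 0) y := hsg.continuous_orbit y
    have hy : ∀ t, 0 ≤ t → (∫ s in (0 : ℝ)..t, T (max s 0) y, T t y - y) ∈ G.graph := by
      intro t ht
      have h1 := (hu y).mem_graph t ht
      rw [← integral_max_zero _ ht] at h1
      simpa [hT, max_eq_left ht] using h1
    have hv : Continuous fun t => x + ∫ s in (0 : ℝ)..t, T (max s 0) y :=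
      continuous_const.add (intervalIntegral.continuous_primitive
        (fun a b => hcy.intervalIntegrable a b) 0)
    have hmild : IsMildSolution G x (fun t => x + ∫ s in (0 : ℝ)..t, T (max s 0) y) := by
      refine ⟨hv, fun t ht => ?_⟩
      rw [add_sub_cancel_left]
      refine graph_integral_mem hG hv hcy ht fun s hs => ?_
      have h1 := G.graph.add_mem hxy (hy s hs.1)
      rw [max_eq_left hs.1]
      simpa using h1
    have heq : ∀ t, 0 ≤ t → T t x - x = ∫ s in (0 : ℝ)..t, T (max s 0) y := by
      intro t ht
      have h1 := uniq (hu x) hmild t ht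
      rw [hT, max_eq_left ht, h1, add_sub_cancel_left]
    have h4 := tendsto_average hcy 0
    simp only [max_self, hsg.zero_apply] at h4
    refine h4.congr' ?_
    filter_upwards [self_mem_nhdsWithin] with h hh
    rw [zero_add, heq h (le_of_lt hh)]
  · have h4 := tendsto_average (hsg.continuous_orbit x) 0
    simp only [max_self, hsg.zero_apply] at h4
    refine hG.mem_of_tendsto (h4.prodMk_nhds hxy) ?_
    filter_upwards [self_mem_nhdsWithin] with h hh
    have hh : (0 : ℝ) ≤ h := le_of_lt (mem_Ioi.1 hh)
    have h1 := (hu x).mem_graph h hh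
    rw [← integral_max_zero _ hh] at h1
    have h2 := (G.graph.restrictScalars ℝ).smul_mem h⁻¹ h1
    rw [zero_add]
    simpa [hT, max_eq_left hh] using h2

end Mild

/-! ### Existence of the Riemann-Stieltjes integral -/

section RSIntegral

variable {𝕜 : Type*} [RCLike 𝕜] {X : Type*} [NormedAddCommGroup X] [NormedSpace 𝕜 X]

/-- A function of bounded variation is dominated by a real function whose total increment over
`[-1,0]` is the total variation. -/
theorem exists_dominating_function {η : ℝ → X →L[𝕜] X}
    (hη : BoundedVariationOn η (Icc (-1 : ℝ) 0)) :
    ∃ V : ℝ → ℝ, V 0 - V (-1) = totalVar η ∧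
      ∀ a b, -1 ≤ a → a ≤ b → b ≤ 0 → ‖η b - η a‖ ≤ V b - V a := by
  have hfin : ∀ a b, -1 ≤ a → b ≤ 0 → eVariationOn η (Icc a b) ≠ ⊤ := fun a b ha hb =>
    hη.mono (Icc_subset_Icc ha hb)
  refine ⟨fun t => (eVariationOn η (Icc (-1) t)).toReal, ?_, fun a b ha hab hb => ?_⟩
  · simp [totalVar]
  · have h1 : eVariationOn η (Icc (-1) a) + eVariationOn η (Icc a b)
        = eVariationOn η (Icc (-1) b) := by
      have := eVariationOn.Icc_add_Icc η (s := univ) ha hab (mem_univ a)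
      simpa using this
    have h2 : (eVariationOn η (Icc (-1) b)).toReal
        = (eVariationOn η (Icc (-1) a)).toReal + (eVariationOn η (Icc a b)).toReal := by
      rw [← h1, ENNReal.toReal_add (hfin _ _ le_rfl (hab.trans hb)) (hfin _ _ ha hb)]
    beta_reduce
    rw [h2, add_sub_cancel_left, ← dist_eq_norm]
    exact (hη.mono (Icc_subset_Icc ha hb)).dist_le ⟨hab, le_rfl⟩ ⟨le_rfl, hab⟩

/-- The increment over the intersection of two intervals, written by clamping either interval to
the other one. -/
theorem clamp_increment_symm {Y : Type*} [AddCommGroup Y] (f : ℝ → Y) {a a' b b' : ℝ} (h : a ≤ a')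
    (h' : b ≤ b') :
    f (max a (min b' a')) - f (max a (min b a'))
      = f (max b (min a' b')) - f (max b (min a b')) := by
  rcases le_total a b with h1 | h1 <;> rcases le_total a' b' with h2 | h2 <;>
    rcases le_total a b' with h3 | h3 <;> rcases le_total a' b with h4 | h4 <;>
    simp [*] <;> grind

theorem sum_clamp {Y : Type*} [AddCommGroup Y] (f : ℝ → Y) {a a' : ℝ} (h : a ≤ a') {m : ℕ}
    {r : ℕ → ℝ} (h0 : r 0 ≤ a) (hm : a' ≤ r m) :
    ∑ j ∈ Finset.range m, (f (max a (min (r (j + 1)) a')) - f (max a (min (r j) a')))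
      = f a' - f a := by
  rw [Finset.sum_range_sub (fun j => f (max a (min (r j) a')))]
  rw [min_eq_right hm, max_eq_right h, max_eq_left ((min_le_left _ _).trans h0)]

theorem partition_mem_Icc {n : ℕ} {s : ℕ → ℝ} (h0 : s 0 = -1) (hn : s n = 0)
    (h : ∀ i < n, s i ≤ s (i + 1)) : ∀ i ≤ n, s i ∈ Icc (-1 : ℝ) 0 := by
  have hmono : ∀ i j, i ≤ j → j ≤ n → s i ≤ s j := by
    intro i j hij
    induction j, hij using Nat.le_induction with
    | base => exact fun _ => le_rfl
    | succ k hk ih => exact fun hkn => (ih (by omega)).trans (h k (by omega))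
  exact fun i hi => ⟨h0 ▸ hmono 0 i (Nat.zero_le _) hi, hn ▸ hmono i n hi le_rfl⟩

/-- Two Riemann-Stieltjes sums over partitions of mesh less than `δ` differ by at most the
oscillation of the integrand at scale `2 δ` times the total increment of the dominating function;
both are sums over the common refinement. -/
theorem norm_rsSum_sub_le {η : ℝ → X →L[𝕜] X} {V : ℝ → ℝ}
    (hV : ∀ a b, -1 ≤ a → a ≤ b → b ≤ 0 → ‖η b - η a‖ ≤ V b - V a)
    {F : C(Icc (-1 : ℝ) 0, X)} {δ ε : ℝ}
    (hF : ∀ x y : Icc (-1 : ℝ) 0, |(x : ℝ) - y| < 2 * δ → ‖F x - F y‖ ≤ ε)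
    {n m : ℕ} {s r : ℕ → ℝ} {τ σ : ℕ → Icc (-1 : ℝ) 0}
    (hs0 : s 0 = -1) (hsn : s n = 0)
    (hs : ∀ i < n, s i ≤ s (i + 1) ∧ s (i + 1) - s i < δ ∧ (τ i : ℝ) ∈ Icc (s i) (s (i + 1)))
    (hr0 : r 0 = -1) (hrm : r m = 0)
    (hr : ∀ i < m, r i ≤ r (i + 1) ∧ r (i + 1) - r i < δ ∧ (σ i : ℝ) ∈ Icc (r i) (r (i + 1))) :
    ‖(∑ i ∈ Finset.range n, (η (s (i + 1)) - η (s i)) (F (τ i))) -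
      ∑ j ∈ Finset.range m, (η (r (j + 1)) - η (r j)) (F (σ j))‖ ≤ ε * (V 0 - V (-1)) := by
  have hsI := partition_mem_Icc hs0 hsn fun i hi => (hs i hi).1
  have hrI := partition_mem_Icc hr0 hrm fun i hi => (hr i hi).1
  -- `c i` clamps to `[s i, s (i + 1)]`; the points `c i (r j)` form the common refinement
  let c : ℕ → ℝ → ℝ := fun i x => max (s i) (min x (s (i + 1)))
  have e1 : ∑ i ∈ Finset.range n, (η (s (i + 1)) - η (s i)) (F (τ i)) =
      ∑ i ∈ Finset.range n, ∑ j ∈ Finset.range m,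
        (η (c i (r (j + 1))) - η (c i (r j))) (F (τ i)) := by
    refine Finset.sum_congr rfl fun i hi => ?_
    have hi := Finset.mem_range.1 hi
    rw [← _root_.sum_apply,
      sum_clamp η (hs i hi).1 (hr0 ▸ (hsI i hi.le).1) (hrm ▸ (hsI (i + 1) hi).2)]
  have e2 : ∑ j ∈ Finset.range m, (η (r (j + 1)) - η (r j)) (F (σ j)) =
      ∑ i ∈ Finset.range n, ∑ j ∈ Finset.range m,
        (η (c i (r (j + 1))) - η (c i (r j))) (F (σ j)) := by
    rw [Finset.sum_comm]
    refine Finset.sum_congr rfl fun j hj => ?_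
    have hj := Finset.mem_range.1 hj
    rw [← sum_clamp η (hr j hj).1 (hs0 ▸ (hrI j hj.le).1) (hsn ▸ (hrI (j + 1) hj).2),
      _root_.sum_apply]
    refine Finset.sum_congr rfl fun i hi => ?_
    rw [clamp_increment_symm η (hr j hj).1 (hs i (Finset.mem_range.1 hi)).1]
  have e3 : V 0 - V (-1) = ∑ i ∈ Finset.range n, ∑ j ∈ Finset.range m,
      (V (c i (r (j + 1))) - V (c i (r j))) := by
    rw [← hs0, ← hsn, ← Finset.sum_range_sub (fun i => V (s i))]
    refine Finset.sum_congr rfl fun i hi => ?_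
    have hi := Finset.mem_range.1 hi
    rw [sum_clamp V (hs i hi).1 (hr0 ▸ (hsI i hi.le).1) (hrm ▸ (hsI (i + 1) hi).2)]
  rw [e1, e2, e3, ← Finset.sum_sub_distrib, Finset.mul_sum]
  refine (norm_sum_le _ _).trans (Finset.sum_le_sum fun i hi => ?_)
  rw [← Finset.sum_sub_distrib, Finset.mul_sum]
  refine (norm_sum_le _ _).trans (Finset.sum_le_sum fun j hj => ?_)
  have hi := Finset.mem_range.1 hi
  have hj := Finset.mem_range.1 hj
  obtain ⟨hs1, hs2, hs3⟩ := hs i hi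
  obtain ⟨hr1, hr2, hr3⟩ := hr j hj
  rw [← map_sub]
  by_cases hint : s i < r (j + 1) ∧ r j < s (i + 1)
  · have h1 : |(τ i : ℝ) - σ j| < 2 * δ := by
      rw [abs_lt]; constructor <;> linarith [hs3.1, hs3.2, hr3.1, hr3.2, hint.1, hint.2]
    have h2 := hV (c i (r j)) (c i (r (j + 1))) ((hsI i hi.le).1.trans (le_max_left _ _))
      (max_le_max le_rfl (min_le_min hr1 le_rfl))
      (max_le (hsI i hi.le).2 ((min_le_right _ _).trans (hsI (i + 1) hi).2))
    refine (ContinuousLinearMap.le_opNorm _ _).trans ?_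
    rw [mul_comm]
    exact mul_le_mul (hF _ _ h1) h2 (norm_nonneg _) ((norm_nonneg _).trans (hF _ _ h1))
  · have h1 : c i (r (j + 1)) = c i (r j) := by
      rw [not_and_or, not_lt, not_lt] at hint
      simp only [c]
      rcases hint with h | h
      · rw [min_eq_left (h.trans hs1), min_eq_left ((hr1.trans h).trans hs1), max_eq_left h,
          max_eq_left (hr1.trans h)]
      · rw [min_eq_right h, min_eq_right (h.trans hr1)]
    simp [h1]

/-- The Riemann-Stieltjes sum over the partition of `[-1,0]` into `N + 1` equal parts, with left
end points as tags. -/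
noncomputable def uniformRSSum (η : ℝ → X →L[𝕜] X) (N : ℕ) : C(Icc (-1 : ℝ) 0, X) →L[𝕜] X :=
  ∑ i ∈ Finset.range (N + 1),
    (η (-1 + (i + 1 : ℕ) / (N + 1 : ℝ)) - η (-1 + (i : ℕ) / (N + 1 : ℝ))).comp
      (ContinuousMap.evalCLM 𝕜 (projIcc (-1 : ℝ) 0 (by norm_num) (-1 + i / (N + 1 : ℝ))))

theorem uniformRSSum_apply (η : ℝ → X →L[𝕜] X) (N : ℕ) (F : C(Icc (-1 : ℝ) 0, X)) :
    uniformRSSum η N F = ∑ i ∈ Finset.range (N + 1),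
      (η (-1 + (i + 1 : ℕ) / (N + 1 : ℝ)) - η (-1 + (i : ℕ) / (N + 1 : ℝ)))
        (F (projIcc (-1 : ℝ) 0 (by norm_num) (-1 + i / (N + 1 : ℝ)))) := by
  simp [uniformRSSum]

theorem uniform_partition {N i : ℕ} (hi : i < N + 1) :
    (-1 + (i : ℕ) / (N + 1 : ℝ) ≤ -1 + (i + 1 : ℕ) / (N + 1 : ℝ)) ∧
    (-1 + (i + 1 : ℕ) / (N + 1 : ℝ) - (-1 + (i : ℕ) / (N + 1 : ℝ)) = 1 / (N + 1 : ℝ)) ∧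
    (-1 + (i : ℕ) / (N + 1 : ℝ)) ∈ Icc (-1 : ℝ) 0 ∧
    (-1 + (i + 1 : ℕ) / (N + 1 : ℝ)) ∈ Icc (-1 : ℝ) 0 := by
  have hN : (0 : ℝ) < N + 1 := by positivity
  have h2 : -1 + (i + 1 : ℕ) / (N + 1 : ℝ) - (-1 + (i : ℕ) / (N + 1 : ℝ)) = 1 / (N + 1 : ℝ) := by
    push_cast; field_simp; ring
  have h1 : (0 : ℝ) < 1 / (N + 1 : ℝ) := by positivity
  have h3 : ((i + 1 : ℕ) : ℝ) / (N + 1 : ℝ) ≤ 1 := by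
    rw [div_le_one hN]; exact_mod_cast hi
  have h4 : (0 : ℝ) ≤ (i : ℕ) / (N + 1 : ℝ) := by positivity
  refine ⟨by linarith, h2, ⟨by linarith, by linarith⟩, ⟨by linarith, by linarith⟩⟩

/-- Sums of the form `∑ ‖Δη‖ b i` with `b i ≤ B` over the uniform partition. -/
theorem sum_norm_increment_mul_le {η : ℝ → X →L[𝕜] X} {V : ℝ → ℝ}
    (hV : ∀ a b, -1 ≤ a → a ≤ b → b ≤ 0 → ‖η b - η a‖ ≤ V b - V a) (N : ℕ) {β : ℕ → ℝ} {B : ℝ}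
    (hB : 0 ≤ B) (hβ : ∀ i < N + 1, β i ≤ B) :
    ∑ i ∈ Finset.range (N + 1),
      ‖η (-1 + (i + 1 : ℕ) / (N + 1 : ℝ)) - η (-1 + (i : ℕ) / (N + 1 : ℝ))‖ * β i
      ≤ (V 0 - V (-1)) * B := by
  have h1 : V 0 - V (-1) = ∑ i ∈ Finset.range (N + 1),
      (V (-1 + (i + 1 : ℕ) / (N + 1 : ℝ)) - V (-1 + (i : ℕ) / (N + 1 : ℝ))) := by
    rw [Finset.sum_range_sub (fun i : ℕ => V (-1 + (i : ℕ) / (N + 1 : ℝ)))]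
    have : (-1 : ℝ) + ((N + 1 : ℕ) : ℝ) / (N + 1 : ℝ) = 0 := by
      push_cast; rw [div_self (by positivity)]; norm_num
    rw [this]; simp
  rw [h1, Finset.sum_mul]
  refine Finset.sum_le_sum fun i hi => ?_
  obtain ⟨a, -, b, c⟩ := uniform_partition (Finset.mem_range.1 hi)
  have h2 := hV _ _ b.1 a c.2
  exact mul_le_mul_of_nonneg h2 (hβ i (Finset.mem_range.1 hi)) (norm_nonneg _) hB

theorem norm_uniformRSSum_le {η : ℝ → X →L[𝕜] X} {V : ℝ → ℝ}
    (hV : ∀ a b, -1 ≤ a → a ≤ b → b ≤ 0 → ‖η b - η a‖ ≤ V b - V a) (N : ℕ)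
    (F : C(Icc (-1 : ℝ) 0, X)) : ‖uniformRSSum η N F‖ ≤ (V 0 - V (-1)) * ‖F‖ := by
  rw [uniformRSSum_apply]
  refine (norm_sum_le _ _).trans (le_trans (Finset.sum_le_sum fun i _ => ?_)
    (sum_norm_increment_mul_le hV N (norm_nonneg F) (β := fun _ => ‖F‖) fun _ _ => le_rfl))
  exact ((ContinuousLinearMap.le_opNorm _ _)).trans
    (mul_le_mul_of_nonneg_left (F.norm_coe_le_norm _) (norm_nonneg _))

/-- The Riemann-Stieltjes integral of continuous functions exists and defines a bounded operator,
the strong limit of the sums over uniform partitions. -/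
theorem exists_rsOperator [CompleteSpace X] {η : ℝ → X →L[𝕜] X}
    (hη : BoundedVariationOn η (Icc (-1 : ℝ) 0)) :
    ∃ Φ : C(Icc (-1 : ℝ) 0, X) →L[𝕜] X, (∀ F, HasRSIntegral η F (Φ F)) ∧
      ∀ F, Tendsto (fun N => uniformRSSum η N F) atTop (𝓝 (Φ F)) := by
  obtain ⟨V, hV0, hV⟩ := exists_dominating_function hη
  have hVnn : 0 ≤ V 0 - V (-1) := (norm_nonneg _).trans (hV (-1) 0 le_rfl (by norm_num) le_rfl)
  have hcomp : ∀ (F : C(Icc (-1 : ℝ) 0, X)) (ε : ℝ), 0 < ε → ∃ δ > 0,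
      ∀ N : ℕ, 1 / (N + 1 : ℝ) < δ → ∀ (n : ℕ) (s : ℕ → ℝ) (τ : ℕ → Icc (-1 : ℝ) 0),
      s 0 = -1 → s n = 0 →
      (∀ i < n, s i ≤ s (i + 1) ∧ s (i + 1) - s i < δ ∧
        (τ i : ℝ) ∈ Icc (s i) (s (i + 1))) →
      ‖(∑ i ∈ Finset.range n, (η (s (i + 1)) - η (s i)) (F (τ i))) - uniformRSSum η N F‖ < ε := by
    intro F ε hε
    have huc := CompactSpace.uniformContinuous_of_continuous F.continuous
    rw [Metric.uniformContinuous_iff] at huc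
    obtain ⟨δ, hδ, h⟩ := huc (ε / (V 0 - V (-1) + 1)) (by positivity)
    refine ⟨δ / 2, half_pos hδ, fun N hN n s τ hs0 hsn hs => ?_⟩
    rw [uniformRSSum_apply]
    refine lt_of_le_of_lt (norm_rsSum_sub_le (ε := ε / (V 0 - V (-1) + 1)) hV ?_ hs0 hsn hs
      (r := fun i => -1 + (i : ℕ) / (N + 1 : ℝ)) ?_ ?_ ?_) ?_
    · intro x y hxy
      rw [← dist_eq_norm]
      refine (h ?_).le
      rw [Subtype.dist_eq, Real.dist_eq]
      linarith
    · simp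
    · push_cast; rw [div_self (by positivity)]; norm_num
    · intro i hi
      obtain ⟨a, b, c, -⟩ := uniform_partition hi
      refine ⟨a, by rw [b]; exact hN, ?_⟩
      rw [projIcc_of_mem _ c]
      exact ⟨le_rfl, a⟩
    · rw [div_mul_eq_mul_div, div_lt_iff₀ (by positivity)]
      nlinarith
  have hunif : ∀ (δ : ℝ), 0 < δ → ∃ N0 : ℕ, ∀ N ≥ N0, 1 / (N + 1 : ℝ) < δ := by
    intro δ hδ
    have := (tendsto_one_div_add_atTop_nhds_zero_nat (𝕜 := ℝ)).eventually (gt_mem_nhds hδ)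
    exact eventually_atTop.1 this
  have hcauchy : ∀ F : C(Icc (-1 : ℝ) 0, X), CauchySeq fun N => uniformRSSum η N F := by
    intro F
    rw [Metric.cauchySeq_iff]
    intro ε hε
    obtain ⟨δ, hδ, h⟩ := hcomp F ε hε
    obtain ⟨N0, hN0⟩ := hunif δ hδ
    refine ⟨N0, fun M hM N hN => ?_⟩
    have := h N (hN0 N hN) (M + 1) (fun i => -1 + (i : ℕ) / (M + 1 : ℝ))
      (fun i => projIcc (-1 : ℝ) 0 (by norm_num) (-1 + i / (M + 1 : ℝ))) (by simp)
      (by push_cast; rw [div_self (by positivity)]; norm_num)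
      (fun i hi => by
        obtain ⟨a, b, c, -⟩ := uniform_partition hi
        refine ⟨a, by rw [b]; exact hN0 M hM, ?_⟩
        rw [projIcc_of_mem _ c]
        exact ⟨le_rfl, a⟩)
    rw [dist_eq_norm, uniformRSSum_apply η M]
    exact this
  choose I hI using fun F => cauchySeq_tendsto_of_complete (hcauchy F)
  let Φ : C(Icc (-1 : ℝ) 0, X) →L[𝕜] X := LinearMap.mkContinuous
    { toFun := I
      map_add' := fun F G => tendsto_nhds_unique (hI (F + G)) (by
        simpa using (hI F).add (hI G))
      map_smul' := fun c F => tendsto_nhds_unique (hI (c • F)) (by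
        simpa using (hI F).const_smul c) }
    (V 0 - V (-1)) (fun F => le_of_tendsto (hI F).norm
      (Eventually.of_forall fun N => norm_uniformRSSum_le hV N F))
  refine ⟨Φ, fun F ε hε => ?_, hI⟩
  obtain ⟨δ, hδ, h⟩ := hcomp F (ε / 2) (half_pos hε)
  obtain ⟨N0, hN0⟩ := hunif δ hδ
  refine ⟨δ, hδ, fun n s τ hs0 hsn hs => ?_⟩
  obtain ⟨N1, hN1⟩ := Metric.tendsto_atTop.1 (hI F) (ε / 2) (half_pos hε)
  have h1 := h (max N0 N1) (hN0 _ (le_max_left _ _)) n s τ hs0 hsn hs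
  have h2 := hN1 (max N0 N1) (le_max_right _ _)
  rw [dist_eq_norm] at h2
  calc _ = ‖((∑ i ∈ Finset.range n, (η (s (i + 1)) - η (s i)) (F (τ i)))
        - uniformRSSum η (max N0 N1) F) + (uniformRSSum η (max N0 N1) F - I F)‖ := by
        rw [sub_add_sub_cancel]; rfl
    _ < ε / 2 + ε / 2 := (norm_add_le _ _).trans_lt (add_lt_add h1 h2)
    _ = ε := add_halves ε

/-! ### Segments and the integral estimate for the delay operator -/

/-- The history segment `σ ↦ w (t + σ)`, `σ ∈ [-1,0]`. -/
def historySegment (w : C(ℝ, X)) (t : ℝ) : C(Icc (-1 : ℝ) 0, X) where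
  toFun σ := w (t + σ)
  continuous_toFun := w.continuous.comp (continuous_const.add continuous_subtype_val)

@[simp] theorem historySegment_apply (w : C(ℝ, X)) (t : ℝ) (σ : Icc (-1 : ℝ) 0) :
    historySegment w t σ = w (t + σ) := rfl

theorem continuous_historySegment (w : C(ℝ, X)) : Continuous (historySegment w) := by
  have h : Continuous (Function.uncurry fun (t : ℝ) (σ : Icc (-1 : ℝ) 0) => w (t + σ)) :=
    w.continuous.comp (continuous_fst.add (continuous_subtype_val.comp continuous_snd))
  exact ContinuousMap.continuous_of_continuous_uncurry _ h

/-- `Φ` satisfies the `L¹` estimate with constant `κ`: the integral of `‖Φ w_s‖` over `[0,t]` is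
at most `κ` times the supremum of the integrals of `‖w‖` over `[σ, t + σ]`, `σ ∈ [-1,0]`. This
is the only property of the delay operator that the perturbation arguments use. -/
def HasDelayBound (Φ : C(Icc (-1 : ℝ) 0, X) →L[𝕜] X) (κ : ℝ) : Prop :=
  ∀ (w : C(ℝ, X)) (t B : ℝ), 0 ≤ t → (∀ σ ∈ Icc (-1 : ℝ) 0, ∫ s in σ..(t + σ), ‖w s‖ ≤ B) →
    ∫ s in (0 : ℝ)..t, ‖Φ (historySegment w s)‖ ≤ κ * B

/-- For a Riemann-Stieltjes sum, the integral over time of each term is an increment of `η` times an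
integral of `‖w‖` over some `[σ, t + σ]`; the estimate passes to the limit by dominated
convergence. -/
theorem hasDelayBound_of_tendsto {η : ℝ → X →L[𝕜] X}
    (hη : BoundedVariationOn η (Icc (-1 : ℝ) 0)) {Φ : C(Icc (-1 : ℝ) 0, X) →L[𝕜] X}
    (hΦ : ∀ F, Tendsto (fun N => uniformRSSum η N F) atTop (𝓝 (Φ F))) :
    HasDelayBound Φ (totalVar η) := by
  obtain ⟨V, hV0, hV⟩ := exists_dominating_function hη
  intro w t B ht hB
  have hB0 : 0 ≤ B := le_trans (by
    rw [add_zero]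
    exact intervalIntegral.integral_nonneg ht fun _ _ => norm_nonneg _)
    (hB 0 ⟨by norm_num, le_rfl⟩)
  have hw := continuous_historySegment w
  have hlim : Tendsto (fun N => ∫ s in (0 : ℝ)..t, ‖uniformRSSum η N (historySegment w s)‖) atTop
      (𝓝 (∫ s in (0 : ℝ)..t, ‖Φ (historySegment w s)‖)) := by
    refine intervalIntegral.tendsto_integral_filter_of_dominated_convergence
      (fun s => (V 0 - V (-1)) * ‖historySegment w s‖) ?_ ?_ ?_ ?_
    · exact Eventually.of_forall fun N =>
        ((uniformRSSum η N).continuous.comp hw).norm.aestronglyMeasurable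
    · refine Eventually.of_forall fun N => Eventually.of_forall fun s _ => ?_
      rw [norm_norm]
      exact norm_uniformRSSum_le hV N _
    · exact (continuous_const.mul hw.norm).intervalIntegrable _ _
    · exact Eventually.of_forall fun s _ => (hΦ _).norm
  refine le_of_tendsto hlim (Eventually.of_forall fun N => ?_)
  have hcont : ∀ i : ℕ, Continuous fun s =>
      ‖η (-1 + (i + 1 : ℕ) / (N + 1 : ℝ)) - η (-1 + (i : ℕ) / (N + 1 : ℝ))‖ *
        ‖w (s + (-1 + i / (N + 1 : ℝ)))‖ := fun i =>
    continuous_const.mul (w.continuous.comp (continuous_id.add continuous_const)).norm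
  calc ∫ s in (0 : ℝ)..t, ‖uniformRSSum η N (historySegment w s)‖
      ≤ ∫ s in (0 : ℝ)..t, ∑ i ∈ Finset.range (N + 1),
        ‖η (-1 + (i + 1 : ℕ) / (N + 1 : ℝ)) - η (-1 + (i : ℕ) / (N + 1 : ℝ))‖ *
          ‖w (s + (-1 + i / (N + 1 : ℝ)))‖ := by
        refine intervalIntegral.integral_mono_on ht
          (((uniformRSSum η N).continuous.comp hw).norm.intervalIntegrable _ _)
          ((continuous_finsetSum _ fun i _ => hcont i).intervalIntegrable _ _) fun s _ => ?_
        rw [uniformRSSum_apply]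
        refine (norm_sum_le _ _).trans (Finset.sum_le_sum fun i hi => ?_)
        rw [projIcc_of_mem _ (uniform_partition (Finset.mem_range.1 hi)).2.2.1]
        exact ContinuousLinearMap.le_opNorm _ _
    _ = ∑ i ∈ Finset.range (N + 1),
        ‖η (-1 + (i + 1 : ℕ) / (N + 1 : ℝ)) - η (-1 + (i : ℕ) / (N + 1 : ℝ))‖ *
          ∫ s in (0 : ℝ)..t, ‖w (s + (-1 + i / (N + 1 : ℝ)))‖ := by
        rw [intervalIntegral.integral_finsetSum
          fun i _ => (hcont i).intervalIntegrable _ _]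
        simp only [intervalIntegral.integral_const_mul]
    _ ≤ (V 0 - V (-1)) * B := by
        refine sum_norm_increment_mul_le hV N hB0 fun i hi => ?_
        rw [intervalIntegral.integral_comp_add_right (fun s => ‖w s‖), zero_add]
        exact hB _ (uniform_partition hi).2.2.1
    _ = totalVar η * B := by rw [hV0]

end RSIntegral

/-! ### Weak derivatives on `(-1,0)` -/

section WeakDeriv

variable {X : Type*} [NormedAddCommGroup X] [NormedSpace ℝ X]

instance isProbabilityMeasure_delayMeasure : IsProbabilityMeasure delayMeasure :=
  ⟨by simp⟩

theorem IsWeakDeriv.congr_left {f f' g : ℝ → X} (h : IsWeakDeriv f g)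
    (hf : f =ᵐ[delayMeasure] f') : IsWeakDeriv f' g := fun φ h1 h2 h3 => by
  rw [← h φ h1 h2 h3]
  refine integral_congr_ae ?_
  filter_upwards [hf] with s hs
  rw [hs]

theorem IsWeakDeriv.sub {f f' g g' : ℝ → X} (h : IsWeakDeriv f g) (h' : IsWeakDeriv f' g')
    (hf : IntegrableOn f (Icc (-1 : ℝ) 0)) (hf' : IntegrableOn f' (Icc (-1 : ℝ) 0))
    (hg : IntegrableOn g (Icc (-1 : ℝ) 0)) (hg' : IntegrableOn g' (Icc (-1 : ℝ) 0)) :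
    IsWeakDeriv (fun s => f s - f' s) (fun s => g s - g' s) := fun φ h1 h2 h3 => by
  have key : ∀ (ψ : ℝ → ℝ), Continuous ψ → ∀ a b : ℝ → X, IntegrableOn a (Icc (-1 : ℝ) 0) →
      IntegrableOn b (Icc (-1 : ℝ) 0) → ∫ s in Icc (-1 : ℝ) 0, ψ s • (a s - b s) =
      (∫ s in Icc (-1 : ℝ) 0, ψ s • a s) - ∫ s in Icc (-1 : ℝ) 0, ψ s • b s := by
    intro ψ hψ a b ha hb
    rw [← integral_sub (ha.continuousOn_smul hψ.continuousOn isCompact_Icc)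
      (hb.continuousOn_smul hψ.continuousOn isCompact_Icc)]
    simp only [smul_sub]
  rw [key _ (h1.continuous_deriv (by simp)) _ _ hf hf', key _ h1.continuous _ _ hg hg',
    h φ h1 h2 h3, h' φ h1 h2 h3]
  abel

theorem eq_zero_of_tsupport_subset_Ioo {φ : ℝ → ℝ} {a b : ℝ} (h : tsupport φ ⊆ Ioo a b) {x : ℝ}
    (hx : x ∉ Ioo a b) : φ x = 0 :=
  image_eq_zero_of_notMem_tsupport fun hx' => hx (h hx')

/-- A primitive of an integrable function has that function as weak derivative. -/
theorem isWeakDeriv_of_primitive [CompleteSpace X] {f g : ℝ → X}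
    (hg : IntegrableOn g (Icc (-1 : ℝ) 0)) (c : X)
    (hf : ∀ᵐ σ ∂delayMeasure, f σ = c + ∫ s in (-1 : ℝ)..σ, g s) : IsWeakDeriv f g := by
  have h10 : (-1 : ℝ) ≤ 0 := by norm_num
  refine IsWeakDeriv.congr_left (f := fun σ => c + ∫ s in (-1 : ℝ)..σ, g s) ?_ (by
    filter_upwards [hf] with σ hσ using hσ.symm)
  intro φ h1 h2 h3
  have hd : Continuous (deriv φ) := h1.continuous_deriv (by simp)
  have hφ : ∀ a b, ∫ s in a..b, deriv φ s = φ b - φ a := fun a b =>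
    intervalIntegral.integral_deriv_eq_sub
      (fun x _ => (h1.differentiable (by simp)).differentiableAt) (hd.intervalIntegrable _ _)
  have hφ0 : φ 0 = 0 := eq_zero_of_tsupport_subset_Ioo h3 (by simp)
  have hφ1 : φ (-1) = 0 := eq_zero_of_tsupport_subset_Ioo h3 (by simp)
  have hgi : IntervalIntegrable g volume (-1) 0 :=
    (intervalIntegrable_iff_integrableOn_Icc_of_le h10).2 hg
  have hgI : IntegrableOn g (Ioc (-1) 0) := hg.mono_set Ioc_subset_Icc_self
  have hprim : ContinuousOn (fun σ => ∫ s in (-1 : ℝ)..σ, g s) (Icc (-1) 0) := by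
    have := intervalIntegral.continuousOn_primitive_interval (a := -1) (b := 0) (f := g)
      (μ := volume) (by rwa [uIcc_of_le h10])
    rwa [uIcc_of_le h10] at this
  rw [integral_Icc_eq_integral_Ioc, integral_Icc_eq_integral_Ioc,
    ← intervalIntegral.integral_of_le h10, ← intervalIntegral.integral_of_le h10]
  have e1 : ∫ σ in (-1 : ℝ)..0, deriv φ σ • (c + ∫ s in (-1 : ℝ)..σ, g s)
      = (∫ σ in (-1 : ℝ)..0, deriv φ σ • c)
        + ∫ σ in (-1 : ℝ)..0, ∫ s in (-1 : ℝ)..σ, deriv φ σ • g s := by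
    rw [← intervalIntegral.integral_add]
    · refine intervalIntegral.integral_congr fun σ _ => ?_
      simp only [smul_add, intervalIntegral.integral_smul]
    · exact (hd.smul continuous_const).intervalIntegrable _ _
    · simp only [intervalIntegral.integral_smul]
      refine ContinuousOn.intervalIntegrable ?_
      rw [uIcc_of_le h10]
      exact hd.continuousOn.smul hprim
  rw [e1, intervalIntegral.integral_smul_const, hφ, hφ0, hφ1, sub_zero, zero_smul, zero_add,
    integral_triangle_swap h10, ← intervalIntegral.integral_neg]
  · refine intervalIntegral.integral_congr fun s _ => ?_
    rw [intervalIntegral.integral_smul_const, hφ, hφ0, zero_sub, neg_smul]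
  · rw [IntegrableOn, ← Measure.prod_restrict]
    exact Integrable.smul_prod ((hd.integrableOn_Icc).mono_set Ioc_subset_Icc_self) hgI

/-- A function with vanishing weak derivative is almost everywhere constant. -/
theorem ae_const_of_isWeakDeriv_zero [CompleteSpace X] {f : ℝ → X}
    (hf : IntegrableOn f (Icc (-1 : ℝ) 0)) (h : IsWeakDeriv f fun _ => 0) :
    ∃ c, ∀ᵐ σ ∂delayMeasure, f σ = c := by
  let β : ContDiffBump (-1 / 2 : ℝ) := ⟨1 / 8, 1 / 4, by norm_num, by norm_num⟩
  set ψ₀ : ℝ → ℝ := β.normed volume with hψ₀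
  have hψ₀i : ∫ x, ψ₀ x = 1 := β.integral_normed
  have hψ₀s : tsupport ψ₀ ⊆ Ioo (-1) 0 := by
    rw [β.tsupport_normed_eq, Real.closedBall_eq_Icc]
    intro x hx
    have h1 : (-1 / 2 : ℝ) - 1 / 4 ≤ x := hx.1
    have h2 : x ≤ (-1 / 2 : ℝ) + 1 / 4 := hx.2
    constructor <;> linarith
  have hψ₀d : ContDiff ℝ (⊤ : ℕ∞) ψ₀ := β.contDiff_normed
  have hψ₀c : HasCompactSupport ψ₀ := β.hasCompactSupport_normed
  set c : X := ∫ s in Icc (-1 : ℝ) 0, ψ₀ s • f s with hc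
  refine ⟨c, ?_⟩
  have hkey : ∀ᵐ s : ℝ, s ∈ Ioo (-1 : ℝ) 0 → f s - c = 0 := by
    have hfc : IntegrableOn (fun s => f s - c) (Icc (-1 : ℝ) 0) :=
      Integrable.sub hf (integrable_const c)
    refine isOpen_Ioo.ae_eq_zero_of_integral_contDiff_smul_eq_zero
      (hfc.mono_set Ioo_subset_Icc_self).locallyIntegrableOn ?_
    intro ψ hψd hψc hψs
    -- `χ` has integral zero, so it is the derivative of a test function
    set m : ℝ := ∫ x, ψ x with hm
    set χ : ℝ → ℝ := fun x => ψ x - m * ψ₀ x with hχ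
    have hχd : ContDiff ℝ (⊤ : ℕ∞) χ := hψd.sub (contDiff_const.mul hψ₀d)
    have hχcont : Continuous χ := hχd.continuous
    have hψi : Integrable ψ := hψd.continuous.integrable_of_hasCompactSupport hψc
    have hψ₀int : Integrable ψ₀ := hψ₀d.continuous.integrable_of_hasCompactSupport hψ₀c
    have hχint : ∫ x, χ x = 0 := by
      rw [hχ, integral_sub hψi (hψ₀int.const_mul m), integral_const_mul, hψ₀i, mul_one, sub_self]
    -- a compact interval containing both supports
    obtain ⟨a, b, ha, hle, hb, hab⟩ : ∃ a b : ℝ, -1 < a ∧ a ≤ b ∧ b < 0 ∧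
        ∀ x ∉ Icc a b, χ x = 0 := by
      have hK : IsCompact (tsupport ψ ∪ tsupport ψ₀) := hψc.union hψ₀c
      have hne : (tsupport ψ ∪ tsupport ψ₀).Nonempty := by
        refine Nonempty.inr ?_
        rw [β.tsupport_normed_eq]
        exact ⟨_, Metric.mem_closedBall_self β.rOut_pos.le⟩
      obtain ⟨a, haK, ha⟩ := hK.exists_isLeast hne
      obtain ⟨b, hbK, hb⟩ := hK.exists_isGreatest hne
      refine ⟨a, b, (union_subset hψs hψ₀s haK).1, ha hbK, (union_subset hψs hψ₀s hbK).2,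
        fun x hx => ?_⟩
      have hx' : x ∉ tsupport ψ ∪ tsupport ψ₀ := fun hx' => hx ⟨ha hx', hb hx'⟩
      rw [mem_union, not_or] at hx'
      simp only [hχ, image_eq_zero_of_notMem_tsupport hx'.1,
        image_eq_zero_of_notMem_tsupport hx'.2, mul_zero, sub_zero]
    set φ : ℝ → ℝ := fun x => ∫ s in (-1 : ℝ)..x, χ s with hφ
    have hφd : ∀ x, HasDerivAt φ (χ x) x := fun x =>
      intervalIntegral.integral_hasDerivAt_right (hχcont.intervalIntegrable _ _)
        hχcont.stronglyMeasurable.stronglyMeasurableAtFilter hχcont.continuousAt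
    have hφ' : deriv φ = χ := funext fun x => (hφd x).deriv
    have hφs : ∀ x ∉ Icc a b, φ x = 0 := by
      intro x hx
      rw [mem_Icc, not_and_or, not_le, not_le] at hx
      rcases hx with hx | hx
      · have : ∀ s ∈ uIcc (-1) x, χ s = (fun _ => (0 : ℝ)) s := fun s hs => hab s fun hs' => by
          have h5 : s ≤ max (-1) x := hs.2
          have := h5.trans_lt (max_lt ha hx)
          linarith [hs'.1]
        simp only [hφ]
        rw [intervalIntegral.integral_congr this, intervalIntegral.integral_zero]
      · simp only [hφ]
        have h4 : (-1 : ℝ) ≤ x := by linarith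
        rw [intervalIntegral.integral_of_le h4, ← hχint]
        refine setIntegral_eq_integral_of_forall_compl_eq_zero fun s hs => hab s fun hs' => hs
          ⟨ha.trans_le hs'.1, hs'.2.trans hx.le⟩
    have hφsupp : tsupport φ ⊆ Icc a b :=
      closure_minimal (fun x hx => by_contra fun hx' => hx (hφs x hx')) isClosed_Icc
    have h1 := h φ (contDiff_infty_iff_deriv.2
      ⟨fun x => (hφd x).differentiableAt, by rw [hφ']; exact hχd⟩)
      (HasCompactSupport.of_support_subset_isCompact isCompact_Icc
        ((subset_tsupport φ).trans hφsupp))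
      (hφsupp.trans fun x hx => ⟨ha.trans_le hx.1, hx.2.trans_lt hb⟩)
    simp only [smul_zero, integral_zero, neg_zero, hφ'] at h1
    have hi : ∀ ξ : ℝ → ℝ, Continuous ξ → ∀ k : ℝ → X, IntegrableOn k (Icc (-1 : ℝ) 0) →
        IntegrableOn (fun s => ξ s • k s) (Icc (-1 : ℝ) 0) := fun ξ hξ k hk =>
      hk.continuousOn_smul hξ.continuousOn isCompact_Icc
    have h2 : ∫ s in Icc (-1 : ℝ) 0, ψ s • f s = m • c := by
      have e : ∀ s, χ s • f s = ψ s • f s - m • (ψ₀ s • f s) := fun s => by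
        simp only [hχ, sub_smul, mul_smul]
      simp only [e] at h1
      have h5 : IntegrableOn (fun s => m • (ψ₀ s • f s)) (Icc (-1 : ℝ) 0) :=
        Integrable.smul m (hi _ hψ₀d.continuous _ hf)
      rw [integral_sub (hi _ hψd.continuous _ hf) h5, integral_smul] at h1
      exact sub_eq_zero.1 h1
    have h3 : ∫ s in Icc (-1 : ℝ) 0, ψ s = m :=
      setIntegral_eq_integral_of_forall_compl_eq_zero fun s hs =>
        eq_zero_of_tsupport_subset_Ioo hψs fun hs' => hs (Ioo_subset_Icc_self hs')
    rw [← setIntegral_eq_integral_of_forall_compl_eq_zero (s := Icc (-1 : ℝ) 0)]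
    · simp only [smul_sub]
      rw [integral_sub (hi _ hψd.continuous _ hf)
        (hi _ hψd.continuous _ (integrable_const c)), h2, integral_smul_const, h3, sub_self]
    · intro s hs
      rw [eq_zero_of_tsupport_subset_Ioo hψs fun hs' => hs (Ioo_subset_Icc_self hs'), zero_smul]
  have h6 : ∀ᵐ s ∂(volume.restrict (Ioo (-1 : ℝ) 0)), f s - c = 0 :=
    (ae_restrict_iff' measurableSet_Ioo).2 hkey
  rw [Measure.restrict_congr_set (Ioo_ae_eq_Icc (μ := volume) (a := (-1 : ℝ)) (b := 0))] at h6
  filter_upwards [h6] with s hs using sub_eq_zero.1 hs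

/-- A function with an integrable weak derivative is almost everywhere a primitive of it. -/
theorem IsWeakDeriv.ae_eq_primitive [CompleteSpace X] {f g : ℝ → X}
    (hf : IntegrableOn f (Icc (-1 : ℝ) 0)) (hg : IntegrableOn g (Icc (-1 : ℝ) 0))
    (h : IsWeakDeriv f g) : ∃ c, ∀ᵐ σ ∂delayMeasure, f σ = c + ∫ s in (-1 : ℝ)..σ, g s := by
  have h10 : (-1 : ℝ) ≤ 0 := by norm_num
  have hP : IntegrableOn (fun σ => ∫ s in (-1 : ℝ)..σ, g s) (Icc (-1 : ℝ) 0) := by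
    have := intervalIntegral.continuousOn_primitive_interval (a := -1) (b := 0) (f := g)
      (μ := volume) (by rwa [uIcc_of_le h10])
    rw [uIcc_of_le h10] at this
    exact this.integrableOn_Icc
  have h1 : IsWeakDeriv (fun σ => ∫ s in (-1 : ℝ)..σ, g s) g :=
    isWeakDeriv_of_primitive hg 0 (Eventually.of_forall fun σ => (zero_add _).symm)
  have h2 := h.sub h1 hf hP hg hg
  simp only [sub_self] at h2
  obtain ⟨c, hc⟩ := ae_const_of_isWeakDeriv_zero (Integrable.sub hf hP) h2
  exact ⟨c, by filter_upwards [hc] with σ hσ using sub_eq_iff_eq_add.1 hσ⟩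

end WeakDeriv

/-! ### Continuous functions, primitives and `L^p([-1,0],X)` -/

section DelayLpLemmas

variable {X : Type*} [NormedAddCommGroup X]

theorem continuous_iccExtend_delay (F : C(Icc (-1 : ℝ) 0, X)) :
    Continuous (IccExtend (by norm_num : (-1 : ℝ) ≤ 0) F) :=
  F.continuous.Icc_extend'

theorem norm_iccExtend_le (F : C(Icc (-1 : ℝ) 0, X)) (s : ℝ) :
    ‖IccExtend (by norm_num : (-1 : ℝ) ≤ 0) F s‖ ≤ ‖F‖ := F.norm_coe_le_norm _

theorem memLp_iccExtend (p : ℝ≥0∞) (F : C(Icc (-1 : ℝ) 0, X)) :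
    MemLp (IccExtend (by norm_num : (-1 : ℝ) ≤ 0) F) p delayMeasure :=
  MemLp.of_bound (continuous_iccExtend_delay F).aestronglyMeasurable ‖F‖
    (Eventually.of_forall fun s => norm_iccExtend_le F s)

theorem isContRep_iff_ae (F : C(Icc (-1 : ℝ) 0, X)) (f : ℝ → X) :
    IsContRep F f ↔ f =ᵐ[delayMeasure] IccExtend (by norm_num : (-1 : ℝ) ≤ 0) F := by
  rw [EventuallyEq, ae_restrict_iff' measurableSet_Icc]
  refine eventually_congr (Eventually.of_forall fun s => forall_congr' fun hs => ?_)
  rw [IccExtend_of_mem _ _ hs]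

variable {p : ℝ≥0∞} [Fact (1 ≤ p)]

theorem DelayLp.integrableOn (f : DelayLp X p) : IntegrableOn f (Icc (-1 : ℝ) 0) :=
  (Lp.memLp f).integrable Fact.out

theorem DelayLp.intervalIntegrable (f : DelayLp X p) {a b : ℝ} (ha : a ∈ Icc (-1 : ℝ) 0)
    (hb : b ∈ Icc (-1 : ℝ) 0) : IntervalIntegrable f volume a b :=
  intervalIntegrable_iff.2 (f.integrableOn.mono_set
    (uIoc_subset_uIcc.trans (uIcc_subset_Icc ha hb)))

theorem DelayLp.integral_norm_le (f : DelayLp X p) :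
    ∫ s in Icc (-1 : ℝ) 0, ‖f s‖ ≤ ‖f‖ := by
  have h := Lp.memLp f
  rw [Lp.norm_def, integral_norm_eq_lintegral_enorm h.1]
  refine ENNReal.toReal_mono (Lp.eLpNorm_ne_top f) ?_
  rw [← eLpNorm_one_eq_lintegral_enorm]
  exact eLpNorm_le_eLpNorm_of_exponent_le Fact.out h.1

theorem DelayLp.intervalIntegral_norm_le (f : DelayLp X p) {a b : ℝ} (ha : -1 ≤ a) (hab : a ≤ b)
    (hb : b ≤ 0) : ∫ s in a..b, ‖f s‖ ≤ ‖f‖ := by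
  rw [intervalIntegral.integral_of_le hab]
  refine le_trans ?_ f.integral_norm_le
  exact setIntegral_mono_set f.integrableOn.norm (Eventually.of_forall fun _ => norm_nonneg _)
    (Ioc_subset_Icc_self.trans (Icc_subset_Icc ha hb)).eventuallyLE

variable [NormedSpace ℝ X]

theorem DelayLp.norm_intervalIntegral_le (f : DelayLp X p) {a b : ℝ} (ha : a ∈ Icc (-1 : ℝ) 0)
    (hb : b ∈ Icc (-1 : ℝ) 0) : ‖∫ s in a..b, f s‖ ≤ ‖f‖ := by
  refine intervalIntegral.norm_integral_le_integral_norm_uIoc.trans ?_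
  refine le_trans ?_ f.integral_norm_le
  exact setIntegral_mono_set f.integrableOn.norm (Eventually.of_forall fun _ => norm_nonneg _)
    (uIoc_subset_uIcc.trans (uIcc_subset_Icc ha hb)).eventuallyLE

/-- Integration over `[a,b] ⊆ [-1,0]` as a bounded operator on `L^p([-1,0],X)`. -/
noncomputable def lpIntegral (p : ℝ≥0∞) [Fact (1 ≤ p)] (a b : Icc (-1 : ℝ) 0) :
    DelayLp X p →L[ℝ] X :=
  LinearMap.mkContinuous
    { toFun := fun f => ∫ s in (a : ℝ)..b, f s
      map_add' := fun f g => by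
        rw [← intervalIntegral.integral_add (f.intervalIntegrable a.2 b.2)
          (g.intervalIntegrable a.2 b.2)]
        refine intervalIntegral.integral_congr_ae ?_
        have h := (ae_restrict_iff' measurableSet_Icc).1 (Lp.coeFn_add f g)
        filter_upwards [h] with s hs hs'
        exact hs (uIoc_subset_uIcc.trans (uIcc_subset_Icc a.2 b.2) hs')
      map_smul' := fun c f => by
        rw [RingHom.id_apply, ← intervalIntegral.integral_smul]
        refine intervalIntegral.integral_congr_ae ?_
        have h := (ae_restrict_iff' measurableSet_Icc).1 (Lp.coeFn_smul c f)
        filter_upwards [h] with s hs hs'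
        exact hs (uIoc_subset_uIcc.trans (uIcc_subset_Icc a.2 b.2) hs') }
    1 (fun f => by
      rw [one_mul]
      exact f.norm_intervalIntegral_le a.2 b.2)

theorem lpIntegral_apply (a b : Icc (-1 : ℝ) 0) (f : DelayLp X p) :
    lpIntegral p a b f = ∫ s in (a : ℝ)..b, f s := rfl

theorem norm_lpIntegral_le (a b : Icc (-1 : ℝ) 0) (f : DelayLp X p) :
    ‖lpIntegral p a b f‖ ≤ ‖f‖ := f.norm_intervalIntegral_le a.2 b.2

/-- The inclusion of `C([-1,0],X)` into `L^p([-1,0],X)`. -/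
noncomputable def contToLp (p : ℝ≥0∞) [Fact (1 ≤ p)] :
    C(Icc (-1 : ℝ) 0, X) →L[ℝ] DelayLp X p :=
  LinearMap.mkContinuous
    { toFun := fun F => (memLp_iccExtend p F).toLp _
      map_add' := fun _ _ => rfl
      map_smul' := fun _ _ => rfl }
    1 (fun F => by
      have h := Lp.norm_le_of_ae_bound (f := (memLp_iccExtend p F).toLp _) (norm_nonneg F) (by
        filter_upwards [(memLp_iccExtend p F).coeFn_toLp] with s hs
        rw [hs]
        exact norm_iccExtend_le F s)
      have h1 : measureUnivNNReal delayMeasure = 1 := by simp [measureUnivNNReal]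
      rw [h1, NNReal.coe_one, Real.one_rpow] at h
      exact h)

theorem contToLp_ae (F : C(Icc (-1 : ℝ) 0, X)) :
    contToLp p F =ᵐ[delayMeasure] IccExtend (by norm_num : (-1 : ℝ) ≤ 0) F :=
  (memLp_iccExtend p F).coeFn_toLp

theorem norm_contToLp_le (F : C(Icc (-1 : ℝ) 0, X)) : ‖contToLp p F‖ ≤ ‖F‖ := by
  refine (ContinuousLinearMap.le_of_opNorm_le _
    (LinearMap.mkContinuous_norm_le _ zero_le_one _) F).trans ?_
  rw [one_mul]

theorem isContRep_iff_eq_contToLp (F : C(Icc (-1 : ℝ) 0, X)) (f : DelayLp X p) :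
    IsContRep F f ↔ f = contToLp p F := by
  rw [isContRep_iff_ae]
  exact ⟨fun h => Lp.ext (h.trans (contToLp_ae F).symm), fun h => h ▸ contToLp_ae F⟩

theorem contToLp_injective : Function.Injective (contToLp p : C(Icc (-1 : ℝ) 0, X) → DelayLp X p) :=
  fun F G h => isContRep_unique ((isContRep_iff_eq_contToLp F (contToLp p F)).2 rfl)
    ((isContRep_iff_eq_contToLp G (contToLp p F)).2 h)

theorem integral_contToLp (F : C(Icc (-1 : ℝ) 0, X)) (a b : Icc (-1 : ℝ) 0) :
    ∫ s in (a : ℝ)..b, contToLp p F s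
      = ∫ s in (a : ℝ)..b, IccExtend (by norm_num : (-1 : ℝ) ≤ 0) F s := by
  refine intervalIntegral.integral_congr_ae ?_
  have h := (ae_restrict_iff' measurableSet_Icc).1 (contToLp_ae (p := p) F)
  filter_upwards [h] with s hs hs'
  exact hs (uIoc_subset_uIcc.trans (uIcc_subset_Icc a.2 b.2) hs')

/-- For a continuous function, weak differentiability means being a primitive. -/
theorem isWeakDeriv_contToLp_iff [CompleteSpace X] (F : C(Icc (-1 : ℝ) 0, X)) (g : DelayLp X p) :
    IsWeakDeriv (contToLp p F) g ↔
      ∀ σ : Icc (-1 : ℝ) 0, F σ = F ⟨0, by norm_num⟩ + ∫ s in (0 : ℝ)..σ, g s := by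
  have h10 : (-1 : ℝ) ≤ 0 := by norm_num
  have hm1 : (-1 : ℝ) ∈ Icc (-1 : ℝ) 0 := by norm_num
  have h0 : (0 : ℝ) ∈ Icc (-1 : ℝ) 0 := by norm_num
  constructor
  · intro h
    obtain ⟨c, hc⟩ := h.ae_eq_primitive (contToLp p F).integrableOn g.integrableOn
    have hcont : ContinuousOn (fun σ => c + ∫ s in (-1 : ℝ)..σ, g s) (Icc (-1) 0) := by
      have := intervalIntegral.continuousOn_primitive_interval (a := -1) (b := 0) (f := g)
        (μ := volume) (by rw [uIcc_of_le h10]; exact g.integrableOn)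
      rw [uIcc_of_le h10] at this
      exact continuousOn_const.add this
    have heq := Measure.eqOn_Icc_of_ae_eq volume (by norm_num) ((contToLp_ae F).symm.trans hc)
      (continuous_iccExtend_delay F).continuousOn hcont
    have hF : ∀ σ : Icc (-1 : ℝ) 0, F σ = c + ∫ s in (-1 : ℝ)..σ, g s := fun σ => by
      have := heq σ.2
      rwa [IccExtend_of_mem _ _ σ.2] at this
    intro σ
    rw [hF σ, hF ⟨0, h0⟩, add_assoc, intervalIntegral.integral_add_adjacent_intervals
      (g.intervalIntegrable hm1 h0) (g.intervalIntegrable h0 σ.2)]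
  · intro h
    refine isWeakDeriv_of_primitive g.integrableOn
      (F ⟨0, h0⟩ + ∫ s in (0 : ℝ)..(-1), g s) ?_
    filter_upwards [contToLp_ae (p := p) F, ae_restrict_mem measurableSet_Icc] with σ h1 hσ
    rw [h1, IccExtend_of_mem _ _ hσ, h ⟨σ, hσ⟩, add_assoc,
      intervalIntegral.integral_add_adjacent_intervals
      (g.intervalIntegrable h0 hm1) (g.intervalIntegrable hm1 hσ)]

/-- `W^{1,p}` embeds in the continuous functions. -/
theorem exists_contRep [CompleteSpace X] {f g : DelayLp X p} (h : IsWeakDeriv f g) :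
    ∃ F : C(Icc (-1 : ℝ) 0, X), f = contToLp p F := by
  have h10 : (-1 : ℝ) ≤ 0 := by norm_num
  obtain ⟨c, hc⟩ := h.ae_eq_primitive f.integrableOn g.integrableOn
  have hcont : ContinuousOn (fun σ => c + ∫ s in (-1 : ℝ)..σ, g s) (Icc (-1) 0) := by
    have := intervalIntegral.continuousOn_primitive_interval (a := -1) (b := 0) (f := g)
      (μ := volume) (by rw [uIcc_of_le h10]; exact g.integrableOn)
    rw [uIcc_of_le h10] at this
    exact continuousOn_const.add this
  refine ⟨⟨_, continuousOn_iff_continuous_domRestrict.1 hcont⟩, ?_⟩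
  rw [← isContRep_iff_eq_contToLp]
  filter_upwards [(ae_restrict_iff' measurableSet_Icc).1 hc] with s hs hs'
  exact hs hs'

/-- The embedding of `W^{1,p}` is bounded: every value of `F` differs from any other by at most
`‖g‖`, and the average of `‖F‖` is at most its `L^p` norm. -/
theorem norm_contRep_le {F : C(Icc (-1 : ℝ) 0, X)} {g : DelayLp X p}
    (h : ∀ σ : Icc (-1 : ℝ) 0, F σ = F ⟨0, by norm_num⟩ + ∫ s in (0 : ℝ)..σ, g s) :
    ‖F‖ ≤ ‖contToLp p F‖ + ‖g‖ := by
  have h0 : (0 : ℝ) ∈ Icc (-1 : ℝ) 0 := by norm_num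
  have key : ∀ σ τ : Icc (-1 : ℝ) 0, ‖F σ‖ ≤ ‖F τ‖ + ‖g‖ := fun σ τ => by
    have h1 : F σ = F τ + ∫ s in (τ : ℝ)..σ, g s := by
      rw [h σ, h τ, add_assoc, intervalIntegral.integral_add_adjacent_intervals
        (g.intervalIntegrable h0 τ.2) (g.intervalIntegrable τ.2 σ.2)]
    rw [h1]
    exact (norm_add_le _ _).trans (add_le_add_right (g.norm_intervalIntegral_le τ.2 σ.2) _)
  rw [ContinuousMap.norm_le _ (by positivity)]
  intro σ
  have h2 : ∫ τ in Icc (-1 : ℝ) 0, (‖F σ‖ - ‖g‖) ≤ ∫ τ in Icc (-1 : ℝ) 0, ‖contToLp p F τ‖ := by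
    refine integral_mono_ae (integrable_const _) (contToLp p F).integrableOn.norm ?_
    filter_upwards [contToLp_ae (p := p) F] with τ hτ
    rw [hτ]
    exact sub_le_iff_le_add.2 (key σ (projIcc (-1) 0 (by norm_num) τ))
  rw [integral_const] at h2
  simp only [measureReal_def, measure_univ, ENNReal.toReal_one, one_smul] at h2
  linarith [(contToLp p F).integral_norm_le]

/-- Continuous functions with prescribed value at `0` are dense in `L^p`. -/
theorem exists_continuous_near (hp : p ≠ ⊤) (f : DelayLp X p) (y : X) {ε : ℝ} (hε : 0 < ε) :
    ∃ F : C(Icc (-1 : ℝ) 0, X), F ⟨0, by norm_num⟩ = y ∧ ‖contToLp p F - f‖ < ε := by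
  have hp0 : p ≠ 0 := (lt_of_lt_of_le one_pos (Fact.out : 1 ≤ p)).ne'
  obtain ⟨g, hg, -⟩ := (Lp.memLp f).exists_boundedContinuous_eLpNorm_sub_le hp
    (ε := ENNReal.ofReal (ε / 2)) (by simpa using hε)
  let G : C(Icc (-1 : ℝ) 0, X) := ⟨fun σ => g σ, g.continuous.comp continuous_subtype_val⟩
  have hG : ‖contToLp p G - f‖ ≤ ε / 2 := by
    rw [norm_sub_rev, Lp.norm_def]
    refine ENNReal.toReal_le_of_le_ofReal (by positivity) (le_trans (le_of_eq ?_) hg)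
    refine eLpNorm_congr_ae ?_
    filter_upwards [Lp.coeFn_sub f (contToLp p G), contToLp_ae (p := p) G,
      ae_restrict_mem measurableSet_Icc] with s h1 h2 hs
    rw [h1, Pi.sub_apply, h2, IccExtend_of_mem _ _ hs, Pi.sub_apply]
    rfl
  set c : X := y - G ⟨0, by norm_num⟩ with hc
  -- a tent of height one and width `δ` carries the correction of the value at `0`
  let K : ℝ → C(Icc (-1 : ℝ) 0, X) := fun δ =>
    ⟨fun σ => max 0 (1 + (σ : ℝ) / δ) • c, by fun_prop⟩
  have hK : ∀ δ, 0 < δ → δ ≤ 1 →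
      ‖contToLp p (K δ)‖ ≤ ‖c‖ * δ ^ (1 / p.toReal) := by
    intro δ hδ hδ1
    have h1 : ‖contToLp p (K δ)‖ ≤ ‖indicatorConstLp p (μ := delayMeasure)
        (measurableSet_Icc (a := -δ) (b := 0)) (measure_ne_top _ _) c‖ := by
      refine Lp.norm_le_norm_of_ae_le ?_
      filter_upwards [contToLp_ae (p := p) (K δ), ae_restrict_mem measurableSet_Icc,
        indicatorConstLp_coeFn (p := p) (μ := delayMeasure)
          (hs := measurableSet_Icc (a := -δ) (b := 0)) (hμs := measure_ne_top _ _) (c := c)]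
        with s h1 hs h2
      rw [h1, h2, IccExtend_of_mem _ _ hs]
      change ‖max 0 (1 + s / δ) • c‖ ≤ _
      by_cases hsδ : s ∈ Icc (-δ) 0
      · rw [indicator_of_mem hsδ, norm_smul]
        have h3 : s / δ ≤ 0 := div_nonpos_of_nonpos_of_nonneg hs.2 hδ.le
        refine mul_le_of_le_one_left (norm_nonneg _) ?_
        rw [Real.norm_of_nonneg (le_max_left _ _)]
        exact max_le zero_le_one (by linarith)
      · have h3 : s < -δ := by
          by_contra h; exact hsδ ⟨not_lt.1 h, hs.2⟩
        have h4 : s / δ ≤ -1 := by rw [div_le_iff₀ hδ]; linarith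
        rw [max_eq_left (by linarith), zero_smul, norm_zero]
        exact norm_nonneg _
    rw [norm_indicatorConstLp hp0 hp] at h1
    refine h1.trans (le_of_eq ?_)
    rw [measureReal_restrict_apply measurableSet_Icc,
      inter_eq_left.2 (Icc_subset_Icc (by linarith) le_rfl)]
    simp [hδ.le]
  have hlim : Tendsto (fun δ : ℝ => ‖c‖ * δ ^ (1 / p.toReal)) (𝓝[>] 0) (𝓝 0) := by
    have hpos : 0 < 1 / p.toReal := one_div_pos.2 (ENNReal.toReal_pos hp0 hp)
    have h1 : ContinuousAt (fun δ : ℝ => ‖c‖ * δ ^ (1 / p.toReal)) 0 :=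
      continuousAt_const.mul (Real.continuousAt_rpow_const _ _ (Or.inr hpos.le))
    have h2 := h1.tendsto
    simp only [Real.zero_rpow hpos.ne', mul_zero] at h2
    exact h2.mono_left nhdsWithin_le_nhds
  obtain ⟨δ, hδ1, hδ0, hδ2⟩ := ((hlim.eventually (gt_mem_nhds (half_pos hε))).and
    (Ioc_mem_nhdsGT zero_lt_one)).exists
  refine ⟨G + K δ, ?_, ?_⟩
  · have : K δ ⟨0, by norm_num⟩ = c := by
      change max 0 (1 + (0 : ℝ) / δ) • c = c
      simp
    rw [ContinuousMap.add_apply, this, hc]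
    abel
  · rw [map_add, add_sub_right_comm]
    calc ‖contToLp p G - f + contToLp p (K δ)‖ ≤ ‖contToLp p G - f‖ + ‖contToLp p (K δ)‖ :=
          norm_add_le _ _
      _ < ε / 2 + ε / 2 := add_lt_add_of_le_of_lt hG ((hK δ hδ0 hδ2).trans_lt hδ1)
      _ = ε := add_halves ε

/-- The integral over `[0,t]` of the history segments of `w`. -/
noncomputable def integralSegment (w : C(ℝ, X)) (t : ℝ) : C(Icc (-1 : ℝ) 0, X) :=
  ∫ s in (0 : ℝ)..t, historySegment w s

theorem integralSegment_apply [CompleteSpace X] (w : C(ℝ, X)) (t : ℝ) (σ : Icc (-1 : ℝ) 0) :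
    integralSegment w t σ = ∫ s in (σ : ℝ)..(t + σ), w s := by
  have h1 := (ContinuousMap.evalCLM ℝ σ).intervalIntegral_comp_comm
    ((continuous_historySegment w).intervalIntegrable (μ := volume) 0 t)
  have h2 : integralSegment w t σ = ∫ s in (0 : ℝ)..t, w (s + σ) := h1.symm
  rw [h2, intervalIntegral.integral_comp_add_right, zero_add]

theorem integral_contToLp_historySegment [CompleteSpace X] (w : C(ℝ, X)) (t : ℝ) :
    ∫ s in (0 : ℝ)..t, contToLp p (historySegment w s) = contToLp p (integralSegment w t) :=
  (contToLp p).intervalIntegral_comp_comm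
    ((continuous_historySegment w).intervalIntegrable (μ := volume) 0 t)

/-- The integrated history segments have the weak derivative `w_t - w_0`. -/
theorem isWeakDeriv_integralSegment [CompleteSpace X] (w : C(ℝ, X)) (t : ℝ) :
    IsWeakDeriv (contToLp p (integralSegment w t))
      (contToLp p (historySegment w t) - contToLp p (historySegment w 0) : DelayLp X p) := by
  have h0 : (0 : ℝ) ∈ Icc (-1 : ℝ) 0 := by norm_num
  rw [← map_sub, isWeakDeriv_contToLp_iff]
  intro σ
  have h1 := integral_contToLp (p := p) (historySegment w t - historySegment w 0) ⟨0, h0⟩ σ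
  change ∫ s in (0 : ℝ)..σ, _ = ∫ s in (0 : ℝ)..σ, _ at h1
  have h2 : ∫ s in (0 : ℝ)..σ, IccExtend (by norm_num : (-1 : ℝ) ≤ 0)
      (historySegment w t - historySegment w 0) s
      = ∫ s in (0 : ℝ)..σ, (w (s + t) - w s) := by
    refine intervalIntegral.integral_congr fun s hs => ?_
    have hs' : s ∈ Icc (-1 : ℝ) 0 := uIcc_subset_Icc h0 σ.2 hs
    change IccExtend _ _ s = _
    rw [IccExtend_of_mem _ _ hs', ContinuousMap.sub_apply, historySegment_apply,
      historySegment_apply, zero_add, add_comm]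
  have hi := fun a b => w.continuous.intervalIntegrable (μ := volume) a b
  have h3 : IntervalIntegrable (fun s => w (s + t)) volume 0 σ :=
    (w.continuous.comp (continuous_add_const t)).intervalIntegrable _ _
  rw [h1, h2, integralSegment_apply, integralSegment_apply,
    intervalIntegral.integral_sub h3 (hi _ _),
    intervalIntegral.integral_comp_add_right (fun s => w s)]
  simp only [add_zero, zero_add]
  rw [add_comm (σ : ℝ) t, ← intervalIntegral.integral_interval_sub_left (hi 0 (t + σ)) (hi 0 σ),
    ← intervalIntegral.integral_interval_sub_left (hi 0 (t + σ)) (hi 0 t)]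
  abel

end DelayLpLemmas

/-! ### Uniqueness for the transport equation -/

section Transport

variable {X : Type*} [NormedAddCommGroup X] [NormedSpace ℝ X] [CompleteSpace X]
  {p : ℝ≥0∞} [Fact (1 ≤ p)]

theorem hasDerivAt_primitive {E : Type*} [NormedAddCommGroup E] [NormedSpace ℝ E]
    [CompleteSpace E] {v : ℝ → E} (hv : Continuous v) (a t : ℝ) :
    HasDerivAt (fun t => ∫ s in a..t, v s) (v t) t :=
  intervalIntegral.integral_hasDerivAt_right (hv.intervalIntegrable _ _)
    hv.stronglyMeasurable.stronglyMeasurableAtFilter hv.continuousAt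

/-- If the primitive `Q(t) = ∫₀ᵗ d(s) ds` in `L^p([-1,0],X)` has weak derivative `d(t)` and trace
`0` at `0`, so that `∂ₜ Q = ∂_σ Q`, then `d = 0`. Integrating `Q(t)` from `0` to `c` gives a
function `R(t,c)` that is continuously differentiable with `∂ₜ R = ∂_c R`; it is constant along the
characteristics `t + c = const`, which leave the strip through a side where it vanishes. -/
theorem transport_unique {d : ℝ → DelayLp X p} (hd : Continuous d)
    (h : ∀ t, 0 ≤ t → ∃ F : C(Icc (-1 : ℝ) 0, X), ∫ s in (0 : ℝ)..t, d s = contToLp p F ∧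
      ∀ σ : Icc (-1 : ℝ) 0, F σ = ∫ s in (0 : ℝ)..σ, d t s) :
    ∀ t, 0 ≤ t → d t = 0 := by
  have h10 : (-1 : ℝ) ≤ 0 := by norm_num
  have h0 : (0 : ℝ) ∈ Icc (-1 : ℝ) 0 := by norm_num
  let P : ℝ → Icc (-1 : ℝ) 0 := projIcc (-1) 0 h10
  let a : ℝ → ℝ → X := fun t c => lpIntegral p ⟨0, h0⟩ (P c) (d t)
  have ha : ∀ t, ∀ c ∈ Icc (-1 : ℝ) 0, a t c = ∫ s in (0 : ℝ)..c, d t s := fun t c hc => by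
    simp only [a, P, projIcc_of_mem h10 hc, lpIntegral_apply]
  have hac : Continuous fun q : ℝ × ℝ => a q.1 q.2 := by
    have hc1 : ∀ f : DelayLp X p, Continuous fun c => lpIntegral p ⟨0, h0⟩ (P c) f := by
      intro f
      have h1 : ContinuousOn (fun c => ∫ s in (0 : ℝ)..c, f s) (Icc (-1) 0) := by
        have := intervalIntegral.continuousOn_primitive_interval' (a := 0) (b₁ := -1) (b₂ := 0)
          (f := f) (μ := volume) (f.intervalIntegrable (by norm_num) h0) (by simp)
        rwa [uIcc_of_le h10] at this
      exact h1.comp_continuous (continuous_subtype_val.comp continuous_projIcc) fun c => (P c).2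
    rw [continuous_iff_continuousAt]
    rintro ⟨t, c⟩
    have h2 : Tendsto (fun q : ℝ × ℝ => ‖d q.1 - d t‖ + ‖a t q.2 - a t c‖) (𝓝 (t, c)) (𝓝 0) := by
      have hcont : Continuous fun q : ℝ × ℝ => ‖d q.1 - d t‖ + ‖a t q.2 - a t c‖ :=
        ((hd.comp continuous_fst).sub continuous_const).norm.add
          (((hc1 (d t)).comp continuous_snd).sub continuous_const).norm
      simpa using hcont.tendsto (t, c)
    rw [ContinuousAt, tendsto_iff_norm_sub_tendsto_zero]
    refine squeeze_zero (fun _ => norm_nonneg _) (fun q => ?_) h2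
    have h3 : a q.1 q.2 - a t c = lpIntegral p ⟨0, h0⟩ (P q.2) (d q.1 - d t)
        + (a t q.2 - a t c) := by
      rw [map_sub]; simp only [a]; abel
    rw [h3]
    exact (norm_add_le _ _).trans (add_le_add_left (norm_lpIntegral_le _ _ _) _)
  have hat : ∀ c, Continuous fun t => a t c := fun c =>
    hac.comp (continuous_id.prodMk continuous_const)
  have hacc : ∀ t, Continuous fun c => a t c := fun t =>
    hac.comp (continuous_const.prodMk continuous_id)
  -- the transport equation turns this integral over time into the integral `∫₀ᶜ a t c' dc'`
  let R : ℝ → ℝ → X := fun t c => ∫ s in (0 : ℝ)..t, a s c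
  have hR : ∀ t, 0 ≤ t → ∀ c ∈ Icc (-1 : ℝ) 0, R t c = ∫ c' in (0 : ℝ)..c, a t c' := by
    intro t ht c hc
    obtain ⟨F, hF, hFd⟩ := h t ht
    have h1 : R t c = lpIntegral p ⟨0, h0⟩ (P c) (∫ s in (0 : ℝ)..t, d s) :=
      (lpIntegral p ⟨0, h0⟩ (P c)).intervalIntegral_comp_comm (hd.intervalIntegrable _ _)
    rw [h1, hF, lpIntegral_apply, integral_contToLp]
    simp only [P, projIcc_of_mem h10 hc]
    refine intervalIntegral.integral_congr fun s hs => ?_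
    have hs' : s ∈ Icc (-1 : ℝ) 0 := uIcc_subset_Icc h0 hc hs
    simp only [IccExtend_of_mem _ _ hs', hFd ⟨s, hs'⟩, ha t s hs']
  have hR1 : ∀ t c, HasDerivAt (fun t => R t c) (a t c) t := fun t c =>
    hasDerivAt_primitive (hat c) 0 t
  have hR2 : ∀ t c, 0 < t → c ∈ Ioo (-1 : ℝ) 0 → HasDerivAt (fun c => R t c) (a t c) c := by
    intro t c ht hc
    refine (hasDerivAt_primitive (hacc t) 0 c).congr_of_eventuallyEq ?_
    filter_upwards [isOpen_Ioo.mem_nhds hc] with c' hc'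
    exact hR t ht.le c' (Ioo_subset_Icc_self hc')
  have hstrict : ∀ t c, 0 < t → c ∈ Ioo (-1 : ℝ) 0 →
      HasFDerivAt (Function.uncurry R) ((ContinuousLinearMap.toSpanSingleton ℝ (a t c)).coprod
        (ContinuousLinearMap.toSpanSingleton ℝ (a t c))) (t, c) := by
    intro t c ht hc
    have hspan : Continuous fun q : ℝ × ℝ =>
        ContinuousLinearMap.toSpanSingleton ℝ (a q.1 q.2) :=
      (ContinuousLinearMap.toSpanSingletonCLE (𝕜 := ℝ) (E := X)).continuous.comp hac
    have hnhds : ∀ᶠ q : ℝ × ℝ in 𝓝 (t, c), q.1 ∈ Ioi 0 ∧ q.2 ∈ Ioo (-1 : ℝ) 0 :=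
      ((isOpen_Ioi.prod isOpen_Ioo).mem_nhds (x := (t, c)) ⟨ht, hc⟩)
    exact (hasStrictFDerivAt_uncurry_coprod (𝕜 := ℝ) (u := (t, c)) (f := R)
      (f₁ := fun t c => ContinuousLinearMap.toSpanSingleton ℝ (a t c))
      (f₂ := fun t c => ContinuousLinearMap.toSpanSingleton ℝ (a t c))
      (Eventually.of_forall fun q => (hR1 q.1 q.2).hasFDerivAt)
      (by filter_upwards [hnhds] with q hq using (hR2 q.1 q.2 hq.1 hq.2).hasFDerivAt)
      hspan.continuousAt hspan.continuousAt).hasFDerivAt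
  have hRc : Continuous (Function.uncurry R) := by
    have h1 : Continuous (Function.uncurry fun (q : ℝ × ℝ) (s : ℝ) => a s q.2) :=
      hac.comp (continuous_snd.prodMk (continuous_snd.comp continuous_fst))
    exact intervalIntegral.continuous_parametric_intervalIntegral_of_continuous h1 continuous_fst
  have hR0 : ∀ t c, 0 < t → c ∈ Ioo (-1 : ℝ) 0 → R t c = 0 := by
    intro t c ht hc
    have hm : 0 ≤ min t (-c) := le_min ht.le (by linarith [hc.2])
    have hconst := constant_of_has_deriv_right_zero (f := fun s => R (t - s) (c + s))
      (a := 0) (b := min t (-c))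
      (hRc.comp ((continuous_const.sub continuous_id).prodMk
        (continuous_const.add continuous_id))).continuousOn (by
        intro s hs
        have h1 : s < t := hs.2.trans_le (min_le_left _ _)
        have h2 : s < -c := hs.2.trans_le (min_le_right _ _)
        have h3 := (hstrict (t - s) (c + s) (by linarith)
          ⟨by linarith [hs.1, hc.1], by linarith⟩).comp_hasDerivAt s
          (((hasDerivAt_id s).const_sub t).prodMk ((hasDerivAt_id s).const_add c))
        have h4 : HasDerivAt (fun s => R (t - s) (c + s)) 0 s := by
          convert! h3 using 1
          simp
        exact h4.hasDerivWithinAt) _ (right_mem_Icc.2 hm)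
    simp only [sub_zero, add_zero] at hconst
    rw [← hconst]
    rcases le_total t (-c) with hle | hle
    · rw [min_eq_left hle, sub_self]
      exact intervalIntegral.integral_same
    · rw [min_eq_right hle, add_neg_cancel, hR _ (by linarith) 0 h0]
      exact intervalIntegral.integral_same
  have ha0 : ∀ t c, 0 < t → c ∈ Ioo (-1 : ℝ) 0 → a t c = 0 := by
    intro t c ht hc
    refine (hR1 t c).unique ((hasDerivAt_const t (0 : X)).congr_of_eventuallyEq ?_)
    filter_upwards [Ioi_mem_nhds ht] with s hs using hR0 s c hs hc
  have hQ : ∀ t, 0 < t → ∫ s in (0 : ℝ)..t, d s = 0 := by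
    intro t ht
    obtain ⟨F, hF, hFd⟩ := h t ht.le
    rw [hF]
    refine Lp.ext ?_
    have hne : ∀ᵐ s ∂delayMeasure, s ∈ Ioo (-1 : ℝ) 0 := by
      rw [delayMeasure, Measure.restrict_congr_set
        (Ioo_ae_eq_Icc (μ := volume) (a := (-1 : ℝ)) (b := 0)).symm]
      exact ae_restrict_mem measurableSet_Ioo
    filter_upwards [contToLp_ae (p := p) F, Lp.coeFn_zero X p delayMeasure, hne] with s h1 h2 hs
    have hs' := Ioo_subset_Icc_self hs
    rw [h1, h2, IccExtend_of_mem _ _ hs', hFd ⟨s, hs'⟩, ← ha t s hs', ha0 t s ht hs]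
    rfl
  have hd0 : ∀ t, 0 < t → d t = 0 := by
    intro t ht
    refine (hasDerivAt_primitive hd 0 t).unique
      ((hasDerivAt_const t (0 : DelayLp X p)).congr_of_eventuallyEq ?_)
    filter_upwards [Ioi_mem_nhds ht] with s hs using hQ s hs
  intro t ht
  have h1 : closure (Ioi (0 : ℝ)) ⊆ d ⁻¹' {0} :=
    closure_minimal (fun s hs => hd0 s hs) (isClosed_singleton.preimage hd)
  rw [closure_Ioi] at h1
  exact h1 ht

end Transport

/-! ### The operator matrix -/

section DelayOperator

variable {𝕜 : Type*} [RCLike 𝕜] {X : Type*} [NormedAddCommGroup X] [NormedSpace 𝕜 X]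
  [NormedSpace ℝ X] [IsScalarTower ℝ 𝕜 X] [CompleteSpace X] {p : ℝ≥0∞} [Fact (1 ≤ p)]
  {A : X →ₗ.[𝕜] X} {Φ : C(Icc (-1 : ℝ) 0, X) →L[𝕜] X}

/-- The graph of the operator matrix in terms of the continuous representative `F` of `f`, with the
weak derivative replaced by a primitive. -/
theorem mem_delayOp_graph_iff {x y : X} {f g : DelayLp X p} :
    ((x, f), (y, g)) ∈ (delayOp p A Φ).graph ↔ ∃ F : C(Icc (-1 : ℝ) 0, X), f = contToLp p F ∧
      F ⟨0, by norm_num⟩ = x ∧ (x, y - Φ F) ∈ A.graph ∧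
      ∀ σ : Icc (-1 : ℝ) 0, F σ = x + ∫ s in (0 : ℝ)..σ, g s := by
  rw [delayOp_graph]
  constructor
  · rintro ⟨hx, F, hF, hF0, hy, hg⟩
    dsimp only at hx hF hF0 hy hg
    rw [isContRep_iff_eq_contToLp] at hF
    rw [hF, isWeakDeriv_contToLp_iff, hF0] at hg
    refine ⟨F, hF, hF0, ?_, hg⟩
    rw [hy, add_sub_cancel_right]
    exact A.mem_graph ⟨x, hx⟩
  · rintro ⟨F, hF, hF0, hA, hg⟩
    obtain ⟨⟨x', hx'⟩, rfl, hA'⟩ := (LinearPMap.mem_graph_iff A).1 hA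
    refine ⟨hx', F, (isContRep_iff_eq_contToLp F f).2 hF, hF0, ?_, ?_⟩
    · exact (eq_sub_iff_add_eq.1 hA').symm
    · rw [← hF0] at hg
      have := (isWeakDeriv_contToLp_iff F g).2 hg
      rwa [← hF] at this

/-- On the graph, the `L^p` norms of `f` and `f'` control the supremum norm of `f`, so that `Φ` is
continuous along convergent sequences. -/
theorem delayOp_isClosed (hA : A.IsClosed) : (delayOp p A Φ).IsClosed := by
  refine isClosed_of_closure_subset ?_
  rintro ⟨⟨x, f⟩, ⟨y, g⟩⟩ hmem
  obtain ⟨z, hz, hzl⟩ := mem_closure_iff_seq_limit.1 hmem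
  have hz' : ∀ n, (((z n).1.1, (z n).1.2), ((z n).2.1, (z n).2.2)) ∈ (delayOp p A Φ).graph := hz
  simp only [mem_delayOp_graph_iff] at hz'
  choose F hF hF0 hFA hFd using hz'
  have hl1 : Tendsto (fun n => (z n).1.1) atTop (𝓝 x) :=
    (continuous_fst.comp continuous_fst).tendsto _ |>.comp hzl
  have hl2 : Tendsto (fun n => (z n).1.2) atTop (𝓝 f) :=
    (continuous_snd.comp continuous_fst).tendsto _ |>.comp hzl
  have hl3 : Tendsto (fun n => (z n).2.1) atTop (𝓝 y) :=
    (continuous_fst.comp continuous_snd).tendsto _ |>.comp hzl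
  have hl4 : Tendsto (fun n => (z n).2.2) atTop (𝓝 g) :=
    (continuous_snd.comp continuous_snd).tendsto _ |>.comp hzl
  have h0 : (0 : ℝ) ∈ Icc (-1 : ℝ) 0 := by norm_num
  have hbound : ∀ m n, ‖F m - F n‖ ≤ ‖(z m).1.2 - (z n).1.2‖ + ‖(z m).2.2 - (z n).2.2‖ := by
    intro m n
    have h1 := norm_contRep_le (p := p) (F := F m - F n) (g := (z m).2.2 - (z n).2.2) (by
      intro σ
      have h2 := (lpIntegral p ⟨0, h0⟩ σ).map_sub (z m).2.2 (z n).2.2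
      simp only [lpIntegral_apply] at h2
      rw [h2, ContinuousMap.sub_apply, ContinuousMap.sub_apply, hFd m σ, hFd n σ, hF0, hF0]
      abel)
    rwa [map_sub, ← hF, ← hF] at h1
  have hcauchy : CauchySeq F := by
    rw [Metric.cauchySeq_iff]
    intro ε hε
    obtain ⟨N1, hN1⟩ := Metric.cauchySeq_iff.1 hl2.cauchySeq (ε / 2) (half_pos hε)
    obtain ⟨N2, hN2⟩ := Metric.cauchySeq_iff.1 hl4.cauchySeq (ε / 2) (half_pos hε)
    refine ⟨max N1 N2, fun m hm n hn => ?_⟩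
    have h1 := hN1 m ((le_max_left _ _).trans hm) n ((le_max_left _ _).trans hn)
    have h2 := hN2 m ((le_max_right _ _).trans hm) n ((le_max_right _ _).trans hn)
    rw [dist_eq_norm] at h1 h2 ⊢
    linarith [hbound m n]
  obtain ⟨G, hG⟩ := cauchySeq_tendsto_of_complete hcauchy
  have heval : ∀ σ, Tendsto (fun n => F n σ) atTop (𝓝 (G σ)) := fun σ =>
    ((ContinuousMap.evalCLM ℝ σ).continuous.tendsto G).comp hG
  refine mem_delayOp_graph_iff.2 ⟨G, ?_, ?_, ?_, fun σ => ?_⟩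
  · refine tendsto_nhds_unique hl2 ?_
    simp only [hF]
    exact ((contToLp p).continuous.tendsto G).comp hG
  · refine tendsto_nhds_unique (heval _) ?_
    simpa only [hF0] using hl1
  · exact hA.mem_of_tendsto (hl1.prodMk_nhds (hl3.sub ((Φ.continuous.tendsto G).comp hG)))
      (Eventually.of_forall hFA)
  · refine tendsto_nhds_unique (heval σ) ?_
    simp only [hFd]
    exact hl1.add (((lpIntegral p ⟨0, h0⟩ σ).continuous.tendsto g).comp hl4)

theorem delayOp_dense_domain (hp : p ≠ ⊤) (hA : Dense (A.domain : Set X)) :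
    Dense ((delayOp p A Φ).domain : Set (X × DelayLp X p)) := by
  rintro ⟨x, f⟩
  rw [Metric.mem_closure_iff]
  intro ε hε
  obtain ⟨x', hx', hxx'⟩ := Metric.mem_closure_iff.1 (hA x) ε hε
  obtain ⟨F, hF0, hF⟩ := exists_continuous_near hp f x' (half_pos hε)
  -- averages over short intervals of the extension of `F` by its value at `0` are in `W^{1,p}`
  let w : C(ℝ, X) := ⟨IccExtend (by norm_num : (-1 : ℝ) ≤ 0) F, continuous_iccExtend_delay F⟩
  have hw : historySegment w 0 = F := by
    ext σ
    rw [historySegment_apply, zero_add]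
    exact IccExtend_of_mem _ _ σ.2
  have hw0 : ∀ s, 0 ≤ s → w s = x' := fun s hs => by
    rw [← hF0]; exact IccExtend_of_right_le _ _ hs
  have hlim : Tendsto (fun h : ℝ => h⁻¹ • integralSegment w h) (𝓝[>] 0) (𝓝 F) := by
    have := tendsto_average (continuous_historySegment w) 0
    simp only [zero_add, hw] at this
    exact this
  obtain ⟨h, hlt, hh⟩ := ((Metric.tendsto_nhds.1 hlim (ε / 2) (half_pos hε)).and
    self_mem_nhdsWithin).exists
  have hh : 0 < h := hh
  refine ⟨(x', contToLp p (h⁻¹ • integralSegment w h)), ?_, ?_⟩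
  · have hwd := (isWeakDeriv_contToLp_iff (p := p) _ _).1 (isWeakDeriv_integralSegment w h)
    have hJ0 : integralSegment w h ⟨0, by norm_num⟩ = h • x' := by
      rw [integralSegment_apply]
      simp only [add_zero]
      rw [intervalIntegral.integral_congr (g := fun _ => x') fun s hs => hw0 s ?_]
      · simp
      · rw [uIcc_of_le hh.le] at hs; exact hs.1
    obtain ⟨y, hy⟩ := LinearPMap.mem_domain_iff.1 hx'
    have hJ0' : (h⁻¹ • integralSegment w h) ⟨0, by norm_num⟩ = x' := by
      rw [ContinuousMap.smul_apply, hJ0, smul_smul, inv_mul_cancel₀ hh.ne', one_smul]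
    refine LinearPMap.mem_domain_of_mem_graph (y := (y + Φ (h⁻¹ • integralSegment w h),
      h⁻¹ • (contToLp p (historySegment w h) - contToLp p (historySegment w 0))))
      (mem_delayOp_graph_iff.2 ⟨_, rfl, hJ0', by rwa [add_sub_cancel_right], fun σ => ?_⟩)
    have h2 := (lpIntegral p ⟨0, by norm_num⟩ σ).map_smul h⁻¹
      (contToLp p (historySegment w h) - contToLp p (historySegment w 0))
    simp only [lpIntegral_apply] at h2
    rw [h2, ContinuousMap.smul_apply, hwd σ, hJ0, smul_add, smul_smul, inv_mul_cancel₀ hh.ne',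
      one_smul]
  · rw [Prod.dist_eq]
    refine max_lt hxx' ?_
    rw [dist_comm, dist_eq_norm]
    calc ‖contToLp p (h⁻¹ • integralSegment w h) - f‖
        = ‖contToLp p (h⁻¹ • integralSegment w h - F) + (contToLp p F - f)‖ := by
          rw [map_sub]; abel_nf
      _ ≤ ‖contToLp p (h⁻¹ • integralSegment w h - F)‖ + ‖contToLp p F - f‖ := norm_add_le _ _
      _ < ε / 2 + ε / 2 := by
          refine add_lt_add ((norm_contToLp_le _).trans_lt ?_) hF
          rwa [← dist_eq_norm]
      _ = ε := add_halves ε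

end DelayOperator

/-! ### Gronwall estimate and Volterra equation with delay -/

section Volterra

variable {𝕜 : Type*} [RCLike 𝕜] {X : Type*} [NormedAddCommGroup X] [NormedSpace 𝕜 X]
  {Φ : C(Icc (-1 : ℝ) 0, X) →L[𝕜] X} {κ : ℝ}

theorem continuous_delay (Φ : C(Icc (-1 : ℝ) 0, X) →L[𝕜] X) (w : C(ℝ, X)) :
    Continuous fun s => Φ (historySegment w s) :=
  Φ.continuous.comp (continuous_historySegment w)

theorem HasDelayBound.integral_le (hΦ : HasDelayBound Φ κ) (w : C(ℝ, X)) {t : ℝ} (ht : 0 ≤ t) :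
    ∫ s in (0 : ℝ)..t, ‖Φ (historySegment w s)‖ ≤ κ * ∫ s in (-1 : ℝ)..t, ‖w s‖ :=
  hΦ w t _ ht fun σ hσ => intervalIntegral.integral_mono_interval hσ.1 (by linarith)
    (by linarith [hσ.2]) (Eventually.of_forall fun _ => norm_nonneg _)
    (w.continuous.norm.intervalIntegrable _ _)

/-- Gronwall's inequality for the delay operator: the history enters through its `L¹` norm. -/
theorem HasDelayBound.gronwall (hΦ : HasDelayBound Φ κ) (hκ : 0 ≤ κ) (w : C(ℝ, X))
    {M α b : ℝ} (hM : 0 ≤ M)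
    (h : ∀ t ∈ Icc 0 b, ‖w t‖ ≤ α + M * ∫ s in (0 : ℝ)..t, ‖Φ (historySegment w s)‖) :
    ∀ t ∈ Icc 0 b,
      ‖w t‖ ≤ (α + M * κ * ∫ s in (-1 : ℝ)..0, ‖w s‖) * Real.exp (M * κ * b) := by
  intro t ht
  set a : ℝ := α + M * κ * ∫ s in (-1 : ℝ)..0, ‖w s‖ with ha
  have hi := fun a b => w.continuous.norm.intervalIntegrable (μ := volume) a b
  let Z : ℝ → ℝ := fun t => a + M * κ * ∫ s in (0 : ℝ)..t, ‖w s‖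
  have hZ : ∀ t ∈ Icc 0 b, ‖w t‖ ≤ Z t := by
    intro t ht
    refine (h t ht).trans ?_
    have h1 := mul_le_mul_of_nonneg_left (hΦ.integral_le w ht.1) hM
    rw [← intervalIntegral.integral_add_adjacent_intervals (hi (-1) 0) (hi 0 t)] at h1
    simp only [Z, ha]
    linarith
  have hZd : ∀ t, HasDerivAt Z (M * κ * ‖w t‖) t := fun t =>
    ((hasDerivAt_primitive w.continuous.norm 0 t).const_mul (M * κ)).const_add a
  have hMκ : 0 ≤ M * κ := mul_nonneg hM hκ
  have h1 := norm_le_gronwallBound_of_norm_deriv_right_le (f := Z)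
    (f' := fun t => M * κ * ‖w t‖) (δ := a) (K := M * κ) (ε := 0) (a := 0) (b := b)
    (fun t _ => (hZd t).continuousAt.continuousWithinAt)
    (fun t _ => (hZd t).hasDerivWithinAt)
    (by
      have h2 := (norm_nonneg _).trans (hZ 0 ⟨le_rfl, ht.1.trans ht.2⟩)
      rw [Real.norm_of_nonneg h2]
      simp [Z])
    (fun t ht => by
      have h2 := hZ t (Ico_subset_Icc_self ht)
      rw [add_zero, Real.norm_of_nonneg ((norm_nonneg _).trans h2),
        Real.norm_of_nonneg (mul_nonneg hMκ (norm_nonneg _))]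
      exact mul_le_mul_of_nonneg_left h2 hMκ) t ht
  rw [gronwallBound_ε0, sub_zero] at h1
  have ha0 : 0 ≤ a := by
    have := (norm_nonneg _).trans (hZ 0 ⟨le_rfl, ht.1.trans ht.2⟩)
    simpa [Z] using this
  refine ((hZ t ht).trans ((le_abs_self _).trans h1)).trans ?_
  exact mul_le_mul_of_nonneg_left
    (Real.exp_le_exp.2 (mul_le_mul_of_nonneg_left ht.2 hMκ)) ha0

theorem exists_bound_of_continuous_uncurry [CompleteSpace X] {L : ℝ → X →L[𝕜] X}
    (hL : Continuous fun q : ℝ × X => L q.1 q.2) (b : ℝ) :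
    ∃ M : ℝ, 0 ≤ M ∧ ∀ t ∈ Icc 0 b, ‖L t‖ ≤ M := by
  obtain ⟨C, hC⟩ := banach_steinhaus (g := fun t : Icc (0 : ℝ) b => L t) (fun x => by
    obtain ⟨C, hC⟩ := isCompact_Icc.exists_bound_of_continuousOn (s := Icc 0 b)
      (hL.comp (continuous_id.prodMk continuous_const) :
        Continuous fun t => L t x).continuousOn
    exact ⟨C, fun t => hC t t.2⟩)
  exact ⟨max C 0, le_max_right _ _, fun t ht => (hC ⟨t, ht⟩).trans (le_max_left _ _)⟩

theorem continuous_volterra_integrand {L : ℝ → X →L[𝕜] X}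
    (hL : Continuous fun q : ℝ × X => L q.1 q.2) (v : C(ℝ, X)) (t : ℝ) :
    Continuous fun s => L (t - s) (Φ (historySegment v s)) :=
  hL.comp ((continuous_const.sub continuous_id).prodMk (continuous_delay Φ v))

variable [NormedSpace ℝ X]

/-- The Volterra operator `v ↦ ∫₀ᵗ L(t - s) Φ v_s ds`, extended by `0` to negative times. -/
noncomputable def volterraOp (Φ : C(Icc (-1 : ℝ) 0, X) →L[𝕜] X) {L : ℝ → X →L[𝕜] X}
    (hL : Continuous fun q : ℝ × X => L q.1 q.2) (v : C(ℝ, X)) : C(ℝ, X) where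
  toFun t := ∫ s in (0 : ℝ)..(max t 0), L (max t 0 - s) (Φ (historySegment v s))
  continuous_toFun := by
    have h1 : Continuous (Function.uncurry fun t s : ℝ =>
        L (max t 0 - s) (Φ (historySegment v s))) :=
      hL.comp ((((continuous_fst.max continuous_const).sub continuous_snd)).prodMk
        ((continuous_delay Φ v).comp continuous_snd))
    exact intervalIntegral.continuous_parametric_intervalIntegral_of_continuous h1
      (continuous_id.max continuous_const)

variable {L : ℝ → X →L[𝕜] X}

variable (hL : Continuous fun q : ℝ × X => L q.1 q.2)

theorem volterraOp_apply (v : C(ℝ, X)) (t : ℝ) : volterraOp Φ hL v t =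
    ∫ s in (0 : ℝ)..(max t 0), L (max t 0 - s) (Φ (historySegment v s)) := rfl

theorem volterraOp_add (u v : C(ℝ, X)) :
    volterraOp Φ hL (u + v) = volterraOp Φ hL u + volterraOp Φ hL v := by
  ext t
  rw [ContinuousMap.add_apply, volterraOp_apply, volterraOp_apply, volterraOp_apply,
    ← intervalIntegral.integral_add
    ((continuous_volterra_integrand hL u _).intervalIntegrable _ _)
    ((continuous_volterra_integrand hL v _).intervalIntegrable _ _)]
  refine intervalIntegral.integral_congr fun s _ => ?_
  have : historySegment (u + v) s = historySegment u s + historySegment v s := rfl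
  simp only [this, map_add]

theorem volterraOp_sub (u v : C(ℝ, X)) :
    volterraOp Φ hL (u - v) = volterraOp Φ hL u - volterraOp Φ hL v := by
  rw [eq_sub_iff_add_eq, ← volterraOp_add, sub_add_cancel]

theorem norm_volterraOp_le_integral {M b : ℝ} (hLM : ∀ t ∈ Icc 0 b, ‖L t‖ ≤ M)
    (v : C(ℝ, X)) {t : ℝ} (ht : t ∈ Icc 0 b) :
    ‖volterraOp Φ hL v t‖ ≤ M * ∫ s in (0 : ℝ)..t, ‖Φ (historySegment v s)‖ := by
  rw [volterraOp_apply, max_eq_left ht.1]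
  refine (intervalIntegral.norm_integral_le_integral_norm ht.1).trans ?_
  rw [← intervalIntegral.integral_const_mul]
  refine intervalIntegral.integral_mono_on ht.1
    ((continuous_volterra_integrand hL v _).norm.intervalIntegrable _ _)
    ((continuous_const.mul (continuous_delay Φ v).norm).intervalIntegrable _ _) fun s hs => ?_
  exact (L (t - s)).le_of_opNorm_le
    (hLM _ ⟨sub_nonneg.2 hs.2, (sub_le_self _ hs.1).trans ht.2⟩) _

theorem norm_volterraOp_le (hΦ : HasDelayBound Φ κ) {M b : ℝ} (hM : 0 ≤ M)
    (hLM : ∀ t ∈ Icc 0 b, ‖L t‖ ≤ M) (v : C(ℝ, X)) {t : ℝ} (ht : t ∈ Icc 0 b) :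
    ‖volterraOp Φ hL v t‖ ≤ M * (κ * ∫ s in (-1 : ℝ)..t, ‖v s‖) :=
  (norm_volterraOp_le_integral hL hLM v ht).trans
    (mul_le_mul_of_nonneg_left (hΦ.integral_le v ht.1) hM)

theorem volterraOp_of_nonpos (v : C(ℝ, X)) {t : ℝ} (ht : t ≤ 0) : volterraOp Φ hL v t = 0 := by
  rw [volterraOp_apply, max_eq_right ht, intervalIntegral.integral_same]

theorem norm_iterate_volterraOp_le (hΦ : HasDelayBound Φ κ) (hκ : 0 ≤ κ) {M b C : ℝ}
    (hM : 0 ≤ M) (hLM : ∀ t ∈ Icc 0 b, ‖L t‖ ≤ M) (a : C(ℝ, X)) (hC : 0 ≤ C)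
    (ha : ∀ t ∈ Icc (-1) b, ‖a t‖ ≤ C) (n : ℕ) :
    ∀ t ∈ Icc (-1) b, ‖(volterraOp Φ hL)^[n] a t‖ ≤ C * ((M * κ * (t + 1)) ^ n / n.factorial) := by
  induction n with
  | zero => simpa using ha
  | succ n ih =>
    intro t ht
    rw [Function.iterate_succ_apply']
    have ht1 : 0 ≤ t + 1 := by linarith [ht.1]
    rcases le_total t 0 with h0 | h0
    · rw [volterraOp_of_nonpos hL _ h0, norm_zero]
      positivity
    · refine (norm_volterraOp_le hL hΦ hM hLM _ ⟨h0, ht.2⟩).trans ?_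
      have h1 : ∫ s in (-1 : ℝ)..t, ‖(volterraOp Φ hL)^[n] a s‖
          ≤ ∫ s in (-1 : ℝ)..t, C * ((M * κ) ^ n / n.factorial) * (s + 1) ^ n := by
        refine intervalIntegral.integral_mono_on ht.1
          ((ContinuousMap.continuous _).norm.intervalIntegrable _ _)
          (Continuous.intervalIntegrable (by fun_prop) _ _) fun s hs => ?_
        refine (ih s ⟨hs.1, hs.2.trans ht.2⟩).trans (le_of_eq ?_)
        rw [mul_pow]; ring
      have h2 : ∫ s in (-1 : ℝ)..t, C * ((M * κ) ^ n / n.factorial) * (s + 1) ^ n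
          = C * ((M * κ) ^ n / n.factorial) * ((t + 1) ^ (n + 1) / (n + 1)) := by
        rw [intervalIntegral.integral_const_mul,
          intervalIntegral.integral_comp_add_right (fun s => s ^ n) 1, integral_pow]
        simp
      rw [h2] at h1
      calc M * (κ * ∫ s in (-1 : ℝ)..t, ‖(volterraOp Φ hL)^[n] a s‖)
          ≤ M * (κ * (C * ((M * κ) ^ n / n.factorial) * ((t + 1) ^ (n + 1) / (n + 1)))) := by
            gcongr
        _ = C * ((M * κ * (t + 1)) ^ (n + 1) / (n + 1).factorial) := by
            rw [Nat.factorial_succ]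
            push_cast
            rw [mul_pow (M * κ), pow_succ (M * κ) n]
            generalize (t + 1) ^ (n + 1) = q
            generalize (M * κ) ^ n = r
            field_simp

/-- The delay Volterra equation `v(t) = a(t) + ∫₀ᵗ L(t - s) Φ v_s ds`, with `v = a` for `t ≤ 0`,
is solved by the Neumann series, which converges locally uniformly. -/
theorem exists_volterra_solution [CompleteSpace X] (hΦ : HasDelayBound Φ κ) (hκ : 0 ≤ κ)
    (a : C(ℝ, X)) : ∃ v : C(ℝ, X), v = a + volterraOp Φ hL v := by
  let F : ℕ → C(ℝ, X) := fun n => (volterraOp Φ hL)^[n] a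
  have hF : ∀ n, F (n + 1) = volterraOp Φ hL (F n) := fun n => Function.iterate_succ_apply' _ _ _
  have hsum : Summable F := by
    refine ContinuousMap.summable_of_locally_summable_norm fun K => ?_
    obtain ⟨B, hB⟩ := K.isCompact.isBounded.subset_closedBall (0 : ℝ)
    rw [Real.closedBall_eq_Icc, zero_sub, zero_add] at hB
    obtain ⟨M, hM, hLM⟩ := exists_bound_of_continuous_uncurry hL B
    obtain ⟨C, hC⟩ := isCompact_Icc.exists_bound_of_continuousOn
      (s := Icc (min (-1) (-B)) B) a.continuous.continuousOn
    have hC' : ∀ t ∈ Icc (min (-1) (-B)) B, ‖a t‖ ≤ max C 0 := fun t ht =>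
      (hC t ht).trans (le_max_left _ _)
    have hbd := norm_iterate_volterraOp_le hL hΦ hκ hM hLM a (le_max_right C 0)
      (fun t ht => hC' t ⟨(min_le_left _ _).trans ht.1, ht.2⟩)
    refine Summable.of_norm_bounded
      (g := fun n => max C 0 * ((M * κ * (|B| + 1)) ^ n / n.factorial))
      ((Real.summable_pow_div_factorial _).mul_left _) fun n => ?_
    rw [norm_norm, ContinuousMap.norm_le _ (by positivity)]
    rintro ⟨t, ht⟩
    have htB := hB ht
    change ‖F n t‖ ≤ _
    rcases le_total (-1) t with h1 | h1
    · have ht1 : 0 ≤ t + 1 := by linarith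
      refine (hbd n t ⟨h1, htB.2⟩).trans ?_
      gcongr
      exact htB.2.trans (le_abs_self _)
    · cases n with
      | zero =>
        rw [pow_zero, Nat.factorial_zero, Nat.cast_one, div_one, mul_one]
        exact hC' t ⟨(min_le_right _ _).trans htB.1, htB.2⟩
      | succ n =>
        rw [hF, volterraOp_of_nonpos hL _ (by linarith), norm_zero]
        positivity
  refine ⟨∑' n, F n, ?_⟩
  set v := ∑' n, F n with hv
  let V : ℕ → C(ℝ, X) := fun N => ∑ n ∈ Finset.range N, F n
  have hV : Tendsto V atTop (𝓝 v) := hsum.hasSum.tendsto_sum_nat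
  have hVs : ∀ N, V (N + 1) = a + volterraOp Φ hL (V N) := by
    intro N
    induction N with
    | zero =>
      have h0 : volterraOp Φ hL 0 = 0 := by
        have := volterraOp_sub (Φ := Φ) hL 0 0
        rwa [sub_self, sub_self] at this
      simp [V, F, h0]
    | succ N ih =>
      have h1 : V (N + 1 + 1) = V (N + 1) + F (N + 1) := Finset.sum_range_succ _ _
      have h2 : V (N + 1) = V N + F N := Finset.sum_range_succ _ _
      rw [h1, hF, h2, volterraOp_add, ← add_assoc, ← ih, h2]
  have hunif := ContinuousMap.tendsto_iff_forall_isCompact_tendstoUniformlyOn.1 hV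
  ext t
  have hpt : ∀ t, Tendsto (fun N => V N t) atTop (𝓝 (v t)) := fun t =>
    (hunif {t} isCompact_singleton).tendsto_at rfl
  have h1 : Tendsto (fun N => V (N + 1) t) atTop (𝓝 (v t)) :=
    (hpt t).comp (tendsto_add_atTop_nat 1)
  refine tendsto_nhds_unique h1 ?_
  simp only [hVs, ContinuousMap.add_apply]
  refine tendsto_const_nhds.add ?_
  rcases le_total t 0 with ht | ht
  · simp only [volterraOp_of_nonpos hL _ ht]
    exact tendsto_const_nhds
  obtain ⟨M, hM, hLM⟩ := exists_bound_of_continuous_uncurry hL t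
  rw [Metric.tendsto_atTop]
  intro ε hε
  have hδ : 0 < ε / (M * κ * (t + 1) + 1) := by positivity
  obtain ⟨N0, hN0⟩ := eventually_atTop.1
    (Metric.tendstoUniformlyOn_iff.1 (hunif (Icc (-1) t) isCompact_Icc) _ hδ)
  refine ⟨N0, fun N hN => ?_⟩
  rw [dist_eq_norm, ← ContinuousMap.sub_apply, ← volterraOp_sub]
  refine (norm_volterraOp_le hL hΦ hM hLM _ ⟨ht, le_rfl⟩).trans_lt ?_
  have h2 : ∫ s in (-1 : ℝ)..t, ‖(V N - v) s‖
      ≤ ∫ s in (-1 : ℝ)..t, ε / (M * κ * (t + 1) + 1) := by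
    refine intervalIntegral.integral_mono_on (by linarith)
      ((V N - v).continuous.norm.intervalIntegrable _ _) intervalIntegrable_const fun s hs => ?_
    have := hN0 N hN s hs
    rw [dist_eq_norm, norm_sub_rev] at this
    exact this.le
  rw [intervalIntegral.integral_const, sub_neg_eq_add, smul_eq_mul] at h2
  calc M * (κ * ∫ s in (-1 : ℝ)..t, ‖(V N - v) s‖)
      ≤ M * (κ * ((t + 1) * (ε / (M * κ * (t + 1) + 1)))) := by gcongr
    _ = ε * ((M * κ * (t + 1)) / (M * κ * (t + 1) + 1)) := by ring
    _ < ε * 1 := by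
        refine mul_lt_mul_of_pos_left ?_ hε
        rw [div_lt_one (by positivity)]
        linarith
    _ = ε := mul_one ε

end Volterra

/-! ### Classical solutions of the delay equation -/

section Pairs

variable {𝕜 : Type*} [RCLike 𝕜] {X : Type*} [NormedAddCommGroup X] [NormedSpace 𝕜 X]
  [NormedSpace ℝ X] [IsScalarTower ℝ 𝕜 X] [CompleteSpace X] {p : ℝ≥0∞} [Fact (1 ≤ p)]
  {A : X →ₗ.[𝕜] X} {Φ : C(Icc (-1 : ℝ) 0, X) →L[𝕜] X}

/-- A classical solution `w` of the delay equation together with its derivative `v`. Both are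
continuous functions on `ℝ`, of which only the restrictions to `[-1,∞)` and `[0,∞)` matter. -/
structure IsDelayPair (p : ℝ≥0∞) [Fact (1 ≤ p)] (A : X →ₗ.[𝕜] X)
    (Φ : C(Icc (-1 : ℝ) 0, X) →L[𝕜] X) (x : X) (f : DelayLp X p) (w v : C(ℝ, X)) : Prop where
  history : f = contToLp p (historySegment w 0)
  eq_integral : ∀ t, 0 ≤ t → w t = x + ∫ s in (0 : ℝ)..t, v s
  mem_graph : ∀ t, 0 ≤ t → (w t, v t - Φ (historySegment w t)) ∈ A.graph

theorem historySegment_sub (w₁ w₂ : C(ℝ, X)) (t : ℝ) :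
    historySegment (w₁ - w₂) t = historySegment w₁ t - historySegment w₂ t := rfl

theorem historySegment_smul (c : ℝ) (w : C(ℝ, X)) (t : ℝ) :
    historySegment (c • w) t = c • historySegment w t := rfl

namespace IsDelayPair

variable {x x₁ x₂ : X} {f f₁ f₂ : DelayLp X p} {w v w₁ v₁ w₂ v₂ : C(ℝ, X)}

theorem map_zero (h : IsDelayPair p A Φ x f w v) : w 0 = x := by
  simpa using h.eq_integral 0 le_rfl

theorem sub (h₁ : IsDelayPair p A Φ x₁ f₁ w₁ v₁) (h₂ : IsDelayPair p A Φ x₂ f₂ w₂ v₂) :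
    IsDelayPair p A Φ (x₁ - x₂) (f₁ - f₂) (w₁ - w₂) (v₁ - v₂) where
  history := by rw [historySegment_sub, map_sub, ← h₁.history, ← h₂.history]
  eq_integral t ht := by
    simp only [ContinuousMap.sub_apply]
    rw [intervalIntegral.integral_sub (v₁.continuous.intervalIntegrable _ _)
      (v₂.continuous.intervalIntegrable _ _), h₁.eq_integral t ht, h₂.eq_integral t ht]
    abel
  mem_graph t ht := by
    have := A.graph.sub_mem (h₁.mem_graph t ht) (h₂.mem_graph t ht)
    rw [Prod.mk_sub_mk, sub_sub_sub_comm, ← map_sub] at this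
    exact this

theorem smul (c : ℝ) (h : IsDelayPair p A Φ x f w v) :
    IsDelayPair p A Φ (c • x) (c • f) (c • w) (c • v) where
  history := by rw [historySegment_smul, map_smul, ← h.history]
  eq_integral t ht := by
    simp only [ContinuousMap.smul_apply]
    rw [intervalIntegral.integral_smul, h.eq_integral t ht, smul_add]
  mem_graph t ht := by
    have := (A.graph.restrictScalars ℝ).smul_mem c (h.mem_graph t ht)
    rw [Prod.smul_mk, smul_sub, ← Φ.map_smul_of_tower] at this
    exact this

theorem mem_delayDomain (h : IsDelayPair p A Φ x f w v) {g : DelayLp X p} (hg : IsWeakDeriv f g) :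
    (x, f) ∈ delayDomain p A := by
  refine ⟨?_, ⟨g, hg⟩, historySegment w 0, (isContRep_iff_eq_contToLp _ _).2 h.history, ?_⟩
  · have := LinearPMap.mem_domain_of_mem_graph (h.mem_graph 0 le_rfl)
    rwa [h.map_zero] at this
  · rw [historySegment_apply, add_zero, h.map_zero]

end IsDelayPair

/-- Up to values on `(-∞,-1)` and `(-∞,0)`, a classical solution is given by a pair of continuous
functions on `ℝ`. -/
theorem IsDelaySolution.exists_pair {x : X} {f : DelayLp X p} {u : ℝ → X}
    (hu : IsDelaySolution p A Φ x f u) :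
    ∃ w v : C(ℝ, X), IsDelayPair p A Φ x f w v ∧ ∀ t, -1 ≤ t → w t = u t := by
  obtain ⟨u', hu'c, hu'⟩ := hu.equation
  let w : C(ℝ, X) := ⟨fun t => u (max t (-1)), hu.continuousOn.comp_continuous
    (continuous_id.max continuous_const) fun s => mem_Ici.2 (le_max_right _ _)⟩
  let v : C(ℝ, X) := ⟨fun t => u' (max t 0), hu'c.comp_continuous
    (continuous_id.max continuous_const) fun s => mem_Ici.2 (le_max_right _ _)⟩
  have hwu : ∀ t, -1 ≤ t → w t = u t := fun t ht => by
    change u (max t (-1)) = u t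
    rw [max_eq_left ht]
  have hvu : ∀ t, 0 ≤ t → v t = u' t := fun t ht => by
    change u' (max t 0) = u' t
    rw [max_eq_left ht]
  refine ⟨w, v, ⟨?_, fun t ht => ?_, fun t ht => ?_⟩, hwu⟩
  · refine (isContRep_iff_eq_contToLp _ _).1 ?_
    have h1 := (ae_restrict_iff' measurableSet_Icc).1 hu.initial_history
    filter_upwards [h1] with s hs hs'
    rw [← hs hs', historySegment_apply, zero_add, hwu s hs'.1]
  · have h1 := intervalIntegral.integral_eq_sub_of_hasDeriv_right_of_le (f := u) (f' := v) ht
      (hu.continuousOn.mono fun s hs => by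
        exact mem_Ici.2 (le_trans (by norm_num) hs.1))
      (fun s hs => by
        rw [hvu s hs.1.le]
        exact (hu' s hs.1.le).1.mono (Ioi_subset_Ici hs.1.le))
      (v.continuous.intervalIntegrable _ _)
    rw [h1, hu.initial_value, hwu t (by linarith)]
    abel
  · obtain ⟨-, hA, U, hU, he⟩ := hu' t ht
    have hUw : U = historySegment w t := by
      ext σ
      rw [hU, historySegment_apply, hwu _ (by linarith [σ.2.1])]
    rw [hwu t (by linarith), hvu t ht, he, ← hUw, add_sub_cancel_right]
    exact A.mem_graph ⟨u t, hA⟩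

/-- The segments of a classical solution lie in `W^{1,p}`: the derivative of the solution is `g` on
`[-1,0]` and `v` on `(0,∞)`. -/
theorem IsDelayPair.memW1p {x : X} {f g : DelayLp X p} {w v : C(ℝ, X)}
    (h : IsDelayPair p A Φ x f w v) (hg : IsWeakDeriv f g) {t : ℝ} (ht : 0 ≤ t) :
    MemW1p p (fun σ => w (t + σ)) := by
  have hcont : ∀ z : C(ℝ, X), MemLp (fun σ => z (t + σ)) p delayMeasure := fun z => by
    refine (memLp_congr_ae ?_).1 (memLp_iccExtend p (historySegment z t))
    filter_upwards [ae_restrict_mem measurableSet_Icc] with s hs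
    rw [IccExtend_of_mem _ _ hs, historySegment_apply]
  let G : ℝ → X := (Icc (-1 : ℝ) 0).indicator g + (Ioi (0 : ℝ)).indicator v
  have hg1 : MemLp ((Icc (-1 : ℝ) 0).indicator g) p volume :=
    (memLp_indicator_iff_restrict measurableSet_Icc).2 (Lp.memLp g)
  have hG : MemLp (fun σ => G (t + σ)) p delayMeasure := by
    refine MemLp.add ((hg1.comp_measurePreserving (measurePreserving_add_left volume t)).restrict _)
      ?_
    exact (hcont v).indicator (s := (fun σ => t + σ) ⁻¹' Ioi 0)
      ((measurable_const_add t) measurableSet_Ioi)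
  have hGi : ∀ a b, IntervalIntegrable G volume a b := fun a b => by
    refine IntervalIntegrable.add ?_ ?_
    · refine Integrable.intervalIntegrable ?_
      exact (integrable_indicator_iff measurableSet_Icc).2 g.integrableOn
    · rw [intervalIntegrable_iff]
      exact (intervalIntegrable_iff.1 (v.continuous.intervalIntegrable a b)).indicator
        measurableSet_Ioi
  have hw : ∀ b, -1 ≤ b → w b = x + ∫ s in (0 : ℝ)..b, G s := by
    intro b hb
    rcases le_total 0 b with h0 | h0
    · rw [h.eq_integral b h0]
      congr 1
      refine intervalIntegral.integral_congr_ae (Eventually.of_forall fun s hs => ?_)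
      rw [uIoc_of_le h0] at hs
      have h1 : s ∉ Icc (-1 : ℝ) 0 := fun h => absurd h.2 (not_le.2 hs.1)
      have h2 : s ∈ Ioi (0 : ℝ) := hs.1
      simp [G, h1, indicator_of_mem h2]
    · have hg' := hg
      rw [h.history, isWeakDeriv_contToLp_iff] at hg'
      have h3 := hg' ⟨b, hb, h0⟩
      rw [historySegment_apply, historySegment_apply, zero_add, zero_add, h.map_zero] at h3
      rw [h3]
      congr 1
      refine intervalIntegral.integral_congr_ae (Eventually.of_forall fun s hs => ?_)
      rw [uIoc_of_ge h0] at hs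
      have h1 : s ∈ Icc (-1 : ℝ) 0 := ⟨hb.trans hs.1.le, hs.2⟩
      have h2 : s ∉ Ioi (0 : ℝ) := not_lt.2 hs.2
      simp [G, h2, indicator_of_mem h1]
  refine ⟨hcont w, _, hG, isWeakDeriv_of_primitive (hG.integrable Fact.out) (w (t - 1)) ?_⟩
  filter_upwards [ae_restrict_mem measurableSet_Icc] with σ hσ
  rw [intervalIntegral.integral_comp_add_left, hw _ (by linarith [hσ.1]), hw _ (by linarith),
    ← intervalIntegral.integral_add_adjacent_intervals (hGi 0 (t - 1)) (hGi _ _), add_assoc,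
    sub_eq_add_neg]

theorem IsDelayPair.isDelaySolution {x : X} {f g : DelayLp X p} {w v : C(ℝ, X)}
    (h : IsDelayPair p A Φ x f w v) (hg : IsWeakDeriv f g) : IsDelaySolution p A Φ x f w where
  continuousOn := w.continuous.continuousOn
  mem_W1p t ht := h.memW1p hg ht
  equation := by
    refine ⟨v, v.continuous.continuousOn, fun t ht => ⟨?_, ?_⟩⟩
    · have h1 : HasDerivWithinAt (fun t => x + ∫ s in (0 : ℝ)..t, v s) (v t) (Ici 0) t :=
        ((hasDerivAt_primitive v.continuous 0 t).const_add x).hasDerivWithinAt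
      exact h1.congr (fun s hs => h.eq_integral s hs) (h.eq_integral t ht)
    · obtain ⟨⟨y, hy⟩, hyw, hA⟩ := (LinearPMap.mem_graph_iff A).1 (h.mem_graph t ht)
      simp only at hyw hA
      subst hyw
      exact ⟨hy, historySegment w t, fun σ => rfl, (sub_eq_iff_eq_add.1 hA.symm)⟩
  initial_value := h.map_zero
  initial_history := by
    have h1 := (isContRep_iff_eq_contToLp _ _).2 h.history
    refine (ae_restrict_iff' measurableSet_Icc).2 ?_
    filter_upwards [h1] with s hs hs'
    rw [hs hs', historySegment_apply, zero_add]

/-! ### Integrated history segments and the operator matrix -/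

theorem delay_integralSegment (Φ : C(Icc (-1 : ℝ) 0, X) →L[𝕜] X) (w : C(ℝ, X)) (t : ℝ) :
    Φ (integralSegment w t) = ∫ s in (0 : ℝ)..t, Φ (historySegment w s) :=
  (Φ.intervalIntegral_comp_comm
    ((continuous_historySegment w).intervalIntegrable (μ := volume) 0 t)).symm

theorem integralSegment_eq (w : C(ℝ, X)) (t : ℝ) (σ : Icc (-1 : ℝ) 0) :
    integralSegment w t σ = (∫ s in (0 : ℝ)..t, w s) + ∫ s in (0 : ℝ)..σ,
      (contToLp p (historySegment w t) - contToLp p (historySegment w 0) : DelayLp X p) s := by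
  have h := (isWeakDeriv_contToLp_iff _ _).1 (isWeakDeriv_integralSegment (p := p) w t) σ
  rwa [integralSegment_apply w t ⟨0, _⟩, add_zero] at h

theorem continuous_contToLp_historySegment (w : C(ℝ, X)) :
    Continuous fun t => contToLp p (historySegment w t) :=
  (contToLp p).continuous.comp (continuous_historySegment w)

theorem integral_mem_delayOp_graph {w : C(ℝ, X)} {t : ℝ} {y : X}
    (h : (∫ s in (0 : ℝ)..t, w s, y - Φ (integralSegment w t)) ∈ A.graph) :
    (∫ s in (0 : ℝ)..t, (w s, contToLp p (historySegment w s)),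
      (y, contToLp p (historySegment w t) - contToLp p (historySegment w 0))) ∈
      (delayOp p A Φ).graph := by
  rw [intervalIntegral_prodMk w.continuous (continuous_contToLp_historySegment w),
    integral_contToLp_historySegment, mem_delayOp_graph_iff]
  refine ⟨_, rfl, ?_, h, integralSegment_eq w t⟩
  rw [integralSegment_apply, add_zero]

/-- If the primitive of `G` satisfies the integrated transport equation with boundary value
`∫₀ᵗ w` and initial value `w₀`, then `G(t)` is the history segment of `w`. -/
theorem eq_historySegment_of_transport {w : C(ℝ, X)} {G : ℝ → DelayLp X p} (hG : Continuous G)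
    (h : ∀ t, 0 ≤ t → ∃ F : C(Icc (-1 : ℝ) 0, X), ∫ s in (0 : ℝ)..t, G s = contToLp p F ∧
      ∀ σ : Icc (-1 : ℝ) 0, F σ = (∫ s in (0 : ℝ)..t, w s) +
        ∫ s in (0 : ℝ)..σ, (G t - contToLp p (historySegment w 0) : DelayLp X p) s) :
    ∀ t, 0 ≤ t → G t = contToLp p (historySegment w t) := by
  have hc := continuous_contToLp_historySegment (p := p) w
  have key := transport_unique (d := fun t => G t - contToLp p (historySegment w t))
    (hG.sub hc) fun t ht => by
    obtain ⟨F, hF, hFσ⟩ := h t ht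
    refine ⟨F - integralSegment w t, ?_, fun σ => ?_⟩
    · rw [intervalIntegral.integral_sub (hG.intervalIntegrable _ _) (hc.intervalIntegrable _ _),
        hF, integral_contToLp_historySegment, map_sub]
    · rw [ContinuousMap.sub_apply, hFσ, integralSegment_eq (p := p)]
      have h1 := fun k => lpIntegral_apply (X := X) (p := p) ⟨0, by norm_num⟩ σ k
      simp only at h1
      rw [← h1, ← h1, ← h1, add_sub_add_left_eq_sub, ← map_sub, sub_sub_sub_cancel_right]
  exact fun t ht => sub_eq_zero.1 (key t ht)

end Pairs

/-! ### Variation of constants -/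

section VariationOfConstants

variable {𝕜 : Type*} [RCLike 𝕜] {E : Type*} [NormedAddCommGroup E] [NormedSpace 𝕜 E]
  [NormedSpace ℝ E] [CompleteSpace E] [IsScalarTower ℝ 𝕜 E]
  {T : ℝ → E →L[𝕜] E} {G : E →ₗ.[𝕜] E}

namespace IsC0Semigroup

/-- The mild solution of `u' = G u + h`, `u(0) = x`, given by the variation of constants formula. -/
noncomputable def variationOfConstants (T : ℝ → E →L[𝕜] E) (x : E) (h : ℝ → E) (t : ℝ) : E :=
  T (max t 0) x + ∫ s in (0 : ℝ)..t, T (max (t - s) 0) (h s)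

theorem continuous_convolution (hT : IsC0Semigroup T) {h : ℝ → E} (hh : Continuous h) :
    Continuous fun t => ∫ s in (0 : ℝ)..t, T (max (t - s) 0) (h s) := by
  have hF : Continuous (Function.uncurry fun r s : ℝ => T (max (r - s) 0) (h s)) :=
    hT.continuous_uncurry.comp
      ((continuous_fst.sub continuous_snd).prodMk (hh.comp continuous_snd))
  exact intervalIntegral.continuous_parametric_intervalIntegral_of_continuous hF continuous_id

theorem continuous_variationOfConstants (hT : IsC0Semigroup T) (x : E) {h : ℝ → E}
    (hh : Continuous h) : Continuous (variationOfConstants T x h) :=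
  (hT.continuous_orbit x).add (hT.continuous_convolution hh)

theorem variationOfConstants_mem_graph (hT : IsC0Semigroup T) (hG : IsGeneratorOf G T) (x : E)
    {h : ℝ → E} (hh : Continuous h) {t : ℝ} (ht : 0 ≤ t) :
    (∫ s in (0 : ℝ)..t, variationOfConstants T x h s,
      variationOfConstants T x h t - x - ∫ s in (0 : ℝ)..t, h s) ∈ G.graph := by
  have h1 := G.graph.add_mem (hT.integral_mem_graph hG x ht) (hT.conv_mem_graph hG hh ht)
  simp only [variationOfConstants]
  rw [intervalIntegral.integral_add ((hT.continuous_orbit x).intervalIntegrable _ _)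
    ((hT.continuous_convolution hh).intervalIntegrable _ _), max_eq_left ht]
  rwa [Prod.mk_add_mk, add_sub, sub_add_eq_add_sub] at h1

theorem eq_variationOfConstants (hT : IsC0Semigroup T) (hG : IsGeneratorOf G T) {x : E}
    {u h : ℝ → E} (hu : Continuous u) (hh : Continuous h)
    (huh : ∀ t, 0 ≤ t → (∫ s in (0 : ℝ)..t, u s, u t - x - ∫ s in (0 : ℝ)..t, h s) ∈ G.graph) :
    ∀ t, 0 ≤ t → u t = variationOfConstants T x h t := by
  intro t ht
  have hv := hT.continuous_variationOfConstants x hh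
  have := hT.mild_unique hG (v := fun s => u s - variationOfConstants T x h s) (b := t)
    (hu.sub hv) (fun r hr => by
      have h1 := G.graph.sub_mem (huh r hr.1) (hT.variationOfConstants_mem_graph hG x hh hr.1)
      rw [Prod.mk_sub_mk, ← intervalIntegral.integral_sub (hu.intervalIntegrable _ _)
        (hv.intervalIntegrable _ _), sub_sub_sub_cancel_right, sub_sub_sub_cancel_right] at h1
      exact h1) t ⟨ht, le_rfl⟩
  exact sub_eq_zero.1 this

end IsC0Semigroup

end VariationOfConstants

/-! ### Well-posedness of the delay equation -/

section WellPosed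

variable {𝕜 : Type*} [RCLike 𝕜] {X : Type*} [NormedAddCommGroup X] [NormedSpace 𝕜 X]
  [NormedSpace ℝ X] [IsScalarTower ℝ 𝕜 X] [CompleteSpace X] {p : ℝ≥0∞} [Fact (1 ≤ p)]
  {A : X →ₗ.[𝕜] X} {Φ : C(Icc (-1 : ℝ) 0, X) →L[𝕜] X} {S : ℝ → X →L[𝕜] X} {κ : ℝ}

theorem variationOfConstants_eq_volterraOp (hS : IsC0Semigroup S) (x : X) (w : C(ℝ, X)) {t : ℝ}
    (ht : 0 ≤ t) :
    IsC0Semigroup.variationOfConstants S x (fun s => Φ (historySegment w s)) t =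
      S t x + volterraOp Φ (L := fun t => S (max t 0)) hS.continuous_uncurry w t := by
  rw [volterraOp_apply, IsC0Semigroup.variationOfConstants, max_eq_left ht]

theorem integral_norm_history_le (p : ℝ≥0∞) [Fact (1 ≤ p)] (w : C(ℝ, X)) :
    ∫ s in (-1 : ℝ)..0, ‖w s‖ ≤ ‖contToLp p (historySegment w 0)‖ := by
  refine le_trans (le_of_eq ?_)
    ((contToLp p (historySegment w 0)).intervalIntegral_norm_le le_rfl (by norm_num) le_rfl)
  refine intervalIntegral.integral_congr_ae ?_
  have h1 := (isContRep_iff_eq_contToLp (p := p) _ _).2 (rfl : _ = contToLp p (historySegment w 0))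
  filter_upwards [h1] with s hs hs'
  rw [uIoc_of_le (by norm_num)] at hs'
  rw [hs (Ioc_subset_Icc_self hs'), historySegment_apply, zero_add]

/-- Classical solutions satisfy the integrated equation. -/
theorem IsDelayPair.integral_mem_graph (hA : A.IsClosed) {x : X} {f : DelayLp X p}
    {w v : C(ℝ, X)} (h : IsDelayPair p A Φ x f w v) {t : ℝ} (ht : 0 ≤ t) :
    (∫ s in (0 : ℝ)..t, w s, w t - x - ∫ s in (0 : ℝ)..t, Φ (historySegment w s)) ∈ A.graph := by
  have h1 := graph_integral_mem (v := fun s => v s - Φ (historySegment w s)) hA w.continuous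
    (v.continuous.sub (continuous_delay Φ w)) ht fun s hs => h.mem_graph s hs.1
  rwa [intervalIntegral.integral_sub (v.continuous.intervalIntegrable _ _)
    ((continuous_delay Φ w).intervalIntegrable _ _), ← sub_eq_iff_eq_add'.2 (h.eq_integral t ht)]
    at h1

/-- If `A` generates a semigroup, then variation of constants and Gronwall's inequality bound the
classical solutions by their initial values. -/
theorem IsDelayPair.exists_bound (hS : IsC0Semigroup S) (hA : IsGeneratorOf A S)
    (hΦ : HasDelayBound Φ κ) (hκ : 0 ≤ κ) (b : ℝ) :
    ∃ C : ℝ, ∀ (x : X) (f : DelayLp X p) (w v : C(ℝ, X)), IsDelayPair p A Φ x f w v →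
      ∀ t ∈ Icc 0 b, ‖w t‖ ≤ C * (‖x‖ + ‖f‖) := by
  obtain ⟨M, hM0, hM⟩ := hS.exists_bound b
  refine ⟨(M + M * κ) * Real.exp (M * κ * b), fun x f w v h t ht => ?_⟩
  have h1 : ∀ t ∈ Icc 0 b,
      ‖w t‖ ≤ M * ‖x‖ + M * ∫ s in (0 : ℝ)..t, ‖Φ (historySegment w s)‖ := by
    intro t ht
    rw [hS.eq_variationOfConstants hA w.continuous (continuous_delay Φ w)
      (fun t ht => h.integral_mem_graph (hS.isClosed_generator hA) ht) t ht.1,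
      variationOfConstants_eq_volterraOp hS x w ht.1]
    refine (norm_add_le _ _).trans (add_le_add ((S t).le_of_opNorm_le (hM t ht) x) ?_)
    exact norm_volterraOp_le_integral _ (fun r hr => by
      rw [max_eq_left hr.1]
      exact hM r hr) w ht
  refine (hΦ.gronwall hκ w hM0 h1 t ht).trans ?_
  have h2 : ∫ s in (-1 : ℝ)..0, ‖w s‖ ≤ ‖f‖ := h.history ▸ integral_norm_history_le p w
  calc (M * ‖x‖ + M * κ * ∫ s in (-1 : ℝ)..0, ‖w s‖) * Real.exp (M * κ * b)
      ≤ ((M + M * κ) * ‖x‖ + (M + M * κ) * ‖f‖) * Real.exp (M * κ * b) := by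
        have h3 : 0 ≤ M * κ := mul_nonneg hM0 hκ
        refine mul_le_mul_of_nonneg_right (add_le_add ?_ ?_) (Real.exp_nonneg _)
        · exact mul_le_mul_of_nonneg_right (le_add_of_nonneg_right h3) (norm_nonneg _)
        · exact (mul_le_mul_of_nonneg_left h2 h3).trans
            (mul_le_mul_of_nonneg_right (le_add_of_nonneg_left hM0) (norm_nonneg _))
    _ = (M + M * κ) * Real.exp (M * κ * b) * (‖x‖ + ‖f‖) := by ring

/-- Existence of classical solutions if `A` is a generator. The derivative `v` of the solution
solves the delay equation with initial value `y = A x + Φ f` and history `g = f'`; as `g` is only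
in `L^p`, it is approximated by continuous histories with value `y` at `0`. -/
theorem exists_isDelayPair (hp : p ≠ ⊤) (hS : IsC0Semigroup S) (hA : IsGeneratorOf A S)
    (hΦ : HasDelayBound Φ κ) (hκ : 0 ≤ κ) {F : C(Icc (-1 : ℝ) 0, X)} {g : DelayLp X p}
    {x : X} (hF0 : F ⟨0, by norm_num⟩ = x)
    (hg : IsWeakDeriv (contToLp p F) g) {y : X} (hxy : (x, y - Φ F) ∈ A.graph) :
    ∃ w v : C(ℝ, X), IsDelayPair p A Φ x (contToLp p F) w v := by
  have h10 : (-1 : ℝ) ≤ 0 := by norm_num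
  have h0 : (0 : ℝ) ∈ Icc (-1 : ℝ) 0 := by norm_num
  have hAcl := hS.isClosed_generator hA
  choose γ hγ0 hγ using fun n : ℕ =>
    exists_continuous_near hp g y (Nat.one_div_pos_of_nat (α := ℝ) (n := n))
  let a : ℕ → C(ℝ, X) := fun n =>
    ⟨fun t => IccExtend h10 (γ n) t + (S (max t 0) y - y),
      (continuous_iccExtend_delay (γ n)).add ((hS.continuous_orbit y).sub continuous_const)⟩
  have hL : Continuous fun q : ℝ × X => S (max q.1 0) q.2 := hS.continuous_uncurry
  choose v hv using fun n => exists_volterra_solution (L := fun t => S (max t 0)) hL hΦ hκ (a n)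
  have hv' : ∀ n t, v n t = IccExtend h10 (γ n) t + (S (max t 0) y - y)
      + volterraOp Φ (L := fun t => S (max t 0)) hL (v n) t :=
    fun n t => DFunLike.congr_fun (hv n) t
  have hvpos : ∀ n t, 0 ≤ t →
      v n t = S t y + volterraOp Φ (L := fun t => S (max t 0)) hL (v n) t := by
    intro n t ht
    rw [hv' n t, max_eq_left ht, IccExtend_of_right_le _ _ ht]
    have : γ n ⟨0, right_mem_Icc.2 h10⟩ = y := hγ0 n
    rw [this]; abel
  have hvneg : ∀ n, historySegment (v n) 0 = γ n := by
    intro n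
    ext σ
    rw [historySegment_apply, zero_add, hv' n, volterraOp_of_nonpos _ _ σ.2.2,
      max_eq_right σ.2.2, hS.zero_apply, sub_self, add_zero, add_zero, IccExtend_of_mem _ _ σ.2]
  have hγlim : Tendsto (fun n => contToLp p (γ n)) atTop (𝓝 g) := by
    rw [tendsto_iff_norm_sub_tendsto_zero]
    exact squeeze_zero (fun _ => norm_nonneg _) (fun n => (hγ n).le)
      tendsto_one_div_add_atTop_nhds_zero_nat
  have hcauchy : ∀ b, 0 ≤ b → UniformCauchySeqOn (fun n t => v n t) atTop (Icc 0 b) := by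
    intro b hb
    obtain ⟨M, hM0, hM⟩ := hS.exists_bound b
    have hbound : ∀ m n, ∀ t ∈ Icc 0 b, ‖(v m - v n) t‖
        ≤ M * κ * Real.exp (M * κ * b) * ‖contToLp p (γ m) - contToLp p (γ n)‖ := by
      intro m n t ht
      refine (hΦ.gronwall (α := 0) hκ (v m - v n) hM0 (fun r hr => ?_) t ht).trans ?_
      · rw [ContinuousMap.sub_apply, hvpos m r hr.1, hvpos n r hr.1, add_sub_add_left_eq_sub,
          ← ContinuousMap.sub_apply, ← volterraOp_sub, zero_add]
        exact norm_volterraOp_le_integral _ (fun r hr => by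
          rw [max_eq_left hr.1]
          exact hM r hr) _ hr
      · have h2 := integral_norm_history_le p (v m - v n)
        rw [historySegment_sub, hvneg, hvneg, map_sub] at h2
        rw [zero_add, mul_right_comm]
        gcongr
    rw [Metric.uniformCauchySeqOn_iff]
    intro ε hε
    set C := M * κ * Real.exp (M * κ * b)
    have hC : 0 ≤ C := by positivity
    obtain ⟨N, hN⟩ := Metric.cauchySeq_iff.1 hγlim.cauchySeq (ε / (C + 1)) (by positivity)
    refine ⟨N, fun m hm n hn t ht => ?_⟩
    have h2 := hN m hm n hn
    rw [dist_eq_norm, lt_div_iff₀ (by positivity)] at h2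
    rw [dist_eq_norm]
    refine (hbound m n t ht).trans_lt (lt_of_le_of_lt ?_ h2)
    rw [mul_comm]
    gcongr
    exact le_add_of_nonneg_right zero_le_one
  obtain ⟨V, hV, hunif⟩ := exists_limit_of_uniformCauchySeqOn (fun n => (v n).continuous) hcauchy
  have hVi := fun a b => hV.intervalIntegrable (μ := volume) a b
  have hvi := fun n a b => (v n).continuous.intervalIntegrable (μ := volume) a b
  let w : C(ℝ, X) := ⟨fun t => IccExtend h10 F t + ∫ s in (0 : ℝ)..(max t 0), V s,
    (continuous_iccExtend_delay F).add ((intervalIntegral.continuous_primitive hVi 0).comp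
      (continuous_id.max continuous_const))⟩
  have hwpos : ∀ t, 0 ≤ t → w t = x + ∫ s in (0 : ℝ)..t, V s := fun t ht => by
    change IccExtend h10 F t + ∫ s in (0 : ℝ)..(max t 0), V s = _
    rw [max_eq_left ht, IccExtend_of_right_le _ _ ht]
    exact congrArg (· + _) hF0
  have hwneg : ∀ σ : Icc (-1 : ℝ) 0, w σ = F σ := fun σ => by
    change IccExtend h10 F σ + ∫ s in (0 : ℝ)..(max (σ : ℝ) 0), V s = _
    rw [max_eq_right σ.2.2, intervalIntegral.integral_same, add_zero, IccExtend_of_mem _ _ σ.2]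
  have hw0 : historySegment w 0 = F := by
    ext σ
    rw [historySegment_apply, zero_add, hwneg]
  -- the primitives of the approximations converge to `w - x`, uniformly on `[-1, t]`
  have hprim : ∀ t, 0 ≤ t → ∀ ε, 0 < ε → ∀ᶠ n in atTop, ∀ c ∈ Icc (-1) t,
      ‖(∫ s in (0 : ℝ)..c, v n s) - (w c - x)‖ ≤ ε := by
    intro t ht ε hε
    have h1 := Metric.tendstoUniformlyOn_iff.1 (hunif t ht) (ε / (t + 1)) (by positivity)
    have h2 := (Metric.tendsto_nhds.1 hγlim) ε hε
    filter_upwards [h1, h2] with n hn1 hn2 c hc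
    rcases le_total 0 c with h0c | h0c
    · rw [hwpos c h0c, add_sub_cancel_left, ← intervalIntegral.integral_sub (hvi n _ _) (hVi _ _)]
      refine (intervalIntegral.norm_integral_le_of_norm_le_const (C := ε / (t + 1))
        fun s hs => ?_).trans ?_
      · rw [uIoc_of_le h0c] at hs
        have := hn1 s ⟨hs.1.le, hs.2.trans hc.2⟩
        rw [dist_eq_norm, norm_sub_rev] at this
        exact this.le
      · rw [sub_zero, abs_of_nonneg h0c, div_mul_eq_mul_div, div_le_iff₀ (by positivity)]
        gcongr
        linarith [hc.2]
    · let σ : Icc (-1 : ℝ) 0 := ⟨c, hc.1, h0c⟩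
      have h3 := (isWeakDeriv_contToLp_iff _ _).1 hg σ
      have h4 : w c = F σ := hwneg σ
      have h5 : ∫ s in (0 : ℝ)..c, v n s = lpIntegral p ⟨0, h0⟩ σ (contToLp p (γ n)) := by
        rw [lpIntegral_apply, integral_contToLp]
        refine intervalIntegral.integral_congr fun s hs => ?_
        have hs' : s ∈ Icc (-1 : ℝ) 0 := uIcc_subset_Icc h0 σ.2 hs
        have := DFunLike.congr_fun (hvneg n) ⟨s, hs'⟩
        rw [historySegment_apply, zero_add] at this
        rw [IccExtend_of_mem _ _ hs', ← this]
      have h6 : F σ - x = lpIntegral p ⟨0, h0⟩ σ g := by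
        rw [lpIntegral_apply, h3, hF0, add_sub_cancel_left]
      rw [h4, h5, h6, ← map_sub]
      refine (norm_lpIntegral_le _ _ _).trans ?_
      rw [dist_eq_norm] at hn2
      exact hn2.le
  have hseg : ∀ t, 0 ≤ t → Tendsto (fun n => integralSegment (v n) t) atTop
      (𝓝 (historySegment w t - historySegment w 0)) := by
    intro t ht
    rw [Metric.tendsto_nhds]
    intro ε hε
    filter_upwards [hprim t ht (ε / 4) (by positivity)] with n hn
    rw [dist_eq_norm]
    refine lt_of_le_of_lt ((ContinuousMap.norm_le _ (half_pos hε).le).2 fun σ => ?_)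
      (half_lt_self hε)
    rw [ContinuousMap.sub_apply, ContinuousMap.sub_apply, integralSegment_apply,
      historySegment_apply, historySegment_apply, zero_add,
      ← intervalIntegral.integral_interval_sub_left (hvi n 0 (t + σ)) (hvi n 0 σ)]
    have e1 := hn (t + σ) ⟨by linarith [σ.2.1], by linarith [σ.2.2]⟩
    have e2 := hn σ ⟨σ.2.1, σ.2.2.trans ht⟩
    have e3 : ((∫ s in (0 : ℝ)..(t + σ), v n s) - ∫ s in (0 : ℝ)..σ, v n s) - (w (t + σ) - w σ)
        = ((∫ s in (0 : ℝ)..(t + σ), v n s) - (w (t + σ) - x))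
          - ((∫ s in (0 : ℝ)..σ, v n s) - (w σ - x)) := by abel
    rw [e3]
    refine (norm_sub_le _ _).trans ?_
    linarith
  refine ⟨w, ⟨V, hV⟩, by rw [hw0], hwpos, fun t ht => ?_⟩
  have h1 : ∀ n, (∫ s in (0 : ℝ)..t, v n s, v n t - y - Φ (integralSegment (v n) t)) ∈ A.graph := by
    intro n
    have h2 := hS.variationOfConstants_mem_graph hA y (continuous_delay Φ (v n)) ht
    have h3 : ∀ s, 0 ≤ s → IsC0Semigroup.variationOfConstants S y
        (fun s => Φ (historySegment (v n) s)) s = v n s := fun s hs => by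
      rw [variationOfConstants_eq_volterraOp hS y (v n) hs, hvpos n s hs]
    rw [h3 t ht, ← delay_integralSegment] at h2
    convert h2 using 2
    refine intervalIntegral.integral_congr fun s hs => ?_
    rw [uIcc_of_le ht] at hs
    exact (h3 s hs.1).symm
  have h2 : Tendsto (fun n => ∫ s in (0 : ℝ)..t, v n s) atTop (𝓝 (w t - x)) := by
    rw [Metric.tendsto_nhds]
    intro ε hε
    filter_upwards [hprim t ht (ε / 2) (half_pos hε)] with n hn
    rw [dist_eq_norm]
    exact (hn t ⟨by linarith, le_rfl⟩).trans_lt (half_lt_self hε)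
  have h3 : Tendsto (fun n => v n t - y - Φ (integralSegment (v n) t)) atTop
      (𝓝 (V t - y - Φ (historySegment w t - historySegment w 0))) :=
    (((hunif t ht).tendsto_at ⟨ht, le_rfl⟩).sub_const y).sub
      ((Φ.continuous.tendsto _).comp (hseg t ht))
  have h4 : (w t - x, V t - y - Φ (historySegment w t - historySegment w 0)) ∈ A.graph :=
    hAcl.mem_of_tendsto (h2.prodMk_nhds h3) (Eventually.of_forall h1)
  have h5 := A.graph.add_mem h4 hxy
  rw [Prod.mk_add_mk, sub_add_cancel, hw0, map_sub] at h5
  convert h5 using 2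
  change V t - _ = _
  abel

theorem eq_contToLp_of_mem_delayDomain {x : X} {f : DelayLp X p} (h : (x, f) ∈ delayDomain p A) :
    ∃ (F : C(Icc (-1 : ℝ) 0, X)) (g : DelayLp X p), f = contToLp p F ∧ F ⟨0, by norm_num⟩ = x ∧
      IsWeakDeriv f g ∧ x ∈ A.domain := by
  obtain ⟨hx, ⟨g, hg⟩, F, hF, hF0⟩ := h
  exact ⟨F, g, (isContRep_iff_eq_contToLp _ _).1 hF, hF0, hg, hx⟩

/-- If `A` generates a strongly continuous semigroup, then the delay equation is well-posed. -/
theorem delayWellPosed_of_generator (hp : p ≠ ⊤) (hS : IsC0Semigroup S) (hA : IsGeneratorOf A S)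
    (hΦ : HasDelayBound Φ κ) (hκ : 0 ≤ κ) : DelayWellPosed p A Φ where
  exists_solution x f hxf := by
    obtain ⟨F, g, rfl, hF0, hg, hx⟩ := eq_contToLp_of_mem_delayDomain hxf
    obtain ⟨w, v, h⟩ := exists_isDelayPair hp hS hA hΦ hκ hF0 hg (y := A ⟨x, hx⟩ + Φ F) (by
      rw [add_sub_cancel_right]
      exact A.mem_graph ⟨x, hx⟩)
    exact ⟨w, h.isDelaySolution hg⟩
  unique_solution x f _ u₁ u₂ hu₁ hu₂ := by
    obtain ⟨w₁, v₁, h₁, hw₁⟩ := hu₁.exists_pair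
    obtain ⟨w₂, v₂, h₂, hw₂⟩ := hu₂.exists_pair
    intro t ht
    rw [← hw₁ t ht, ← hw₂ t ht]
    rcases le_total t 0 with h0 | h0
    · have h3 : historySegment w₁ 0 = historySegment w₂ 0 :=
        contToLp_injective (h₁.history.symm.trans h₂.history)
      have h4 := DFunLike.congr_fun h3 ⟨t, ht, h0⟩
      simpa [historySegment_apply] using h4
    · obtain ⟨C, hC⟩ := IsDelayPair.exists_bound (p := p) hS hA hΦ hκ t
      have h3 := hC _ _ _ _ (h₁.sub h₂) t ⟨h0, le_rfl⟩
      rw [sub_self, sub_self, norm_zero, norm_zero, add_zero, mul_zero] at h3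
      exact sub_eq_zero.1 (norm_le_zero_iff.1 h3)
  continuous_dependence x f xs fs u us _ _ hlim hu hus b hb := by
    obtain ⟨w, v, h, hw⟩ := hu.exists_pair
    choose ws vs hs hws using fun n => (hus n).exists_pair
    obtain ⟨C, hC⟩ := IsDelayPair.exists_bound (p := p) hS hA hΦ hκ b
    have h1 : Tendsto (fun n => C * (‖x - xs n‖ + ‖f - fs n‖)) atTop (𝓝 0) := by
      have hx : Tendsto xs atTop (𝓝 x) := (continuous_fst.tendsto _).comp hlim
      have hf : Tendsto fs atTop (𝓝 f) := (continuous_snd.tendsto _).comp hlim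
      have := (((tendsto_const_nhds (x := x)).sub hx).norm.add
        ((tendsto_const_nhds (x := f)).sub hf).norm).const_mul C
      simpa using this
    rw [Metric.tendstoUniformlyOn_iff]
    intro ε hε
    filter_upwards [h1.eventually (gt_mem_nhds hε)] with n hn t ht
    rw [dist_eq_norm, ← hw t (by linarith [ht.1]), ← hws n t (by linarith [ht.1])]
    exact (hC _ _ _ _ (h.sub (hs n)) t ht).trans_lt hn

end WellPosed

/-! ### From well-posedness to generation by the operator matrix -/

section Necessity

variable {𝕜 : Type*} [RCLike 𝕜] {X : Type*} [NormedAddCommGroup X] [NormedSpace 𝕜 X]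
  [NormedSpace ℝ X] [IsScalarTower ℝ 𝕜 X] [CompleteSpace X] {p : ℝ≥0∞} [Fact (1 ≤ p)]
  {A : X →ₗ.[𝕜] X} {Φ : C(Icc (-1 : ℝ) 0, X) →L[𝕜] X} {κ : ℝ}

theorem norm_contToLp_eq (F : C(Icc (-1 : ℝ) 0, X)) : ‖contToLp p F‖ =
    (eLpNorm (IccExtend (by norm_num : (-1 : ℝ) ≤ 0) F) p delayMeasure).toReal := by
  rw [Lp.norm_def, eLpNorm_congr_ae (contToLp_ae F)]

/-- The `L^p` norm of a history segment is bounded by that of the initial history and a bound for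
the function at positive times. -/
theorem norm_historySegment_le (w : C(ℝ, X)) {t B : ℝ} (ht : 0 ≤ t) (hB : 0 ≤ B)
    (h : ∀ s ∈ Icc 0 t, ‖w s‖ ≤ B) :
    ‖contToLp p (historySegment w t)‖ ≤ ‖contToLp p (historySegment w 0)‖ + B := by
  have h10 : (-1 : ℝ) ≤ 0 := by norm_num
  set w₀ : ℝ → X := (Icc (-1 : ℝ) 0).indicator (IccExtend h10 (historySegment w 0)) with hw₀
  have hm₀ : AEStronglyMeasurable w₀ volume :=
    (continuous_iccExtend_delay _).aestronglyMeasurable.indicator measurableSet_Icc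
  let w₁ : ℝ → X := {σ | 0 < t + σ}.indicator fun σ => w (t + σ)
  have hms : MeasurableSet {σ : ℝ | 0 < t + σ} :=
    measurableSet_lt measurable_const (measurable_const_add t)
  have hm₁ : AEStronglyMeasurable w₁ delayMeasure :=
    (w.continuous.comp (continuous_const_add t)).aestronglyMeasurable.indicator hms
  have hae : IccExtend h10 (historySegment w t) =ᵐ[delayMeasure] (fun σ => w₀ (t + σ)) + w₁ := by
    filter_upwards [ae_restrict_mem measurableSet_Icc] with σ hσ
    rw [IccExtend_of_mem _ _ hσ, historySegment_apply, Pi.add_apply]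
    rcases lt_or_ge 0 (t + σ) with h0 | h0
    · have h1 : t + σ ∉ Icc (-1 : ℝ) 0 := fun h => absurd h.2 (not_le.2 h0)
      have h2 : σ ∈ {σ : ℝ | 0 < t + σ} := h0
      simp only [hw₀, w₁, indicator_of_notMem h1, zero_add, indicator_of_mem h2]
    · have h1 : t + σ ∈ Icc (-1 : ℝ) 0 := ⟨by linarith [hσ.1], h0⟩
      have h2 : σ ∉ {σ : ℝ | 0 < t + σ} := not_lt.2 h0
      simp only [hw₀, w₁, indicator_of_mem h1, indicator_of_notMem h2, IccExtend_of_mem _ _ h1,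
        historySegment_apply, add_zero, zero_add]
  have e₀ : eLpNorm (fun σ => w₀ (t + σ)) p delayMeasure
      ≤ ENNReal.ofReal ‖contToLp p (historySegment w 0)‖ := by
    refine (eLpNorm_restrict_le _ _ _ _).trans ?_
    rw [show (fun σ => w₀ (t + σ)) = w₀ ∘ (fun σ => t + σ) from rfl,
      eLpNorm_comp_measurePreserving hm₀ (measurePreserving_add_left volume t), hw₀,
      eLpNorm_indicator_eq_eLpNorm_restrict measurableSet_Icc, norm_contToLp_eq,
      ENNReal.ofReal_toReal (memLp_iccExtend p _).eLpNorm_ne_top]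
  have e₁ : eLpNorm w₁ p delayMeasure ≤ ENNReal.ofReal B := by
    refine (eLpNorm_le_of_ae_bound (C := B) ?_).trans (by simp)
    filter_upwards [ae_restrict_mem measurableSet_Icc] with σ hσ
    rcases lt_or_ge 0 (t + σ) with h0 | h0
    · exact (norm_indicator_le_norm_self _ _).trans (h _ ⟨h0.le, by linarith [hσ.2]⟩)
    · have h2 : σ ∉ {σ : ℝ | 0 < t + σ} := not_lt.2 h0
      simpa only [w₁, indicator_of_notMem h2, norm_zero] using hB
  rw [norm_contToLp_eq]
  refine ENNReal.toReal_le_of_le_ofReal (by positivity) ?_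
  rw [eLpNorm_congr_ae hae, ENNReal.ofReal_add (norm_nonneg _) hB]
  refine (eLpNorm_add_le ?_ hm₁ Fact.out).trans (add_le_add e₀ e₁)
  exact (hm₀.comp_measurePreserving (measurePreserving_add_left volume t)).restrict

theorem isWeakDeriv_zero : IsWeakDeriv (0 : DelayLp X p) (0 : DelayLp X p) := by
  have h := isWeakDeriv_integralSegment (p := p) (0 : C(ℝ, X)) 0
  have h1 : integralSegment (0 : C(ℝ, X)) 0 = 0 := intervalIntegral.integral_same
  rwa [sub_self, h1, map_zero] at h

theorem isDelayPair_zero : IsDelayPair p A Φ 0 0 0 0 where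
  history := by
    have : historySegment (0 : C(ℝ, X)) 0 = 0 := rfl
    rw [this, map_zero]
  eq_integral t _ := by simp
  mem_graph t _ := by
    have : historySegment (0 : C(ℝ, X)) t = 0 := rfl
    rw [this, map_zero]
    simp

/-- Continuous dependence on the initial values gives a linear bound. -/
theorem DelayWellPosed.exists_bound (h : DelayWellPosed p A Φ) (b : ℝ) :
    ∃ K : ℝ, ∀ (x : X) (f : DelayLp X p) (w v : C(ℝ, X)), (x, f) ∈ delayDomain p A →
      IsDelayPair p A Φ x f w v → ∀ t ∈ Icc 0 b, ‖w t‖ ≤ K * ‖(x, f)‖ := by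
  rcases lt_or_ge b 0 with hb | hb
  · exact ⟨0, fun _ _ _ _ _ _ t ht => absurd (ht.1.trans ht.2) (not_le.2 hb)⟩
  by_contra! hcon
  choose x f w v hxf hw t ht hlt using fun n : ℕ => hcon n
  have hpos : ∀ n, 0 < ‖w n (t n)‖ := fun n => lt_of_le_of_lt (by positivity) (hlt n)
  -- normalized so that the solutions attain norm one, the initial values tend to zero
  let c : ℕ → ℝ := fun n => ‖w n (t n)‖⁻¹
  have hmem : ∀ n, (c n • x n, c n • f n) ∈ delayDomain p A := fun n => by
    have h1 := hxf n
    rw [← delayOp_domain p A Φ] at h1 ⊢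
    exact ((delayOp p A Φ).domain.restrictScalars ℝ).smul_mem (c n) h1
  have hlim : Tendsto (fun n => (c n • x n, c n • f n)) atTop (𝓝 ((0 : X), (0 : DelayLp X p))) := by
    rw [← Prod.zero_eq_mk, tendsto_zero_iff_norm_tendsto_zero]
    refine squeeze_zero' (Eventually.of_forall fun _ => norm_nonneg _) ?_
      tendsto_inv_atTop_nhds_zero_nat
    filter_upwards [eventually_gt_atTop 0] with n hn
    have hn' : (0 : ℝ) < n := Nat.cast_pos.2 hn
    rw [← Prod.smul_mk, norm_smul, Real.norm_of_nonneg (inv_nonneg.2 (norm_nonneg _)),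
      inv_mul_le_iff₀ (hpos n), ← div_eq_mul_inv, le_div_iff₀ hn', mul_comm]
    exact (hlt n).le
  have hsol : ∀ n, IsDelaySolution p A Φ (c n • x n) (c n • f n) (c n • w n) := fun n => by
    obtain ⟨_, _, -, -, hg, -⟩ := eq_contToLp_of_mem_delayDomain (hmem n)
    exact ((hw n).smul (c n)).isDelaySolution hg
  have hunif := h.continuous_dependence 0 0 _ _ _ _
    ((isDelayPair_zero (Φ := Φ)).mem_delayDomain isWeakDeriv_zero) hmem hlim
    ((isDelayPair_zero (Φ := Φ)).isDelaySolution isWeakDeriv_zero) hsol b hb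
  obtain ⟨n, hn⟩ := (Metric.tendstoUniformlyOn_iff.1 hunif 1 one_pos).exists
  have h1 := hn (t n) (ht n)
  rw [dist_eq_norm, ContinuousMap.zero_apply, zero_sub, norm_neg, Pi.smul_apply, norm_smul,
    Real.norm_of_nonneg (inv_nonneg.2 (norm_nonneg _)), inv_mul_cancel₀ (hpos n).ne'] at h1
  exact lt_irrefl _ h1

/-- If the delay equation is well-posed, then the operator matrix is a generator: the history
segments of the classical solutions are its mild solutions. -/
theorem DelayWellPosed.generates (h : DelayWellPosed p A Φ) (hp : p ≠ ⊤) (hA : A.IsClosed)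
    (hAd : Dense (A.domain : Set X)) : GeneratesC0Semigroup (delayOp p A Φ) := by
  choose K hK using h.exists_bound
  refine generates_of_mild (C := fun b => 1 + |K b|) (delayOp_isClosed hA)
    (delayOp_dense_domain (Φ := Φ) hp hAd) ?_ ?_
  · rintro ⟨x, f⟩ hz
    have hz' : (x, f) ∈ delayDomain p A := by
      rw [← delayOp_domain p A Φ]
      exact hz
    obtain ⟨u, hu⟩ := h.exists_solution x f hz'
    obtain ⟨w, v, hw, -⟩ := hu.exists_pair
    refine ⟨fun t => (w t, contToLp p (historySegment w t)),
      ⟨w.continuous.prodMk (continuous_contToLp_historySegment w), fun t ht => ?_⟩,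
      fun b hb t ht => ?_⟩
    · rw [Prod.mk_sub_mk, hw.history]
      refine integral_mem_delayOp_graph ?_
      rw [delay_integralSegment]
      exact hw.integral_mem_graph hA ht
    · have h1 : ∀ s ∈ Icc 0 b, ‖w s‖ ≤ |K b| * ‖(x, f)‖ := fun s hs =>
        (hK b x f w v hz' hw s hs).trans
          (mul_le_mul_of_nonneg_right (le_abs_self _) (norm_nonneg _))
      have h2 := norm_historySegment_le (p := p) w ht.1 (by positivity)
        fun s hs => h1 s ⟨hs.1, hs.2.trans ht.2⟩
      rw [← hw.history] at h2
      have h3 : ‖f‖ ≤ ‖(x, f)‖ := norm_snd_le (x, f)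
      rw [Prod.norm_mk, add_mul, one_mul]
      exact max_le ((h1 t ht).trans (le_add_of_nonneg_left (norm_nonneg _)))
        (h2.trans (by gcongr))
  · intro u hu
    have hu1 : Continuous fun t => (u t).1 := continuous_fst.comp hu.continuous
    have hu2 : Continuous fun t => (u t).2 := continuous_snd.comp hu.continuous
    have hu0 : (u 0).1 = 0 := by rw [hu.map_zero]; rfl
    let w : C(ℝ, X) := ⟨fun t => (u (max t 0)).1, hu1.comp (continuous_id.max continuous_const)⟩
    have hwpos : ∀ t, 0 ≤ t → w t = (u t).1 := fun t ht => by
      change (u (max t 0)).1 = _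
      rw [max_eq_left ht]
    have hwneg : ∀ t ≤ 0, w t = 0 := fun t ht => by
      change (u (max t 0)).1 = _
      rw [max_eq_right ht, hu0]
    have hw0 : historySegment w 0 = 0 := by
      ext σ
      rw [historySegment_apply, zero_add, hwneg _ σ.2.2, ContinuousMap.zero_apply]
    have hwi : ∀ t, 0 ≤ t → ∫ s in (0 : ℝ)..t, w s = ∫ s in (0 : ℝ)..t, (u s).1 := fun t ht =>
      integral_max_zero (fun t => (u t).1) ht
    have hmem : ∀ t, 0 ≤ t → ∃ F : C(Icc (-1 : ℝ) 0, X),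
        ∫ s in (0 : ℝ)..t, (u s).2 = contToLp p F ∧
        (∫ s in (0 : ℝ)..t, w s, w t - Φ F) ∈ A.graph ∧
        ∀ σ : Icc (-1 : ℝ) 0, F σ = (∫ s in (0 : ℝ)..t, w s) + ∫ s in (0 : ℝ)..σ, (u t).2 s := by
      intro t ht
      have h1 := hu.mem_graph t ht
      rw [sub_zero, intervalIntegral_prodMk hu1 hu2, ← hwi t ht] at h1
      obtain ⟨F, hF, -, hA', hFσ⟩ := mem_delayOp_graph_iff.1 h1
      rw [← hwpos t ht] at hA'
      exact ⟨F, hF, hA', hFσ⟩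
    have htr := eq_historySegment_of_transport (w := w) hu2 fun t ht => by
      obtain ⟨F, hF, -, hFσ⟩ := hmem t ht
      refine ⟨F, hF, ?_⟩
      rwa [hw0, _root_.map_zero, sub_zero]
    -- the primitive of the first component is a classical solution with zero initial values
    let W : C(ℝ, X) := ⟨fun t => ∫ s in (0 : ℝ)..t, w s,
      intervalIntegral.continuous_primitive (fun a b => w.continuous.intervalIntegrable a b) 0⟩
    have hWneg : ∀ t ≤ 0, W t = 0 := fun t ht => by
      change ∫ s in (0 : ℝ)..t, w s = 0
      rw [intervalIntegral.integral_congr (g := fun _ => 0) fun s hs => ?_,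
        intervalIntegral.integral_zero]
      rw [uIcc_of_ge ht] at hs
      exact hwneg s hs.2
    have hWseg : ∀ t, historySegment W t = integralSegment w t := fun t => by
      ext σ
      have h1 : ∫ s in (0 : ℝ)..σ, w s = 0 := hWneg _ σ.2.2
      rw [historySegment_apply, integralSegment_apply,
        ← intervalIntegral.integral_interval_sub_left
          (w.continuous.intervalIntegrable 0 (t + σ)) (w.continuous.intervalIntegrable 0 σ), h1,
        sub_zero]
      rfl
    have hW : IsDelayPair p A Φ 0 0 W w := by
      refine ⟨?_, fun t _ => (zero_add _).symm, fun t ht => ?_⟩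
      · have h1 : integralSegment w 0 = 0 := intervalIntegral.integral_same
        rw [hWseg, h1, _root_.map_zero]
      · obtain ⟨F, hF, hA', -⟩ := hmem t ht
        have h1 : F = integralSegment w t := by
          refine contToLp_injective (p := p) ?_
          rw [← hF, ← integral_contToLp_historySegment]
          refine intervalIntegral.integral_congr fun s hs => ?_
          rw [uIcc_of_le ht] at hs
          exact htr s hs.1
        rw [hWseg, ← h1]
        exact hA'
    have h0 := h.unique_solution 0 0
      ((isDelayPair_zero (Φ := Φ)).mem_delayDomain isWeakDeriv_zero) _ _
      (hW.isDelaySolution isWeakDeriv_zero)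
      ((isDelayPair_zero (Φ := Φ)).isDelaySolution isWeakDeriv_zero)
    have hW0 : ∀ t, W t = 0 := fun t => by
      rcases le_total t 0 with ht | ht
      · exact hWneg t ht
      · exact h0 (mem_Ici.2 (by linarith))
    have hw : w = 0 := by
      ext t
      have h1 : HasDerivAt W (w t) t := hasDerivAt_primitive w.continuous 0 t
      have h2 : (W : ℝ → X) = fun _ => 0 := funext hW0
      rw [h2] at h1
      exact h1.unique (hasDerivAt_const t 0)
    intro t ht
    refine Prod.ext ?_ ?_
    · rw [← hwpos t ht, hw]; rfl
    · have h1 : historySegment (0 : C(ℝ, X)) t = 0 := rfl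
      rw [htr t ht, hw, h1, _root_.map_zero]
      rfl

/-! ### From the operator matrix to the operator -/

/-- Minus the first component of the solution operators of a semigroup on `X × L^p([-1,0],X)`,
applied to a value with zero history. The sign is that of the inhomogeneity `(-Φ v_s, 0)`. -/
noncomputable def delayResponse (T : ℝ → (X × DelayLp X p) →L[𝕜] (X × DelayLp X p)) (t : ℝ) :
    X →L[𝕜] X :=
  -((ContinuousLinearMap.fst 𝕜 X (DelayLp X p)).comp
    ((T (max t 0)).comp (ContinuousLinearMap.inl 𝕜 X (DelayLp X p))))

variable {T : ℝ → (X × DelayLp X p) →L[𝕜] (X × DelayLp X p)}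

theorem delayResponse_apply (t : ℝ) (x : X) : delayResponse T t x = -(T (max t 0) (x, 0)).1 := rfl

theorem continuous_delayResponse (hT : IsC0Semigroup T) :
    Continuous fun q : ℝ × X => delayResponse T q.1 q.2 :=
  (continuous_fst.comp (hT.continuous_uncurry.comp
    (continuous_fst.prodMk (continuous_snd.prodMk continuous_const)))).neg

/-- With the inhomogeneity `(-Φ w_s, 0)`, the variation of constants formula for the operator matrix
has a first component of Volterra form. -/
theorem fst_variationOfConstants (hT : IsC0Semigroup T) (z : X × DelayLp X p) (w : C(ℝ, X))
    {t : ℝ} (ht : 0 ≤ t) :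
    (IsC0Semigroup.variationOfConstants T z
      (fun s => (-Φ (historySegment w s), (0 : DelayLp X p))) t).1 =
      (T t z).1 + volterraOp Φ (continuous_delayResponse hT) w t := by
  have hk : Continuous fun s => (-Φ (historySegment w s), (0 : DelayLp X p)) :=
    (continuous_delay Φ w).neg.prodMk continuous_const
  have hc : Continuous fun s => T (max (t - s) 0) (-Φ (historySegment w s), (0 : DelayLp X p)) :=
    hT.continuous_uncurry.comp ((continuous_const.sub continuous_id).prodMk hk)
  have h1 := (ContinuousLinearMap.fst 𝕜 X (DelayLp X p)).intervalIntegral_comp_comm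
    (hc.intervalIntegrable (μ := volume) 0 t)
  rw [volterraOp_apply, IsC0Semigroup.variationOfConstants, max_eq_left ht, Prod.fst_add]
  congr 1
  refine h1.symm.trans (intervalIntegral.integral_congr fun s _ => ?_)
  simp only [delayResponse_apply, ContinuousLinearMap.coe_fst']
  have h2 : (-Φ (historySegment w s), (0 : DelayLp X p)) = -(Φ (historySegment w s), 0) := by
    rw [Prod.neg_mk, neg_zero]
  rw [h2, map_neg, Prod.fst_neg]

theorem integral_neg_delay (w : C(ℝ, X)) (t : ℝ) :
    ∫ s in (0 : ℝ)..t, (-Φ (historySegment w s), (0 : DelayLp X p)) =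
      (-∫ s in (0 : ℝ)..t, Φ (historySegment w s), 0) := by
  rw [intervalIntegral_prodMk (u := fun s => -Φ (historySegment w s))
    (continuous_delay Φ w).neg continuous_const, intervalIntegral.integral_neg,
    intervalIntegral.integral_zero]

/-- If the operator matrix generates a semigroup, then so does `A`: the mild solutions of
`u' = A u` are obtained from the semigroup by a Volterra equation that removes the delay term. -/
theorem generates_of_delayOp_generates (hA : A.IsClosed) (hΦ : HasDelayBound Φ κ) (hκ : 0 ≤ κ)
    (h : GeneratesC0Semigroup (delayOp p A Φ)) : GeneratesC0Semigroup A := by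
  obtain ⟨T, hT, hG⟩ := h
  have hL := continuous_delayResponse hT
  have hk : ∀ w : C(ℝ, X),
      Continuous fun s => (-Φ (historySegment w s), (0 : DelayLp X p)) := fun w =>
    (continuous_delay Φ w).neg.prodMk continuous_const
  choose M₀ hM₀ hTM using hT.exists_bound
  choose M hM hLM using exists_bound_of_continuous_uncurry hL
  refine generates_of_mild (D := ⊤)
    (C := fun b => (M₀ b + M b * κ) * Real.exp (M b * κ * b)) hA (by simp) ?_ ?_
  · -- the mild solution with initial value `x` comes from the constant history `x`
    intro x _
    set c : C(Icc (-1 : ℝ) 0, X) := ContinuousMap.const _ x with hc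
    have hcx : ‖contToLp p c‖ ≤ ‖x‖ := (norm_contToLp_le c).trans
      ((ContinuousMap.norm_le _ (norm_nonneg x)).2 fun _ => le_rfl)
    set z : X × DelayLp X p := (x, contToLp p c) with hz
    have hzx : ‖z‖ ≤ ‖x‖ := max_le le_rfl hcx
    obtain ⟨v, hv⟩ := exists_volterra_solution hL hΦ hκ
      (⟨fun t => (T (max t 0) z).1, continuous_fst.comp (hT.continuous_orbit z)⟩ : C(ℝ, X))
    have hv' : ∀ t, v t = (T (max t 0) z).1 + volterraOp Φ hL v t := fun t =>
      DFunLike.congr_fun hv t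
    have hvneg : historySegment v 0 = c := by
      ext σ
      rw [historySegment_apply, zero_add, hv', volterraOp_of_nonpos _ _ σ.2.2, add_zero,
        max_eq_right σ.2.2, hT.zero_apply]
      rfl
    let V : ℝ → X × DelayLp X p := IsC0Semigroup.variationOfConstants T z
      fun s => (-Φ (historySegment v s), (0 : DelayLp X p))
    have hV : Continuous V := hT.continuous_variationOfConstants z (hk v)
    have hV1 : ∀ t, 0 ≤ t → (V t).1 = v t := fun t ht => by
      rw [hv' t, max_eq_left ht]
      exact fst_variationOfConstants hT z v ht
    have hmem : ∀ t, 0 ≤ t → ∃ F : C(Icc (-1 : ℝ) 0, X),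
        ∫ s in (0 : ℝ)..t, (V s).2 = contToLp p F ∧
        (∫ s in (0 : ℝ)..t, v s,
          v t - x + (∫ s in (0 : ℝ)..t, Φ (historySegment v s)) - Φ F) ∈ A.graph ∧
        ∀ σ : Icc (-1 : ℝ) 0, F σ = (∫ s in (0 : ℝ)..t, v s) +
          ∫ s in (0 : ℝ)..σ, ((V t).2 - contToLp p c : DelayLp X p) s := by
      intro t ht
      have h1 := hT.variationOfConstants_mem_graph hG z (hk v) ht
      have h2 : ∫ s in (0 : ℝ)..t, V s = (∫ s in (0 : ℝ)..t, v s, ∫ s in (0 : ℝ)..t, (V s).2) := by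
        have h3 : ∫ s in (0 : ℝ)..t, v s = ∫ s in (0 : ℝ)..t, (V s).1 :=
          intervalIntegral.integral_congr fun s hs => by
            rw [uIcc_of_le ht] at hs
            exact (hV1 s hs.1).symm
        rw [h3]
        exact intervalIntegral_prodMk (continuous_fst.comp hV) (continuous_snd.comp hV) 0 t
      have h4 : V t - z - ∫ s in (0 : ℝ)..t, (-Φ (historySegment v s), (0 : DelayLp X p))
          = (v t - x + ∫ s in (0 : ℝ)..t, Φ (historySegment v s), (V t).2 - contToLp p c) := by
        rw [integral_neg_delay]
        refine Prod.ext ?_ ?_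
        · simp [hV1 t ht, hz]
        · simp [hz]
      change (∫ s in (0 : ℝ)..t, V s, V t - z - _) ∈ _ at h1
      rw [h2, h4] at h1
      obtain ⟨F, hF, -, hA', hFσ⟩ := mem_delayOp_graph_iff.1 h1
      exact ⟨F, hF, hA', hFσ⟩
    have htr := eq_historySegment_of_transport (w := v) (continuous_snd.comp hV) fun t ht => by
      obtain ⟨F, hF, -, hFσ⟩ := hmem t ht
      refine ⟨F, hF, ?_⟩
      rwa [hvneg]
    refine ⟨v, ⟨v.continuous, fun t ht => ?_⟩, fun b hb t ht => ?_⟩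
    · obtain ⟨F, hF, hA', -⟩ := hmem t ht
      have h1 : F = integralSegment v t := by
        refine contToLp_injective (p := p) ?_
        rw [← hF, ← integral_contToLp_historySegment]
        refine intervalIntegral.integral_congr fun s hs => ?_
        rw [uIcc_of_le ht] at hs
        exact htr s hs.1
      rwa [h1, delay_integralSegment, add_sub_cancel_right] at hA'
    · have h1 : ∀ t ∈ Icc 0 b,
          ‖v t‖ ≤ M₀ b * ‖x‖ + M b * ∫ s in (0 : ℝ)..t, ‖Φ (historySegment v s)‖ := by
        intro t ht
        rw [hv' t, max_eq_left ht.1]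
        refine (norm_add_le _ _).trans
          (add_le_add ?_ (norm_volterraOp_le_integral hL (hLM b) v ht))
        refine (norm_fst_le _).trans (((T t).le_of_opNorm_le (hTM b t ht) z).trans ?_)
        exact mul_le_mul_of_nonneg_left hzx (hM₀ b)
      refine (hΦ.gronwall hκ v (hM b) h1 t ht).trans ?_
      have h2 := (integral_norm_history_le p v).trans_eq (by rw [hvneg])
      have h3 : 0 ≤ M b * κ := mul_nonneg (hM b) hκ
      rw [mul_right_comm (M₀ b + M b * κ), add_mul (M₀ b)]
      exact mul_le_mul_of_nonneg_right
        (add_le_add_right (mul_le_mul_of_nonneg_left (h2.trans hcx) h3) _) (Real.exp_nonneg _)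
  · intro u hu
    have hu0 : u 0 = 0 := hu.map_zero
    let w : C(ℝ, X) := ⟨fun t => u (max t 0), hu.continuous.comp
      (continuous_id.max continuous_const)⟩
    have hwpos : ∀ t, 0 ≤ t → w t = u t := fun t ht => by
      change u (max t 0) = _
      rw [max_eq_left ht]
    have hw0 : historySegment w 0 = 0 := by
      ext σ
      rw [historySegment_apply, zero_add]
      change u (max (σ : ℝ) 0) = 0
      rw [max_eq_right σ.2.2, hu0]
    have h1 := hT.eq_variationOfConstants hG (x := 0)
      (u := fun t => (w t, contToLp p (historySegment w t)))
      (w.continuous.prodMk (continuous_contToLp_historySegment w)) (hk w) fun t ht => by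
        have h2 := integral_mem_delayOp_graph (p := p) (A := A) (Φ := Φ) (w := w) (t := t)
          (y := w t + Φ (integralSegment w t)) (by
            have h3 := hu.mem_graph t ht
            rw [sub_zero, ← integral_max_zero u ht] at h3
            rw [add_sub_cancel_right, hwpos t ht]
            exact h3)
        rw [hw0, _root_.map_zero, sub_zero, delay_integralSegment] at h2
        rw [integral_neg_delay, sub_zero, Prod.mk_sub_mk, sub_neg_eq_add, sub_zero]
        exact h2
    have h2 : ∀ t, 0 ≤ t → w t = volterraOp Φ hL w t := fun t ht => by
      have h3 := congrArg Prod.fst (h1 t ht)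
      rw [fst_variationOfConstants hT 0 w ht, _root_.map_zero, Prod.fst_zero, zero_add] at h3
      exact h3
    intro t ht
    have h3 := hΦ.gronwall (α := 0) (b := t) hκ w (hM t) (fun s hs => by
      rw [zero_add, h2 s hs.1]
      exact norm_volterraOp_le_integral hL (hLM t) w hs) t ⟨ht, le_rfl⟩
    have h4 := integral_norm_history_le p w
    rw [hw0, _root_.map_zero, norm_zero] at h4
    have h5 : ‖w t‖ ≤ 0 := by
      refine h3.trans (mul_nonpos_of_nonpos_of_nonneg ?_ (Real.exp_nonneg _))
      rw [zero_add]
      exact mul_nonpos_of_nonneg_of_nonpos (mul_nonneg (hM t) hκ) h4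
    rw [← hwpos t ht]
    exact norm_le_zero_iff.1 h5

end Necessity

/-! ### The Miyadera estimate -/

section Miyadera

variable {𝕜 : Type*} [RCLike 𝕜] {X : Type*} [NormedAddCommGroup X] [NormedSpace 𝕜 X]
  [NormedSpace ℝ X] [IsScalarTower ℝ 𝕜 X] [CompleteSpace X] {p : ℝ≥0∞} [Fact (1 ≤ p)]
  {A : X →ₗ.[𝕜] X} {Φ : C(Icc (-1 : ℝ) 0, X) →L[𝕜] X} {S : ℝ → X →L[𝕜] X} {κ : ℝ}

theorem one_le_toReal (hp : p ≠ ⊤) : 1 ≤ p.toReal := by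
  simpa using ENNReal.toReal_mono hp (Fact.out : 1 ≤ p)

/-- Hölder's inequality on a subinterval of `[-1,0]`. -/
theorem DelayLp.intervalIntegral_norm_le_rpow (f : DelayLp X p) {a b : ℝ} (ha : -1 ≤ a)
    (hab : a ≤ b) (hb : b ≤ 0) :
    ∫ s in a..b, ‖f s‖ ≤ (b - a) ^ (1 - 1 / p.toReal) * ‖f‖ := by
  have hsub : Ioc a b ⊆ Icc (-1 : ℝ) 0 := fun s hs => ⟨ha.trans hs.1.le, hs.2.trans hb⟩
  have hmono : volume.restrict (Ioc a b) ≤ delayMeasure := Measure.restrict_mono hsub le_rfl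
  have hm : AEStronglyMeasurable f (volume.restrict (Ioc a b)) :=
    (Lp.aestronglyMeasurable f).mono_measure hmono
  have h1 := eLpNorm_le_eLpNorm_mul_rpow_measure_univ (p := 1) (q := p) Fact.out hm
  have h2 := h1.trans (mul_le_mul_left (eLpNorm_mono_measure f hmono) _)
  rw [intervalIntegral.integral_of_le hab, integral_norm_eq_lintegral_enorm hm,
    ← eLpNorm_one_eq_lintegral_enorm]
  rw [Measure.restrict_apply_univ, Real.volume_Ioc, ENNReal.toReal_one, div_one,
    ENNReal.ofReal_rpow_of_nonneg (sub_nonneg.2 hab) ?_] at h2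
  · refine (ENNReal.toReal_mono ?_ h2).trans (le_of_eq ?_)
    · exact ENNReal.mul_ne_top (Lp.eLpNorm_ne_top f) ENNReal.ofReal_ne_top
    · rw [ENNReal.toReal_mul, ENNReal.toReal_ofReal (Real.rpow_nonneg (sub_nonneg.2 hab) _),
        Lp.norm_def, mul_comm]
  · rw [sub_nonneg]
    rcases eq_or_ne p ⊤ with rfl | hp
    · simp
    · rw [div_le_one₀]
      · exact one_le_toReal hp
      · exact one_pos.trans_le (one_le_toReal hp)

/-- The estimate behind condition (M), with any bound `M` of the semigroup on `[0,1]` such that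
`‖f‖ ≤ M ‖f‖` for all histories. -/
theorem miyaderaEstimate_of_hasDelayBound (hp : p ≠ ⊤) (hS : IsC0Semigroup S)
    (hΦ : HasDelayBound Φ κ) {M : ℝ} (hM : ∀ r ∈ Icc (0 : ℝ) 1, ‖S r‖ ≤ M)
    (hM1 : ∀ f : DelayLp X p, ‖f‖ ≤ M * ‖f‖) {t : ℝ} (ht0 : 0 ≤ t) (ht1 : t ≤ 1) :
    MiyaderaEstimate p A S Φ t (t ^ (1 - 1 / p.toReal) * M * κ) := by
  rintro x f hxf
  obtain ⟨F, -, rfl, hF0, -, -⟩ := eq_contToLp_of_mem_delayDomain hxf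
  have h10 : (-1 : ℝ) ≤ 0 := by norm_num
  have hp1 : 1 ≤ p.toReal := one_le_toReal hp
  have hα0 : 0 ≤ 1 - 1 / p.toReal := by
    rw [sub_nonneg, div_le_one₀ (by linarith)]
    exact hp1
  have hα1 : 1 - 1 / p.toReal ≤ 1 := sub_le_self _ (by positivity)
  have hM0 : 0 ≤ M := (norm_nonneg _).trans (hM 0 ⟨le_rfl, zero_le_one⟩)
  let w : C(ℝ, X) := ⟨fun t => IccExtend h10 F t + (S (max t 0) x - x),
    (continuous_iccExtend_delay F).add ((hS.continuous_orbit x).sub continuous_const)⟩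
  have hwpos : ∀ s, 0 ≤ s → w s = S s x := fun s hs => by
    change IccExtend h10 F s + (S (max s 0) x - x) = _
    have : F ⟨0, right_mem_Icc.2 h10⟩ = x := hF0
    rw [max_eq_left hs, IccExtend_of_right_le _ _ hs, this]
    abel
  have hwneg : ∀ s (hs : s ∈ Icc (-1 : ℝ) 0), w s = F ⟨s, hs⟩ := fun s hs => by
    change IccExtend h10 F s + (S (max s 0) x - x) = _
    rw [max_eq_right hs.2, hS.zero_apply, sub_self, add_zero, IccExtend_of_mem _ _ hs]
  have hrep := (isContRep_iff_eq_contToLp (p := p) F _).2 rfl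
  refine ⟨historySegment w, fun r hr => ?_, (continuous_delay Φ w).norm.intervalIntegrable _ _, ?_⟩
  · have h1 := (measurePreserving_add_left volume r).quasiMeasurePreserving.ae hrep
    filter_upwards [h1] with τ hτ hs
    rw [historySegment_apply, Pi.add_apply, orbitSegment, leftShift]
    rcases lt_or_ge 0 (r + τ) with h0 | h0
    · rw [if_pos (by linarith), if_neg (not_le.2 h0), add_zero, hwpos _ h0.le]
    · have h2 : r + τ ∈ Icc (-1 : ℝ) 0 := ⟨by linarith [hr.1, hs.1], h0⟩
      rw [if_neg (by linarith), if_pos h0, zero_add, hτ h2, ← hwneg _ h2]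
  · have hw : ∀ a b, -1 ≤ a → a ≤ b → b ≤ 0 → b - a ≤ t →
        ∫ s in a..b, ‖w s‖ ≤ t ^ (1 - 1 / p.toReal) * ‖contToLp p F‖ := by
      intro a b ha hab hb hbt
      have h1 := DelayLp.intervalIntegral_norm_le_rpow (contToLp p F) ha hab hb
      have h2 : ∫ s in a..b, ‖w s‖ = ∫ s in a..b, ‖contToLp p F s‖ := by
        refine intervalIntegral.integral_congr_ae ?_
        filter_upwards [hrep] with s hs hs'
        rw [uIoc_of_le hab] at hs'
        have h3 : s ∈ Icc (-1 : ℝ) 0 := ⟨ha.trans hs'.1.le, hs'.2.trans hb⟩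
        rw [hs h3, hwneg s h3]
      rw [h2]
      refine h1.trans (mul_le_mul_of_nonneg_right ?_ (norm_nonneg _))
      exact Real.rpow_le_rpow (sub_nonneg.2 hab) hbt hα0
    have htα : 0 ≤ t ^ (1 - 1 / p.toReal) := Real.rpow_nonneg ht0 _
    have hf := mul_le_mul_of_nonneg_left (hM1 (contToLp p F)) htα
    refine (hΦ w t (t ^ (1 - 1 / p.toReal) * M * (‖contToLp p F‖ + ‖x‖)) ht0
      fun σ hσ => ?_).trans (le_of_eq (by ring))
    have hx0 : 0 ≤ t ^ (1 - 1 / p.toReal) * M * ‖x‖ := by positivity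
    rcases le_total (t + σ) 0 with h0 | h0
    · have h1 := hw σ (t + σ) hσ.1 (by linarith) h0 (by linarith)
      linarith
    · have h1 := hw σ 0 hσ.1 hσ.2 le_rfl (by linarith)
      have h2 : ∫ s in (0 : ℝ)..(t + σ), ‖w s‖ ≤ t ^ (1 - 1 / p.toReal) * (M * ‖x‖) := by
        have h3 : ∫ s in (0 : ℝ)..(t + σ), ‖w s‖ ≤ ∫ s in (0 : ℝ)..(t + σ), M * ‖x‖ := by
          refine intervalIntegral.integral_mono_on h0
            (w.continuous.norm.intervalIntegrable _ _) intervalIntegrable_const fun s hs => ?_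
          rw [hwpos s hs.1]
          exact (S s).le_of_opNorm_le (hM s ⟨hs.1, by linarith [hs.2, hσ.2]⟩) x
        rw [intervalIntegral.integral_const, sub_zero, smul_eq_mul] at h3
        refine h3.trans (mul_le_mul_of_nonneg_right ?_ (by positivity))
        exact (by linarith [hσ.2] : t + σ ≤ t).trans
          (Real.self_le_rpow_of_le_one ht0 ht1 hα1)
      rw [← intervalIntegral.integral_add_adjacent_intervals
        (w.continuous.norm.intervalIntegrable σ 0) (w.continuous.norm.intervalIntegrable 0 (t + σ))]
      linarith

theorem IsC0Semigroup.norm_le_sSup (hS : IsC0Semigroup S) :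
    ∀ r ∈ Icc (0 : ℝ) 1, ‖S r‖ ≤ sSup ((fun r => ‖S r‖) '' Icc 0 1) := by
  intro r hr
  obtain ⟨M, -, hM⟩ := hS.exists_bound 1
  refine le_csSup ⟨M, ?_⟩ (mem_image_of_mem _ hr)
  rintro _ ⟨s, hs, rfl⟩
  exact hM s hs

/-- The bound of the semigroup on `[0,1]` is at least `‖S 0‖ = 1`, unless `X` is trivial. -/
theorem IsC0Semigroup.norm_le_sSup_mul (hS : IsC0Semigroup S) (f : DelayLp X p) :
    ‖f‖ ≤ sSup ((fun r => ‖S r‖) '' Icc 0 1) * ‖f‖ := by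
  rcases subsingleton_or_nontrivial X with hX | hX
  · have : f = 0 := Lp.ext (Eventually.of_forall fun _ => Subsingleton.elim _ _)
    rw [this, norm_zero, mul_zero]
  · have h1 := hS.norm_le_sSup 0 ⟨le_rfl, zero_le_one⟩
    rw [hS.map_zero, ContinuousLinearMap.norm_id] at h1
    exact le_mul_of_one_le_left (norm_nonneg _) h1

theorem conditionM_of_estimate {α C : ℝ} (hα : 0 < α) (hC : 0 ≤ C)
    (h : ∀ t : ℝ, 0 < t → t < 1 → MiyaderaEstimate p A S Φ t (t ^ α * C)) :
    ConditionM p A S Φ := by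
  have h1 : Tendsto (fun t : ℝ => t ^ α * C) (𝓝[>] 0) (𝓝 0) := by
    have h2 := ((Real.continuousAt_rpow_const 0 α (Or.inr hα.le)).tendsto.mul_const C).mono_left
      (nhdsWithin_le_nhds (s := Ioi 0))
    rwa [Real.zero_rpow hα.ne', zero_mul] at h2
  obtain ⟨t, ht1, ht⟩ := ((h1.eventually (gt_mem_nhds zero_lt_one)).and
    (Ioo_mem_nhdsGT zero_lt_one)).exists
  exact ⟨t, _, ht.1, mul_nonneg (Real.rpow_nonneg ht.1.le _) hC, ht1, h t ht.1 ht.2⟩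

end Miyadera

theorem mainTheorem3 {𝕜 : Type*} [RCLike 𝕜] {X : Type*} [NormedAddCommGroup X]
    [NormedSpace 𝕜 X] [NormedSpace ℝ X] [IsScalarTower ℝ 𝕜 X] [CompleteSpace X]
    (p : ℝ≥0∞) [Fact (1 ≤ p)] (hp1 : 1 < p) (hp : p ≠ ⊤)
    (p' : ℝ) (hpp' : 1 / p.toReal + 1 / p' = 1)
    (η : ℝ → X →L[𝕜] X) (hη : BoundedVariationOn η (Icc (-1 : ℝ) 0)) :
    -- the Riemann-Stieltjes integral defines a bounded operator on `C([-1,0],X)`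
    ∃ Φ : C(Icc (-1 : ℝ) 0, X) →L[𝕜] X, (∀ F, HasRSIntegral η F (Φ F)) ∧
      -- `W^{1,p}` embeds in `C([-1,0],X)`, and the operator is bounded on `W^{1,p}`
      (∃ C : ℝ, ∀ f g : DelayLp X p, IsWeakDeriv f g →
        ∃ F : C(Icc (-1 : ℝ) 0, X), IsContRep F f ∧ ‖Φ F‖ ≤ C * (‖f‖ + ‖g‖)) ∧
      -- the explicit estimate, condition (M), generation and well-posedness
      (∀ (A : X →ₗ.[𝕜] X) (S : ℝ → X →L[𝕜] X), IsC0Semigroup S → IsGeneratorOf A S →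
        (∀ t : ℝ, 0 < t → t < 1 → MiyaderaEstimate p A S Φ t
          (t ^ (1 / p') * sSup ((fun r => ‖S r‖) '' Icc 0 1) * totalVar η)) ∧
        ConditionM p A S Φ ∧
        GeneratesC0Semigroup (delayOp p A Φ) ∧
        DelayWellPosed p A Φ) ∧
      -- necessity: for closed densely defined `A`, generation of `A` is equivalent to both
      (∀ A : X →ₗ.[𝕜] X, A.IsClosed → Dense (A.domain : Set X) →
        (DelayWellPosed p A Φ ↔ GeneratesC0Semigroup A) ∧
        (GeneratesC0Semigroup (delayOp p A Φ) ↔ GeneratesC0Semigroup A)) := by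
  obtain ⟨Φ, hΦ, hlim⟩ := exists_rsOperator hη
  have hκ : 0 ≤ totalVar η := ENNReal.toReal_nonneg
  have hb : HasDelayBound Φ (totalVar η) := hasDelayBound_of_tendsto hη hlim
  have hp1' : 1 < p.toReal := by
    simpa using (ENNReal.toReal_lt_toReal ENNReal.one_ne_top hp).2 hp1
  have hα : 1 / p' = 1 - 1 / p.toReal := by linarith
  have hwp : ∀ A : X →ₗ.[𝕜] X, GeneratesC0Semigroup A → DelayWellPosed p A Φ :=
    fun A ⟨S, hS, hA⟩ => delayWellPosed_of_generator hp hS hA hb hκ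
  refine ⟨Φ, hΦ, ⟨‖Φ‖, fun f g hfg => ?_⟩, fun A S hS hA => ?_, fun A hA hAd => ?_⟩
  · obtain ⟨F, rfl⟩ := exists_contRep hfg
    exact ⟨F, (isContRep_iff_eq_contToLp _ _).2 rfl,
      (Φ.le_opNorm F).trans (mul_le_mul_of_nonneg_left
        (norm_contRep_le ((isWeakDeriv_contToLp_iff F g).1 hfg)) (norm_nonneg _))⟩
  · have hM0 : 0 ≤ sSup ((fun r => ‖S r‖) '' Icc 0 1) :=
      (norm_nonneg _).trans (hS.norm_le_sSup 0 ⟨le_rfl, zero_le_one⟩)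
    have hest : ∀ t : ℝ, 0 < t → t < 1 → MiyaderaEstimate p A S Φ t
        (t ^ (1 / p') * sSup ((fun r => ‖S r‖) '' Icc 0 1) * totalVar η) := fun t ht0 ht1 => by
      rw [hα]
      exact miyaderaEstimate_of_hasDelayBound hp hS hb hS.norm_le_sSup hS.norm_le_sSup_mul
        ht0.le ht1.le
    have hW := hwp A ⟨S, hS, hA⟩
    refine ⟨hest, ?_, hW.generates hp (hS.isClosed_generator hA) (hS.dense_domain hA), hW⟩
    refine conditionM_of_estimate (α := 1 / p') ?_ (mul_nonneg hM0 hκ) fun t ht0 ht1 => ?_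
    · rw [hα, sub_pos, div_lt_one (by linarith)]
      exact hp1'
    · rw [← mul_assoc]
      exact hest t ht0 ht1
  · have hgen : GeneratesC0Semigroup (delayOp p A Φ) → GeneratesC0Semigroup A :=
      generates_of_delayOp_generates hA hb hκ
    exact ⟨⟨fun h => hgen (h.generates hp hA hAd), hwp A⟩,
      ⟨hgen, fun h => (hwp A h).generates hp hA hAd⟩⟩
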